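/- Let $\Bbbk$ be a field of characteristic different from $2$. Superalgebras are $\mathbb Z_2$-graded and supercommutative (even elements are central, odd elements square to $0$), and $\mathsf{SAlgf}_\Bbbk$ is the category of finite-dimensional $\Bbbk$-superalgebras. A formal $\Bbbk$-superscheme is a functor $\mathfrak X:\mathsf{SAlgf}_\Bbbk\to\mathsf{Sets}$ isomorphic to the inductive limit of a filtered system of functors $\mathrm{SSpf}\,A_\lambda=\mathrm{Hom}(A_\lambda,-)$, $A_\lambda\in\mathsf{SAlgf}_\Bbbk$, with transition maps induced by surjections $A_\mu\to A_\lambda$. For a super-cocommutative super-coalgebra $\mathbf A$ over $\Bbbk$, $\mathrm{Sp}^*\mathbf A$ is the functor $R\mapsto G_R(R\otimes\mathbf A)$ of even group-like elements; $\mathrm{Sp}^*$ is an equivalence onto formal superschemes. The underlying set $|\mathfrak X|$ is the colimit of the prime spectra of $A$ over all pairs $(A,a)$, $a\in\mathfrak X(A)$; for $x\in|\mathfrak X|$, $\mathfrak X_x$ is the irreducible component of $\mathfrak X$ containing $x$, so that $\mathfrak X=\coprod_x\mathfrak X_x$, and $\mathcal O_x$ is the super-coalgebra with $\mathrm{Sp}^*\mathcal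 O_x\simeq\mathfrak X_x$. Let $\{x\}\subseteq\mathfrak X_x$ be $\mathrm{Sp}^*$ of the coradical of $\mathcal O_x$ (the sum of its simple sub-super-coalgebras). The fiber of a map $f:\mathfrak X\to\mathfrak Y$ over $y\in|\mathfrak Y|$ is $f^{-1}(y)=\mathfrak X\times_{\mathfrak Y}\{y\}\subseteq\mathfrak X$. A super-coalgebra $\mathbf A$ with coradical $\mathbf A_0$ is of finite type if $\mathbf A_1=\ker(\mathbf A\xrightarrow{\Delta}\mathbf A\otimes\mathbf A\to\mathbf A/\mathbf A_0\otimes\mathbf A/\mathbf A_0)$ is finite-dimensional. $\mathfrak X$ is algebraic at $x$ if $\mathcal O_x$ is of finite type, and locally algebraic if it is algebraic at every point. A map $f:\mathfrak X\to\mathfrak Y$ is locally of finite presentation (LOFP) if there are a locally algebraic formal superscheme $\mathfrak W$ and a closed immersion $i:\mathfrak X\to\mathfrak W\times\mathfrak Y$ with $f=\pi_2\circ i$; it is of finite presentation (OFP) at $x\in|\mathfrak X|$ if the induced map $\mathfrak X_x\to\mathfrak Y_{f(x)}$ is LOFP. Proposition. Let $f:\mathfrak X\to\mathfrak Y$ be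 a map of formal $\Bbbk$-superschemes. For every $x\in|\mathfrak X|$ there is exactly one point of $|f^{-1}(f(x))|$ lying over $x$, again denoted $x$, and $f$ is OFP at $x$ if and only if $f^{-1}(f(x))$ is algebraic at $x$. Moreover, $f$ is LOFP if and only if $f^{-1}(y)$ is locally algebraic for all $y\in|\mathfrak Y|$. -/

import Mathlib

open CategoryTheory Opposite
open scoped TensorProduct

universe u

namespace SuperFormal

noncomputable section

/-! ### Super vector spaces -/

section SuperVec

variable {k : Type u} [Field k] {V W : Type u} [AddCommGroup V] [Module k V]
  [AddCommGroup W] [Module k W]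

/-- The projection of a super vector space `V = V₀ ⊕ V₁` onto its part of parity `i`. -/
def parityProj (𝒱 : ZMod 2 → Submodule k V) [DirectSum.Decomposition 𝒱] (i : ZMod 2) :
    V →ₗ[k] V :=
  (𝒱 i).subtype ∘ₗ DirectSum.component k (ZMod 2) (fun j => 𝒱 j) i ∘ₗ
    (DirectSum.decomposeLinearEquiv 𝒱).toLinearMap

/-- The Koszul sign `(-1)^{i j}`. -/
def koszul (k : Type u) [Field k] (i j : ZMod 2) : k :=
  if i = 1 ∧ j = 1 then -1 else 1

/-- The part of parity `i` of the tensor product of two super vector spaces,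
`⨁_{p + q = i} V_p ⊗ W_q`. -/
def tensorPart (𝒱 : ZMod 2 → Submodule k V) (𝒲 : ZMod 2 → Submodule k W) (i : ZMod 2) :
    Submodule k (V ⊗[k] W) :=
  ⨆ p : ZMod 2, LinearMap.range (TensorProduct.map (𝒱 p).subtype (𝒲 (i - p)).subtype)

/-- The twisting map `v ⊗ w ↦ (-1)^{|v||w|} w ⊗ v`. -/
def twist (𝒱 : ZMod 2 → Submodule k V) (𝒲 : ZMod 2 → Submodule k W)
    [DirectSum.Decomposition 𝒱] [DirectSum.Decomposition 𝒲] : V ⊗[k] W →ₗ[k] W ⊗[k] V :=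
  ∑ i : ZMod 2, ∑ j : ZMod 2, koszul k i j •
    ((TensorProduct.comm k V W).toLinearMap ∘ₗ
      TensorProduct.map (parityProj 𝒱 i) (parityProj 𝒲 j))

end SuperVec

/-! ### Super-cocommutative super-coalgebras -/

/-- A (coassociative, counital) super-cocommutative super-coalgebra over `k`. -/
structure SuperCoalg (k : Type u) [Field k] where
  carrier : Type u
  [addCommGroup : AddCommGroup carrier]
  [module : Module k carrier]
  [coalgebra : Coalgebra k carrier]
  part : ZMod 2 → Submodule k carrier
  [decomposition : DirectSum.Decomposition part]
  comul_mem : ∀ (i : ZMod 2) (a : carrier), a ∈ part i →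
    Coalgebra.comul (R := k) a ∈ tensorPart part part i
  counit_odd : ∀ a ∈ part 1, Coalgebra.counit (R := k) a = 0
  super_cocomm : ∀ a : carrier,
    twist part part (Coalgebra.comul (R := k) a) = Coalgebra.comul (R := k) a

attribute [instance] SuperCoalg.addCommGroup SuperCoalg.module SuperCoalg.coalgebra
  SuperCoalg.decomposition

namespace SuperCoalg

variable {k : Type u} [Field k] (A : SuperCoalg k)

/-- `B` is a sub-super-coalgebra of `A`: a graded subspace with `Δ(B) ⊆ B ⊗ B`. -/
structure IsSub (B : Submodule k A.carrier) : Prop where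
  graded : ∀ b ∈ B, ∀ i : ZMod 2, parityProj A.part i b ∈ B
  comul_mem : ∀ b ∈ B, Coalgebra.comul (R := k) b ∈
    LinearMap.range (TensorProduct.map B.subtype B.subtype)

/-- `B` is a simple sub-super-coalgebra of `A`. -/
structure IsSimpleSub (B : Submodule k A.carrier) : Prop where
  isSub : A.IsSub B
  ne_bot : B ≠ ⊥
  eq_bot_or_eq : ∀ C : Submodule k A.carrier, A.IsSub C → C ≤ B → C = ⊥ ∨ C = B

/-- The coradical: the sum of all simple sub-super-coalgebras. -/
def corad : Submodule k A.carrier := sSup {B | A.IsSimpleSub B}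

/-- The wedge of `X` and `Y`: the kernel of `A → A ⊗ A → A/X ⊗ A/Y`. -/
def wedge (X Y : Submodule k A.carrier) : Submodule k A.carrier :=
  LinearMap.ker (TensorProduct.map X.mkQ Y.mkQ ∘ₗ Coalgebra.comul (R := k) (A := A.carrier))

/-- The iterated wedges of `X`, starting with `0` and `X`. -/
def wedgePow (X : Submodule k A.carrier) : ℕ → Submodule k A.carrier
  | 0 => ⊥
  | 1 => X
  | n + 2 => A.wedge (wedgePow X (n + 1)) X

/-- The `n`-th term of the coradical filtration, the `(n+1)`-st wedge power of the coradical. -/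
def coradFiltration (n : ℕ) : Submodule k A.carrier := A.wedgePow A.corad (n + 1)

/-- `A` is of finite type: the term of index `1` of the coradical filtration is
finite-dimensional. -/
def FiniteType : Prop := Module.Finite k (A.coradFiltration 1)

end SuperCoalg

/-! ### Finite-dimensional superalgebras and formal functors -/

/-- A finite-dimensional supercommutative superalgebra over `k`. -/
structure SAlgf (k : Type u) [Field k] where
  carrier : Type u
  [ring : Ring carrier]
  [algebra : Algebra k carrier]
  part : ZMod 2 → Submodule k carrier
  [gradedAlgebra : GradedAlgebra part]
  even_central : ∀ a ∈ part 0, ∀ b : carrier, a * b = b * a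
  odd_sq : ∀ a ∈ part 1, a * a = 0
  [finite : Module.Finite k carrier]

attribute [instance] SAlgf.ring SAlgf.algebra SAlgf.gradedAlgebra SAlgf.finite

/-- Morphisms are the parity-preserving homomorphisms of `k`-algebras. -/
instance (k : Type u) [Field k] : Category.{u} (SAlgf k) where
  Hom A B := A.part →ₐᵍ[k] B.part
  id A := GradedAlgHom.id k A.part
  comp f g := g.comp f

/-- Formal super `k`-functors. -/
abbrev FormalFunctor (k : Type u) [Field k] := SAlgf k ⥤ Type u

variable {k : Type u} [Field k]

/-- The underlying algebra homomorphism of a morphism of `SAlgf k`. -/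
def homAlg {R S : SAlgf k} (φ : R ⟶ S) : R.carrier →ₐ[k] S.carrier :=
  GradedAlgHom.toAlgHom φ

theorem parityProj_hom {R S : SAlgf k} (φ : R ⟶ S) (i : ZMod 2) (a : R.carrier) :
    parityProj S.part i (homAlg φ a) = homAlg φ (parityProj R.part i a) := by
  have h : ∀ j : ZMod 2, ∀ x : R.carrier, x ∈ R.part j →
      parityProj S.part i (homAlg φ x) = homAlg φ (parityProj R.part i x) := by
    intro j x hx
    have hx' : homAlg φ x ∈ S.part j := φ.map_mem hx
    have e1 : parityProj S.part i (homAlg φ x) =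
        ((DirectSum.decompose S.part (homAlg φ x) i : S.part i) : S.carrier) := rfl
    have e2 : parityProj R.part i x =
        ((DirectSum.decompose R.part x i : R.part i) : R.carrier) := rfl
    rw [e1, e2]
    by_cases hij : j = i
    · subst hij
      rw [DirectSum.decompose_of_mem_same _ hx, DirectSum.decompose_of_mem_same _ hx']
    · rw [DirectSum.decompose_of_mem_ne _ hx hij, DirectSum.decompose_of_mem_ne _ hx' hij,
        map_zero]
  induction a using DirectSum.Decomposition.inductionOn R.part with
  | zero => simp
  | homogeneous m => exact h _ _ m.2
  | add m m' hm hm' => simp only [map_add, hm, hm']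

/-- The formal functor `SSpf A = Hom(A, -)`. -/
abbrev SSpf (A : SAlgf k) : FormalFunctor k := coyoneda.obj (op A)

/-- `X` is a formal superscheme: it is isomorphic to the inductive limit of a filtered inductive
system of finite affine superschemes `SSpf (A l)` whose transition morphisms are
closed immersions, that is, are induced by surjections `A m → A l`. -/
def IsFormalSuperscheme (X : FormalFunctor k) : Prop :=
  ∃ (Λ : Type u) (_ : Preorder Λ) (_ : IsDirectedOrder Λ) (_ : Nonempty Λ)
    (A : Λ ⥤ (SAlgf k)ᵒᵖ),
    (∀ (l m : Λ) (h : l ⟶ m), Function.Surjective (homAlg (A.map h).unop)) ∧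
    Nonempty (X ≅ Limits.colimit (A ⋙ coyoneda))

/-! ### The underlying space -/

/-- The prime spectrum of a superalgebra: the superideals `p` such that `A/p` is a domain. -/
def Spec (A : SAlgf k) : Type u :=
  {p : Ideal A.carrier // (∀ a ∈ p, ∀ i : ZMod 2, parityProj A.part i a ∈ p) ∧ p.IsPrime}

/-- Inverse image of primes. -/
def Spec.comap {A B : SAlgf k} (φ : A ⟶ B) (p : Spec B) : Spec A :=
  ⟨p.1.comap (homAlg φ), by
    refine ⟨fun a ha i => ?_, ?_⟩
    · rw [Ideal.mem_comap, ← parityProj_hom]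
      exact p.2.1 _ ha i
    · have := p.2.2
      exact Ideal.IsPrime.comap _⟩

/-- The spectrum as a contravariant functor. -/
def specFunctor (k : Type u) [Field k] : (SAlgf k)ᵒᵖ ⥤ Type u where
  obj A := Spec A.unop
  map φ := ↾fun p => Spec.comap φ.unop p

/-- The set of points `|X|`: the colimit of the spectra of all `A`, over all pairs
`(A, a)` with `a ∈ X(A)`. -/
def Points (X : FormalFunctor k) : Type (u + 1) :=
  ((CategoryOfElements.π X).op ⋙ specFunctor k).ColimitType

/-- The image in `|X|` of `p ∈ Spec R` under the map `Spec R → |X|` given by `a ∈ X(R)`. -/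
def Points.mk (X : FormalFunctor k) (R : SAlgf k) (a : X.obj R) (p : Spec R) : Points X :=
  ((CategoryOfElements.π X).op ⋙ specFunctor k).ιColimitType (op (X.elementsMk R a)) p

theorem Points.mk_map (X : FormalFunctor k) {R S : SAlgf k} (φ : R ⟶ S) (a : X.obj R)
    (p : Spec S) : Points.mk X S (X.map φ a) p = Points.mk X R a (Spec.comap φ p) :=
  (((CategoryOfElements.π X).op ⋙ specFunctor k).ιColimitType_map
    (Quiver.Hom.op (⟨φ, rfl⟩ : X.elementsMk R a ⟶ X.elementsMk S (X.map φ a))) p).symm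

theorem Points.mk_app {X Y : FormalFunctor k} (f : X ⟶ Y) {R S : SAlgf k} (φ : R ⟶ S)
    (a : X.obj R) (b : X.obj S) (h : X.map φ a = b) (p : Spec S) :
    Points.mk Y S (f.app S b) p = Points.mk Y R (f.app R a) (Spec.comap φ p) := by
  subst h
  rw [NatTrans.naturality_apply, Points.mk_map]

/-- The map `|f| : |X| → |Y|`. -/
def Points.map {X Y : FormalFunctor k} (f : X ⟶ Y) : Points X → Points Y :=
  Quot.lift (fun z => Points.mk Y z.1.unop.1 (f.app _ z.1.unop.2) z.2) (by
    rintro ⟨⟨S, b⟩, q⟩ ⟨⟨R, a⟩, p⟩ ⟨⟨φ, hφ⟩, h⟩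
    refine Eq.symm ?_
    exact (congrArg (Points.mk Y R (f.app R a)) h).trans (Points.mk_app f φ a b hφ q).symm)

theorem Points.map_mk {X Y : FormalFunctor k} (f : X ⟶ Y) (R : SAlgf k) (a : X.obj R)
    (p : Spec R) : Points.map f (Points.mk X R a p) = Points.mk Y R (f.app R a) p := rfl

/-- The irreducible component `X_x`: the (open and closed) subfunctor of `X` of all
`a ∈ X(R)` such that the map `Spec R → |X|` takes no value other than `x`. -/
def component (X : FormalFunctor k) (x : Points X) : Subfunctor X where
  obj R := {a | ∀ p : Spec R, Points.mk X R a p = x}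
  map φ := by
    intro a ha p
    rw [Points.mk_map]
    exact ha _

/-- The morphism `X_x → Y_{f(x)}` induced by `f : X → Y`. -/
def componentMap {X Y : FormalFunctor k} (f : X ⟶ Y) (x : Points X) :
    (component X x).toFunctor ⟶ (component Y (Points.map f x)).toFunctor :=
  Subfunctor.lift ((component X x).ι ≫ f) (by
    rintro R _ ⟨⟨a, ha⟩, rfl⟩ p
    exact congrArg (Points.map f) (ha p))

/-! ### The formal superscheme of a super-coalgebra -/

/-- The product `(R ⊗ A) ⊗ (R ⊗ A) → R ⊗ A ⊗ A ≃ (R ⊗ A) ⊗_R (R ⊗ A)`,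
`(r ⊗ a) ⊗ (s ⊗ b) ↦ (-1)^{|a||s|} r s ⊗ a ⊗ b`. -/
def tensorOver (R : SAlgf k) (A : SuperCoalg k) :
    (R.carrier ⊗[k] A.carrier) ⊗[k] (R.carrier ⊗[k] A.carrier) →ₗ[k]
      R.carrier ⊗[k] (A.carrier ⊗[k] A.carrier) :=
  ∑ i : ZMod 2, ∑ j : ZMod 2, koszul k i j •
    (TensorProduct.map (LinearMap.mul' k R.carrier) LinearMap.id ∘ₗ
      (TensorProduct.tensorTensorTensorComm k R.carrier A.carrier R.carrier
        A.carrier).toLinearMap ∘ₗ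
      TensorProduct.map
        (TensorProduct.map LinearMap.id (parityProj A.part i))
        (TensorProduct.map (parityProj R.part j) LinearMap.id))

/-- The group-like elements of the super-coalgebra `R ⊗ A` over `R`. -/
structure IsGroupLike (R : SAlgf k) (A : SuperCoalg k) (v : R.carrier ⊗[k] A.carrier) :
    Prop where
  even : v ∈ tensorPart R.part A.part 0
  comul : TensorProduct.map LinearMap.id (Coalgebra.comul (R := k)) v = tensorOver R A (v ⊗ₜ v)
  counit : TensorProduct.rid k R.carrier
    (TensorProduct.map LinearMap.id (Coalgebra.counit (R := k)) v) = 1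

/-- The map `R ⊗ A → S ⊗ A` induced by `R → S`. -/
def baseMap {R S : SAlgf k} (φ : R ⟶ S) (A : SuperCoalg k) :
    R.carrier ⊗[k] A.carrier →ₗ[k] S.carrier ⊗[k] A.carrier :=
  TensorProduct.map (homAlg φ).toLinearMap LinearMap.id

theorem tensorOver_tmul (R : SAlgf k) (A : SuperCoalg k) (r s : R.carrier) (a b : A.carrier) :
    tensorOver R A ((r ⊗ₜ a) ⊗ₜ (s ⊗ₜ b)) = ∑ i : ZMod 2, ∑ j : ZMod 2, koszul k i j •
      ((r * parityProj R.part j s) ⊗ₜ[k] (parityProj A.part i a ⊗ₜ[k] b)) := by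
  simp [tensorOver, LinearMap.sum_apply]

theorem tensorOver_baseMap {R S : SAlgf k} (φ : R ⟶ S) (A : SuperCoalg k)
    (v w : R.carrier ⊗[k] A.carrier) :
    tensorOver S A (baseMap φ A v ⊗ₜ baseMap φ A w) =
      TensorProduct.map (homAlg φ).toLinearMap LinearMap.id (tensorOver R A (v ⊗ₜ w)) := by
  induction v with
  | zero => simp
  | add v v' hv hv' => simp only [map_add, TensorProduct.add_tmul, hv, hv']
  | tmul r a =>
    induction w with
    | zero => simp
    | add w w' hw hw' => simp only [map_add, TensorProduct.tmul_add, hw, hw']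
    | tmul s b =>
      simp only [baseMap, TensorProduct.map_tmul, LinearMap.id_apply, tensorOver_tmul, map_sum,
        map_smul, AlgHom.toLinearMap_apply, map_mul, parityProj_hom]

theorem IsGroupLike.baseMap {R S : SAlgf k} (φ : R ⟶ S) {A : SuperCoalg k}
    {v : R.carrier ⊗[k] A.carrier} (hv : IsGroupLike R A v) :
    IsGroupLike S A (baseMap φ A v) where
  even := by
    have hle : tensorPart R.part A.part 0 ≤
        (tensorPart S.part A.part 0).comap (SuperFormal.baseMap φ A) := by
      refine iSup_le fun p => ?_
      rintro _ ⟨t, rfl⟩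
      induction t with
      | zero => simp
      | add t t' ht ht' => rw [map_add]; exact Submodule.add_mem _ ht ht'
      | tmul r a =>
        refine Submodule.mem_iSup_of_mem p ⟨⟨homAlg φ r, φ.map_mem r.2⟩ ⊗ₜ a, ?_⟩
        simp [SuperFormal.baseMap]
    exact hle hv.even
  comul := by
    rw [tensorOver_baseMap, ← hv.comul]
    simp only [SuperFormal.baseMap, ← LinearMap.comp_apply, ← TensorProduct.map_comp,
      LinearMap.id_comp, LinearMap.comp_id]
  counit := by
    have h : ∀ w : R.carrier ⊗[k] A.carrier,
        TensorProduct.rid k S.carrier (TensorProduct.map LinearMap.id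
          (Coalgebra.counit (R := k)) (SuperFormal.baseMap φ A w)) =
        homAlg φ (TensorProduct.rid k R.carrier
          (TensorProduct.map LinearMap.id (Coalgebra.counit (R := k)) w)) := by
      intro w
      induction w with
      | zero => simp
      | add w w' hw hw' => simp only [map_add, hw, hw']
      | tmul r a => simp [SuperFormal.baseMap]
    rw [h, hv.counit, map_one]

theorem baseMap_id (R : SAlgf k) (A : SuperCoalg k) (v : R.carrier ⊗[k] A.carrier) :
    baseMap (𝟙 R) A v = v := by
  have h : (homAlg (𝟙 R)).toLinearMap = LinearMap.id := rfl
  rw [baseMap, h, TensorProduct.map_id, LinearMap.id_apply]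

theorem baseMap_comp {R S T : SAlgf k} (φ : R ⟶ S) (ψ : S ⟶ T) (A : SuperCoalg k)
    (v : R.carrier ⊗[k] A.carrier) : baseMap (φ ≫ ψ) A v = baseMap ψ A (baseMap φ A v) := by
  have h : (homAlg (φ ≫ ψ)).toLinearMap = (homAlg ψ).toLinearMap ∘ₗ (homAlg φ).toLinearMap := rfl
  simp only [baseMap, h, ← LinearMap.comp_apply, ← TensorProduct.map_comp, LinearMap.id_comp]

/-- The functor `Sp* A : R ↦ G_R(R ⊗ A)`. -/
def spStar (A : SuperCoalg k) : FormalFunctor k where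
  obj R := {v : R.carrier ⊗[k] A.carrier // IsGroupLike R A v}
  map φ := ↾fun v => ⟨baseMap φ A v.1, v.2.baseMap φ⟩
  map_id R := by
    ext v
    exact baseMap_id R A v.1
  map_comp φ ψ := by
    ext v
    exact baseMap_comp φ ψ A v.1

/-- For a subspace `B` of `A`, the group-like elements of `R ⊗ A` lying in `R ⊗ B`. If `B` is
a sub-super-coalgebra, this is `Sp* B` as a subfunctor of `Sp* A`. -/
def spStarSub (A : SuperCoalg k) (B : Submodule k A.carrier) : Subfunctor (spStar A) where
  obj R := {v | v.1 ∈ LinearMap.range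
    (TensorProduct.map (LinearMap.id : R.carrier →ₗ[k] R.carrier) B.subtype)}
  map {R S} φ := by
    rintro v ⟨t, ht⟩
    refine ⟨TensorProduct.map (homAlg φ).toLinearMap LinearMap.id t, ?_⟩
    change _ = baseMap φ A v.1
    rw [← ht]
    simp only [baseMap, ← LinearMap.comp_apply, ← TensorProduct.map_comp, LinearMap.id_comp,
      LinearMap.comp_id]

/-! ### Points, fibers, algebraicity -/

/-- The formal subsuperscheme `{x}` of `X_x ⊆ X`, given by the coradical of the super-coalgebra
`O_x` of `X_x`. Here `O_x` is determined up to isomorphism by `Sp* O_x ≃ X_x`, and the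
subfunctor does not depend on the choice of `O_x` and of this isomorphism. -/
def pointSub (X : FormalFunctor k) (x : Points X) : Subfunctor X :=
  ⨆ (A : SuperCoalg k) (e : spStar A ≅ (component X x).toFunctor),
    (spStarSub A A.corad).image (e.hom ≫ (component X x).ι)

/-- The fiber `f⁻¹(y) = X ×_Y {y}`, as a subfunctor of `X`. -/
def fiber {X Y : FormalFunctor k} (f : X ⟶ Y) (y : Points Y) : Subfunctor X :=
  (pointSub Y y).preimage f

theorem fiber_isPullback {X Y : FormalFunctor k} (f : X ⟶ Y) (y : Points Y) :
    IsPullback (fiber f y).ι ((pointSub Y y).fromPreimage f) f (pointSub Y y).ι := by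
  refine ⟨⟨rfl⟩, ⟨Limits.PullbackCone.IsLimit.mk _ (fun s => Subfunctor.lift s.fst ?_)
    (fun s => rfl) ?_ ?_⟩⟩
  · rintro R _ ⟨a, rfl⟩
    have h : f.app R (s.fst.app R a) = ((s.snd.app R a : (pointSub Y y).obj R) : Y.obj R) :=
      congrArg (fun t => t.app R a) s.condition
    change f.app R (s.fst.app R a) ∈ (pointSub Y y).obj R
    rw [h]
    exact Subtype.mem _
  · intro s
    rw [← cancel_mono (pointSub Y y).ι]
    exact s.condition
  · intro s m h1 h2
    rw [← cancel_mono (fiber f y).ι]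
    exact h1

/-- `X` is algebraic at `x`: the super-coalgebra `O_x` of `X_x` is of finite type. -/
def AlgebraicAt (X : FormalFunctor k) (x : Points X) : Prop :=
  ∃ A : SuperCoalg k, Nonempty (spStar A ≅ (component X x).toFunctor) ∧ A.FiniteType

/-- `X` is locally algebraic: it is algebraic at every point. -/
def LocallyAlgebraic (X : FormalFunctor k) : Prop :=
  ∀ x : Points X, AlgebraicAt X x

/-- Closed immersions: every base change along a morphism `SSpf A → Y` is, up to
isomorphism, of the form `SSpf B → SSpf A` for a surjection `A → B`. -/
def IsClosedImmersion {X Y : FormalFunctor k} (f : X ⟶ Y) : Prop :=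
  ∀ (A : SAlgf k) (a : SSpf A ⟶ Y), ∃ (B : SAlgf k) (π : A ⟶ B) (b : SSpf B ⟶ X),
    Function.Surjective (homAlg π) ∧ IsPullback b (coyoneda.map π.op) f a

/-- `f` is locally of finite presentation: it is the composite of an immersion `X → W × Y`,
with `W` a locally algebraic formal superscheme, and the second projection. -/
def LOFP {X Y : FormalFunctor k} (f : X ⟶ Y) : Prop :=
  ∃ W : FormalFunctor k, IsFormalSuperscheme W ∧ LocallyAlgebraic W ∧
    ∃ i : X ⟶ FunctorToTypes.prod W Y, IsClosedImmersion i ∧ i ≫ FunctorToTypes.prod.snd = f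

/-- `f` is of finite presentation at `x`: the map `X_x → Y_{f(x)}` is LOFP. -/
def OFPAt {X Y : FormalFunctor k} (f : X ⟶ Y) (x : Points X) : Prop :=
  LOFP (componentMap f x)

end

end SuperFormal

namespace SuperFormal

noncomputable section

/-! ### The parity involution -/

/-! All finiteness conditions in the proposition are reduced to one bound on dimensions. Since 2 is
invertible, a grading is the same as an involution, so quotients and subobjects of superalgebras are
those stable under the involution. A finite-dimensional superalgebra has the primes of its even
part, which is a commutative Artinian ring; hence spectra are discrete and cut out by even
idempotents, and components and points of fibers can be handled by idempotents and closed
subfunctors. Write a formal superscheme as a directed union of `SSpf A_l` (`Pres`); the minimal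
elements (`IsMinimal`) are those given by quotients of the `A_l`.

Translation of coalgebra data. A group-like element of `R ⊗ A` is a unital, parity-preserving,
order-reversing multiplicative map from the dual algebra of `A` to `R` (`isGroupLike_iff`). For a
one-pointed `Z` with super-coalgebra `A`, the coradical is the dual of the residue algebra
(`corad_eq_idealSub`), and the next term of the coradical filtration is the union of the duals of
the `A_l / m²`. Therefore `Z` is algebraic at `z` exactly when the minimal square-zero thickenings
of `z` have bounded dimension (`algebraicAt_iff`). Moreover `{y}` consists of the elements that
factor through the residue algebra of `y` (`mem_pointSub_iff`). So fibers are closed subfunctors,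
their points inject into the points of `X`, and algebraicity of the fiber at `x` becomes the
condition `FiberBoundedAt f x` on elements of `X`.

LOFP implies bounded fibers (`fiberBoundedAt_of_lofp`). If `X` is closed in `W × Y`, a minimal
thickening of `x` in the fiber is a quotient of an algebra generated by a minimal thickening in `W`,
of bounded dimension, and the fixed residue algebra of `y`.

Bounded fibers imply LOFP (`lofp_of_forall_fiberBoundedAt`). A fiber thickening of maximal dimension
dominates all others, so a finite-dimensional space `V x` of functions on `X` spans every fiber
thickening at `x` (`exists_generators`). Let `W` be the formal superscheme presented by the
subalgebras of the `A_l` generated by the functions in `V x`, cut off at `x` by idempotents. Its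
square-zero thickenings are bounded by the cube of the dimension of `V x`, so `W` is locally
algebraic. By a Nakayama argument these subalgebras together with functions from `Y` generate each
`A_l`, which makes `X → W × Y` a closed immersion.

The bound at `x` does not change when `X` and `Y` are replaced by the components of `x` and `f(x)`,
which gives the pointwise statement. -/

theorem zmod_two_cases : ∀ i : ZMod 2, i = 0 ∨ i = 1 := by decide

section Parity

variable {k : Type u} [Field k] {V : Type u} [AddCommGroup V] [Module k V]
  (𝒱 : ZMod 2 → Submodule k V) [DirectSum.Decomposition 𝒱]

theorem parityProj_mem (i : ZMod 2) (v : V) : parityProj 𝒱 i v ∈ 𝒱 i :=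
  (DirectSum.decompose 𝒱 v i).2

theorem parityProj_of_mem {i : ZMod 2} {v : V} (h : v ∈ 𝒱 i) : parityProj 𝒱 i v = v :=
  DirectSum.decompose_of_mem_same 𝒱 h

theorem parityProj_of_mem_ne {i j : ZMod 2} {v : V} (h : v ∈ 𝒱 i) (hij : i ≠ j) :
    parityProj 𝒱 j v = 0 :=
  DirectSum.decompose_of_mem_ne 𝒱 h hij

theorem parityProj_add (v : V) : parityProj 𝒱 0 v + parityProj 𝒱 1 v = v := by
  induction v using DirectSum.Decomposition.inductionOn 𝒱 with
  | zero => simp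
  | add v w hv hw =>
    conv_rhs => rw [← hv, ← hw]
    simp only [map_add]; abel
  | @homogeneous i m =>
    obtain rfl | rfl := zmod_two_cases i
    · rw [parityProj_of_mem 𝒱 m.2, parityProj_of_mem_ne 𝒱 m.2 (by decide), add_zero]
    · rw [parityProj_of_mem 𝒱 m.2, parityProj_of_mem_ne 𝒱 m.2 (by decide), zero_add]

/-- The parity involution `v₀ + v₁ ↦ v₀ - v₁`. -/
def parityInv : V →ₗ[k] V := parityProj 𝒱 0 - parityProj 𝒱 1

theorem parityInv_apply (v : V) : parityInv 𝒱 v = parityProj 𝒱 0 v - parityProj 𝒱 1 v := rfl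

theorem parityInv_of_mem_zero {v : V} (h : v ∈ 𝒱 0) : parityInv 𝒱 v = v := by
  rw [parityInv_apply, parityProj_of_mem 𝒱 h, parityProj_of_mem_ne 𝒱 h (by decide), sub_zero]

theorem parityInv_of_mem_one {v : V} (h : v ∈ 𝒱 1) : parityInv 𝒱 v = -v := by
  rw [parityInv_apply, parityProj_of_mem 𝒱 h, parityProj_of_mem_ne 𝒱 h (by decide), zero_sub]

theorem parityInv_parityInv (v : V) : parityInv 𝒱 (parityInv 𝒱 v) = v := by
  conv_lhs => rw [parityInv_apply 𝒱 v, map_sub, parityInv_of_mem_zero 𝒱 (parityProj_mem 𝒱 0 v),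
    parityInv_of_mem_one 𝒱 (parityProj_mem 𝒱 1 v), sub_neg_eq_add, parityProj_add]

theorem two_smul_parityProj_zero (v : V) : (2 : k) • parityProj 𝒱 0 v = v + parityInv 𝒱 v := by
  conv_rhs => enter [1]; rw [← parityProj_add 𝒱 v]
  rw [parityInv_apply, two_smul]; abel

theorem two_smul_parityProj_one (v : V) : (2 : k) • parityProj 𝒱 1 v = v - parityInv 𝒱 v := by
  conv_rhs => enter [1]; rw [← parityProj_add 𝒱 v]
  rw [parityInv_apply, two_smul]; abel

variable [NeZero (2 : k)]

theorem parityProj_zero_eq (v : V) :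
    parityProj 𝒱 0 v = (2 : k)⁻¹ • (v + parityInv 𝒱 v) := by
  rw [← two_smul_parityProj_zero, smul_smul, inv_mul_cancel₀ (NeZero.ne _), one_smul]

theorem parityProj_one_eq (v : V) :
    parityProj 𝒱 1 v = (2 : k)⁻¹ • (v - parityInv 𝒱 v) := by
  rw [← two_smul_parityProj_one, smul_smul, inv_mul_cancel₀ (NeZero.ne _), one_smul]

theorem parityProj_mem_of_parityInv {P : Submodule k V} (hP : ∀ v ∈ P, parityInv 𝒱 v ∈ P)
    {v : V} (hv : v ∈ P) (i : ZMod 2) : parityProj 𝒱 i v ∈ P := by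
  fin_cases i
  · exact (parityProj_zero_eq 𝒱 v).symm ▸ P.smul_mem _ (P.add_mem hv (hP v hv))
  · exact (parityProj_one_eq 𝒱 v).symm ▸ P.smul_mem _ (P.sub_mem hv (hP v hv))

theorem mem_zero_iff_parityInv {v : V} : v ∈ 𝒱 0 ↔ parityInv 𝒱 v = v := by
  refine ⟨parityInv_of_mem_zero 𝒱, fun h => ?_⟩
  have : parityProj 𝒱 0 v = v := by
    rw [parityProj_zero_eq, h, ← two_smul k v, smul_smul, inv_mul_cancel₀ (NeZero.ne _), one_smul]
  exact this ▸ parityProj_mem 𝒱 0 v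

theorem mem_one_iff_parityInv {v : V} : v ∈ 𝒱 1 ↔ parityInv 𝒱 v = -v := by
  refine ⟨parityInv_of_mem_one 𝒱, fun h => ?_⟩
  have : parityProj 𝒱 1 v = v := by
    rw [parityProj_one_eq, h, sub_neg_eq_add, ← two_smul k v, smul_smul,
      inv_mul_cancel₀ (NeZero.ne _), one_smul]
  exact this ▸ parityProj_mem 𝒱 1 v

end Parity

/-! ### Gradings from involutions -/

section Eigen

variable {k : Type u} [Field k] {V : Type u} [AddCommGroup V] [Module k V]

/-- The even and odd parts determined by a linear involution. -/
def eigenPart (σ : V →ₗ[k] V) (i : ZMod 2) : Submodule k V :=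
  if i = 0 then LinearMap.ker (σ - LinearMap.id) else LinearMap.ker (σ + LinearMap.id)

theorem mem_eigenPart_zero (σ : V →ₗ[k] V) (v : V) : v ∈ eigenPart σ 0 ↔ σ v = v := by
  simp [eigenPart, sub_eq_zero]

theorem mem_eigenPart_one (σ : V →ₗ[k] V) (v : V) : v ∈ eigenPart σ 1 ↔ σ v = -v := by
  simp [eigenPart, add_eq_zero_iff_eq_neg]

/-- The eigenspace decomposition of a linear involution. -/
@[reducible] def eigenDecomposition [NeZero (2 : k)] (σ : V →ₗ[k] V) (hσ : ∀ v, σ (σ v) = v) :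
    DirectSum.Decomposition (eigenPart σ) :=
  DirectSum.Decomposition.ofLinearMap _
    (DirectSum.lof k (ZMod 2) (fun i => eigenPart σ i) 0 ∘ₗ
        ((2 : k)⁻¹ • (LinearMap.id + σ)).codRestrict (eigenPart σ 0) (fun v => by
          rw [mem_eigenPart_zero]; simp [hσ, add_comm]) +
      DirectSum.lof k (ZMod 2) (fun i => eigenPart σ i) 1 ∘ₗ
        ((2 : k)⁻¹ • (LinearMap.id - σ)).codRestrict (eigenPart σ 1) (fun v => by
          rw [mem_eigenPart_one]; simp [hσ, ← smul_neg]))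
    (by
      ext v
      simp only [LinearMap.comp_apply, LinearMap.add_apply, map_add, DirectSum.coeLinearMap_lof,
        LinearMap.codRestrict_apply, LinearMap.smul_apply, LinearMap.sub_apply, LinearMap.id_apply]
      rw [← smul_add, add_add_sub_cancel, ← two_smul k v, smul_smul,
        inv_mul_cancel₀ (NeZero.ne _), one_smul])
    (by
      have key : ∀ x : V, (2 : k)⁻¹ • (x + x) = x := fun x => by
        rw [← two_smul k x, smul_smul, inv_mul_cancel₀ (NeZero.ne _), one_smul]
      refine DirectSum.linearMap_ext _ fun i => LinearMap.ext fun x => ?_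
      simp only [LinearMap.comp_apply, LinearMap.add_apply, DirectSum.coeLinearMap_lof,
        LinearMap.id_apply]
      obtain rfl | rfl := zmod_two_cases i
      · have hx := (mem_eigenPart_zero σ x).1 x.2
        have h0 : ((2 : k)⁻¹ • (LinearMap.id + σ)).codRestrict (eigenPart σ 0) (fun v => by
          rw [mem_eigenPart_zero]; simp [hσ, add_comm]) (x : V) = x :=
            Subtype.ext (by simp [hx, -smul_add, key])
        have h1 : ((2 : k)⁻¹ • (LinearMap.id - σ)).codRestrict (eigenPart σ 1) (fun v => by
          rw [mem_eigenPart_one]; simp [hσ, ← smul_neg]) (x : V) = 0 :=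
            Subtype.ext (by simp [hx])
        rw [h0, h1, map_zero, add_zero]
      · have hx := (mem_eigenPart_one σ x).1 x.2
        have h0 : ((2 : k)⁻¹ • (LinearMap.id + σ)).codRestrict (eigenPart σ 0) (fun v => by
          rw [mem_eigenPart_zero]; simp [hσ, add_comm]) (x : V) = 0 :=
            Subtype.ext (by simp [hx])
        have h1 : ((2 : k)⁻¹ • (LinearMap.id - σ)).codRestrict (eigenPart σ 1) (fun v => by
          rw [mem_eigenPart_one]; simp [hσ, ← smul_neg]) (x : V) = x :=
            Subtype.ext (by simp [hx, key])
        rw [h0, h1, map_zero, zero_add])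

theorem parityInv_eigenPart [NeZero (2 : k)] (σ : V →ₗ[k] V)
    [DirectSum.Decomposition (eigenPart σ)] (v : V) : parityInv (eigenPart σ) v = σ v := by
  conv_rhs => rw [← parityProj_add (eigenPart σ) v, map_add,
    (mem_eigenPart_zero σ _).1 (parityProj_mem (eigenPart σ) 0 v),
    (mem_eigenPart_one σ _).1 (parityProj_mem (eigenPart σ) 1 v)]
  rw [parityInv_apply, sub_eq_add_neg]

end Eigen
end
end SuperFormal

namespace SuperFormal

noncomputable section

/-! ### Finite-dimensional superalgebras via their parity involution -/

namespace SAlgf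

variable {k : Type u} [Field k]

/-- The parity involution of a superalgebra. -/
def inv (R : SAlgf k) : R.carrier →ₐ[k] R.carrier :=
  AlgHom.ofLinearMap (parityInv R.part)
    (parityInv_of_mem_zero _ SetLike.GradedOne.one_mem) (fun a b => by
      have ha := parityProj_add R.part a
      have hb := parityProj_add R.part b
      have m : ∀ i j : ZMod 2, parityProj R.part i a * parityProj R.part j b ∈ R.part (i + j) :=
        fun i j => SetLike.GradedMul.mul_mem (parityProj_mem _ _ _) (parityProj_mem _ _ _)
      conv_lhs => rw [← ha, ← hb]
      simp only [add_mul, mul_add, map_add]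
      rw [parityInv_of_mem_zero _ (m 0 0), parityInv_of_mem_one _ (m 0 1),
        parityInv_of_mem_one _ (m 1 0), parityInv_of_mem_zero _ (m 1 1), parityInv_apply,
        parityInv_apply]
      noncomm_ring)

theorem inv_apply (R : SAlgf k) (r : R.carrier) : R.inv r = parityInv R.part r := rfl

theorem inv_inv (R : SAlgf k) (r : R.carrier) : R.inv (R.inv r) = r := parityInv_parityInv _ r

theorem inv_hom {R S : SAlgf k} (φ : R ⟶ S) (r : R.carrier) :
    homAlg φ (R.inv r) = S.inv (homAlg φ r) := by
  simp only [inv_apply, parityInv_apply, map_sub, parityProj_hom]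

theorem hom_ext {R S : SAlgf k} {φ ψ : R ⟶ S} (h : ∀ r, homAlg φ r = homAlg ψ r) : φ = ψ :=
  DFunLike.ext (F := R.part →ₐᵍ[k] S.part) φ ψ h

theorem homAlg_comp {R S T : SAlgf k} (φ : R ⟶ S) (ψ : S ⟶ T) (r : R.carrier) :
    homAlg (φ ≫ ψ) r = homAlg ψ (homAlg φ r) := rfl

theorem even_mul_comm (R : SAlgf k) {a : R.carrier} (ha : a ∈ R.part 0) (b : R.carrier) :
    a * b = b * a := R.even_central a ha b

theorem odd_mul_odd (R : SAlgf k) {a b : R.carrier} (ha : a ∈ R.part 1) (hb : b ∈ R.part 1) :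
    a * b = -(b * a) := by
  have h := R.odd_sq _ (add_mem ha hb)
  rw [add_mul, mul_add, mul_add, R.odd_sq a ha, R.odd_sq b hb, zero_add, add_zero] at h
  exact eq_neg_of_add_eq_zero_left h

/-- Only a pair of odd elements produces a sign, and odd elements anticommute by polarizing the
relation that they square to zero. -/
theorem koszul_smul_mul (R : SAlgf k) {i j : ZMod 2} {a b : R.carrier} (ha : a ∈ R.part i)
    (hb : b ∈ R.part j) : koszul k i j • (a * b) = b * a := by
  obtain rfl | rfl := zmod_two_cases i
  · simp [koszul, R.even_mul_comm ha b]
  · obtain rfl | rfl := zmod_two_cases j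
    · simp [koszul, R.even_mul_comm hb a]
    · simp [koszul, R.odd_mul_odd ha hb]

/-- The kernel of a morphism, as a left ideal. -/
def ker {R S : SAlgf k} (φ : R ⟶ S) : Ideal R.carrier := RingHom.ker (homAlg φ)

theorem mem_ker {R S : SAlgf k} (φ : R ⟶ S) (r : R.carrier) : r ∈ ker φ ↔ homAlg φ r = 0 :=
  Iff.rfl

theorem inv_mem_ker {R S : SAlgf k} (φ : R ⟶ S) (r : R.carrier) (hr : r ∈ ker φ) :
    R.inv r ∈ ker φ := by
  rw [mem_ker] at hr ⊢
  rw [inv_hom, hr, map_zero]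

section

variable [NeZero (2 : k)]

theorem mem_zero_iff (R : SAlgf k) {r : R.carrier} : r ∈ R.part 0 ↔ R.inv r = r :=
  mem_zero_iff_parityInv _

theorem mem_one_iff (R : SAlgf k) {r : R.carrier} : r ∈ R.part 1 ↔ R.inv r = -r :=
  mem_one_iff_parityInv _

/-- An algebra homomorphism commuting with the parity involutions is a morphism. -/
def homMk {R S : SAlgf k} (φ : R.carrier →ₐ[k] S.carrier)
    (h : ∀ r, φ (R.inv r) = S.inv (φ r)) : R ⟶ S :=
  show R.part →ₐᵍ[k] S.part from
  { φ with
    map_mem := by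
      intro i r hr
      change φ r ∈ S.part i
      obtain rfl | rfl := zmod_two_cases i
      · rw [mem_zero_iff] at hr ⊢
        rw [← h, hr]
      · rw [mem_one_iff] at hr ⊢
        rw [← h, hr, map_neg] }

/-- The superalgebra determined by an involution of an algebra. -/
def ofInv (R : Type u) [Ring R] [Algebra k R] [Module.Finite k R] (σ : R →ₐ[k] R)
    (hσ : ∀ r, σ (σ r) = r) (hc : ∀ a b, σ a = a → a * b = b * a)
    (hs : ∀ a, σ a = -a → a * a = 0) : SAlgf k where
  carrier := R
  part := eigenPart σ.toLinearMap
  gradedAlgebra :=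
    { eigenDecomposition σ.toLinearMap hσ with
      one_mem := (mem_eigenPart_zero _ _).2 (map_one σ)
      mul_mem := by
        intro i j a b ha hb
        obtain rfl | rfl := zmod_two_cases i <;> obtain rfl | rfl := zmod_two_cases j <;>
          simp only [mem_eigenPart_zero, mem_eigenPart_one, AlgHom.toLinearMap_apply, add_zero,
            zero_add, show (1 : ZMod 2) + 1 = 0 from rfl, map_mul] at ha hb ⊢ <;>
          simp [ha, hb] }
  even_central a ha b := hc a b ((mem_eigenPart_zero _ _).1 ha)
  odd_sq a ha := hs a ((mem_eigenPart_one _ _).1 ha)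

theorem inv_ofInv (R : Type u) [Ring R] [Algebra k R] [Module.Finite k R] (σ : R →ₐ[k] R)
    (hσ : ∀ r, σ (σ r) = r) (hc : ∀ a b, σ a = a → a * b = b * a)
    (hs : ∀ a, σ a = -a → a * a = 0) (r : R) :
    (ofInv R σ hσ hc hs).inv r = σ r :=
  letI := eigenDecomposition σ.toLinearMap hσ
  parityInv_eigenPart σ.toLinearMap r

theorem exists_lift_of_surjective {R Q S : SAlgf k} (π : R ⟶ Q)
    (hπ : Function.Surjective (homAlg π)) (φ : R ⟶ S)
    (h : ∀ r, homAlg π r = 0 → homAlg φ r = 0) : ∃ ψ : Q ⟶ S, π ≫ ψ = φ := by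
  have hk : ∀ r s, homAlg π r = homAlg π s → homAlg φ r = homAlg φ s := fun r s hrs => by
    rw [← sub_eq_zero, ← map_sub]
    exact h _ (by rw [map_sub, hrs, sub_self])
  let g := Function.surjInv hπ
  have hg : ∀ q, homAlg π (g q) = q := Function.surjInv_eq hπ
  let ψ : Q.carrier →ₐ[k] S.carrier :=
    { toFun q := homAlg φ (g q)
      map_one' := (hk _ 1 (by rw [hg, map_one])).trans (map_one _)
      map_mul' a b := (hk _ (g a * g b) (by rw [hg, map_mul, hg, hg])).trans (map_mul _ _ _)
      map_zero' := (hk _ 0 (by rw [hg, map_zero])).trans (map_zero _)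
      map_add' a b := (hk _ (g a + g b) (by rw [hg, map_add, hg, hg])).trans (map_add _ _ _)
      commutes' c := (hk _ (algebraMap k _ c) (by rw [hg, AlgHom.commutes])).trans
        (AlgHom.commutes _ _) }
  refine ⟨homMk ψ fun q => ?_, hom_ext fun r => hk _ _ (hg _)⟩
  exact (hk _ (R.inv (g q)) (by rw [hg, inv_hom, hg])).trans (inv_hom φ _)

theorem exists_lift_of_injective {T R S : SAlgf k} (ι : T ⟶ R)
    (hι : Function.Injective (homAlg ι)) (φ : S ⟶ R)
    (h : ∀ s, ∃ t, homAlg ι t = homAlg φ s) : ∃ ψ : S ⟶ T, ψ ≫ ι = φ := by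
  choose g hg using h
  let ψ : S.carrier →ₐ[k] T.carrier :=
    { toFun := g
      map_one' := hι (by rw [hg, map_one, map_one])
      map_mul' a b := hι (by rw [hg, map_mul, map_mul, hg, hg])
      map_zero' := hι (by rw [hg, map_zero, map_zero])
      map_add' a b := hι (by rw [hg, map_add, map_add, hg, hg])
      commutes' c := hι (by rw [hg, AlgHom.commutes, AlgHom.commutes]) }
  exact ⟨homMk ψ fun s => hι (by
    change homAlg ι (g _) = homAlg ι (T.inv (g s))
    rw [hg, inv_hom, inv_hom, hg]), hom_ext hg⟩

/-- A left ideal stable under the parity involution contains all parity components. -/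
theorem proj_mem (R : SAlgf k) {I : Ideal R.carrier} (hI : ∀ r ∈ I, R.inv r ∈ I) {r : R.carrier}
    (hr : r ∈ I) (i : ZMod 2) : parityProj R.part i r ∈ I :=
  parityProj_mem_of_parityInv R.part (P := I.restrictScalars k) hI hr i

/-- Stability under the involution puts parity components back into the ideal, and homogeneous
elements commute up to sign, so right multiplication can be traded for left multiplication. -/
theorem isTwoSided (R : SAlgf k) {I : Ideal R.carrier} (hI : ∀ r ∈ I, R.inv r ∈ I) :
    I.IsTwoSided := ⟨by
  intro r s hr
  have key : ∀ i j : ZMod 2, parityProj R.part i r * parityProj R.part j s ∈ I := fun i j => by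
    rw [← R.koszul_smul_mul (parityProj_mem R.part j s) (parityProj_mem R.part i r)]
    rw [Algebra.smul_def]
    exact I.mul_mem_left _ (I.mul_mem_left _ (R.proj_mem hI hr i))
  rw [← parityProj_add R.part r, ← parityProj_add R.part s, add_mul, mul_add, mul_add]
  exact I.add_mem (I.add_mem (key _ _) (key _ _)) (I.add_mem (key _ _) (key _ _))⟩

theorem exists_quot (R : SAlgf k) (I : Ideal R.carrier) (hI : ∀ r ∈ I, R.inv r ∈ I) :
    ∃ (Q : SAlgf k) (π : R ⟶ Q), Function.Surjective (homAlg π) ∧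
      ∀ r, homAlg π r = 0 ↔ r ∈ I := by
  have := R.isTwoSided hI
  let σ : R.carrier ⧸ I →ₐ[k] R.carrier ⧸ I :=
    Ideal.Quotient.liftₐ I ((Ideal.Quotient.mkₐ k I).comp R.inv)
      (fun a ha => Ideal.Quotient.eq_zero_iff_mem.2 (hI a ha))
  have hσ : ∀ r, σ (Ideal.Quotient.mk I r) = Ideal.Quotient.mk I (R.inv r) := fun r => rfl
  have hs := Ideal.Quotient.mk_surjective (I := I)
  -- Even and odd classes lift to even and odd elements by averaging over the involution; this is
  -- how supercommutativity descends to the quotient.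
  have lift0 : ∀ a, σ a = a → ∃ r ∈ R.part 0, Ideal.Quotient.mk I r = a := fun a ha => by
    obtain ⟨r, rfl⟩ := hs a
    refine ⟨(2 : k)⁻¹ • (r + R.inv r), ?_, ?_⟩
    · rw [mem_zero_iff, map_smul, map_add, inv_inv, add_comm]
    · have := map_smul (Ideal.Quotient.mkₐ k I) (2 : k)⁻¹ (r + R.inv r)
      refine this.trans ?_
      rw [map_add]
      change (2 : k)⁻¹ • (Ideal.Quotient.mk I r + σ (Ideal.Quotient.mk I r)) = _
      rw [ha, ← two_smul k (Ideal.Quotient.mk I r), smul_smul, inv_mul_cancel₀ (NeZero.ne _),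
        one_smul]
  have lift1 : ∀ a, σ a = -a → ∃ r ∈ R.part 1, Ideal.Quotient.mk I r = a := fun a ha => by
    obtain ⟨r, rfl⟩ := hs a
    refine ⟨(2 : k)⁻¹ • (r - R.inv r), ?_, ?_⟩
    · rw [mem_one_iff, map_smul, map_sub, inv_inv, ← smul_neg, neg_sub]
    · have := map_smul (Ideal.Quotient.mkₐ k I) (2 : k)⁻¹ (r - R.inv r)
      refine this.trans ?_
      rw [map_sub]
      change (2 : k)⁻¹ • (Ideal.Quotient.mk I r - σ (Ideal.Quotient.mk I r)) = _
      rw [ha, sub_neg_eq_add, ← two_smul k (Ideal.Quotient.mk I r), smul_smul,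
        inv_mul_cancel₀ (NeZero.ne _), one_smul]
  have : Module.Finite k (R.carrier ⧸ I) :=
    Module.Finite.of_surjective (Ideal.Quotient.mkₐ k I).toLinearMap hs
  let Q := ofInv (R.carrier ⧸ I) σ
    (fun a => by obtain ⟨r, rfl⟩ := hs a; rw [hσ, hσ, inv_inv])
    (fun a b ha => by
      obtain ⟨r, hr, rfl⟩ := lift0 a ha
      obtain ⟨s, rfl⟩ := hs b
      rw [← map_mul, R.even_mul_comm hr, map_mul])
    (fun a ha => by
      obtain ⟨r, hr, rfl⟩ := lift1 a ha
      rw [← map_mul, R.odd_sq r hr, map_zero])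
  refine ⟨Q, homMk (S := Q) (Ideal.Quotient.mkₐ k I) fun r => ?_, hs,
    fun r => Ideal.Quotient.eq_zero_iff_mem⟩
  exact (inv_ofInv (R.carrier ⧸ I) σ _ _ _ (Ideal.Quotient.mk I r)).symm

theorem exists_sub (R : SAlgf k) (A : Subalgebra k R.carrier) (hA : ∀ r ∈ A, R.inv r ∈ A) :
    ∃ (S : SAlgf k) (ι : S ⟶ R), Function.Injective (homAlg ι) ∧
      ∀ r, (∃ s, homAlg ι s = r) ↔ r ∈ A := by
  let σ : A →ₐ[k] A := (R.inv.comp A.val).codRestrict A fun a => hA a a.2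
  have hσ : ∀ a : A, (σ a : R.carrier) = R.inv a := fun a => rfl
  let S := ofInv A σ (fun a => Subtype.ext (R.inv_inv a))
    (fun a b ha => Subtype.ext (R.even_mul_comm (R.mem_zero_iff.2 (congrArg Subtype.val ha)) b))
    (fun a ha => Subtype.ext (R.odd_sq _ (R.mem_one_iff.2 (congrArg Subtype.val ha))))
  refine ⟨S, homMk (R := S) A.val fun a => ?_, Subtype.val_injective, fun r => ?_⟩
  · exact congrArg Subtype.val (inv_ofInv A σ _ _ _ a)
  · exact ⟨fun ⟨s, hs⟩ => hs ▸ s.2, fun h => ⟨⟨r, h⟩, rfl⟩⟩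

/-- Every morphism factors as a surjection followed by an injection. -/
theorem exists_factor {R S : SAlgf k} (φ : R ⟶ S) :
    ∃ (Q : SAlgf k) (π : R ⟶ Q) (ι : Q ⟶ S), π ≫ ι = φ ∧ Function.Surjective (homAlg π) ∧
      Function.Injective (homAlg ι) := by
  obtain ⟨Q, π, hπ, hk⟩ := R.exists_quot (ker φ) (inv_mem_ker φ)
  obtain ⟨ι, hι⟩ := exists_lift_of_surjective π hπ φ fun r hr => (hk r).1 hr
  refine ⟨Q, π, ι, hι, hπ, (injective_iff_map_eq_zero (homAlg ι)).2 fun q hq => ?_⟩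
  obtain ⟨r, rfl⟩ := hπ q
  rw [← homAlg_comp, hι] at hq
  exact (hk r).2 hq

theorem iso_of_bijective {R S : SAlgf k} (φ : R ⟶ S) (h : Function.Bijective (homAlg φ)) :
    ∃ ψ : S ⟶ R, φ ≫ ψ = 𝟙 R ∧ ψ ≫ φ = 𝟙 S := by
  obtain ⟨ψ, hψ⟩ := exists_lift_of_injective φ h.1 (𝟙 S) fun s => h.2 s
  refine ⟨ψ, hom_ext fun r => h.1 ?_, hψ⟩
  change homAlg (ψ ≫ φ) (homAlg φ r) = _
  rw [hψ]; rfl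

end

end SAlgf
end
end SuperFormal

namespace SuperFormal

noncomputable section

/-! ### Primes of finite-dimensional superalgebras -/

variable {k : Type u} [Field k]

namespace SAlgf

/-- The even part, a commutative algebra. -/
def evenSub (R : SAlgf k) : Subalgebra k R.carrier :=
  { R.part 0 with
    mul_mem' := fun {a b} ha hb => by
      have := SetLike.GradedMul.mul_mem (A := R.part) ha hb
      rwa [add_zero] at this
    one_mem' := SetLike.GradedOne.one_mem (A := R.part)
    algebraMap_mem' := fun c => by
      have : c • (1 : R.carrier) ∈ R.part 0 := (R.part 0).smul_mem c SetLike.GradedOne.one_mem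
      rwa [← Algebra.algebraMap_eq_smul_one] at this }

instance (R : SAlgf k) : CommRing R.evenSub :=
  { R.evenSub.toRing with
    mul_comm := fun a b => Subtype.ext (R.even_mul_comm a.2 b) }

instance (R : SAlgf k) : IsArtinianRing R.evenSub :=
  IsArtinianRing.of_finite k R.evenSub

/-- The even component of an element. -/
def evenProj (R : SAlgf k) (r : R.carrier) : R.evenSub :=
  ⟨parityProj R.part 0 r, parityProj_mem _ _ _⟩

theorem odd_mul_odd_mem (R : SAlgf k) {a b : R.carrier} (ha : a ∈ R.part 1) (hb : b ∈ R.part 1) :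
    a * b ∈ R.evenSub := by
  have := SetLike.GradedMul.mul_mem (A := R.part) ha hb
  rwa [show (1 : ZMod 2) + 1 = 0 from rfl] at this

theorem odd_mul_odd_sq (R : SAlgf k) {a b : R.carrier} (ha : a ∈ R.part 1) (hb : b ∈ R.part 1) :
    (a * b) * (a * b) = 0 := by
  have h := R.even_mul_comm (R.odd_mul_odd_mem ha hb) a
  rw [← mul_assoc, h, ← mul_assoc, R.odd_sq a ha]; simp

/-- The even part of a product differs from the product of the even parts by a product of two odd
elements. That product squares to zero, hence lies in every prime. This makes the preimage of an
even prime a prime of `R`. -/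
theorem evenProj_mul (R : SAlgf k) (q : PrimeSpectrum R.evenSub) (r s : R.carrier) :
    R.evenProj (r * s) ∈ q.asIdeal ↔ R.evenProj r * R.evenProj s ∈ q.asIdeal := by
  have hr := parityProj_mem R.part 1 r
  have hs := parityProj_mem R.part 1 s
  let t : R.evenSub := ⟨_, R.odd_mul_odd_mem hr hs⟩
  have ht : t ∈ q.asIdeal := q.isPrime.mem_of_pow_mem 2 (by
    have : t ^ 2 = 0 := by rw [pow_two]; exact Subtype.ext (R.odd_mul_odd_sq hr hs)
    rw [this]; exact zero_mem _)
  have e : R.evenProj (r * s) = R.evenProj r * R.evenProj s + t := by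
    refine Subtype.ext ?_
    have m : ∀ i j : ZMod 2, parityProj R.part i r * parityProj R.part j s ∈ R.part (i + j) :=
        fun i j => SetLike.GradedMul.mul_mem (parityProj_mem _ _ _) (parityProj_mem _ _ _)
    change parityProj R.part 0 (r * s) = parityProj R.part 0 r * parityProj R.part 0 s +
      parityProj R.part 1 r * parityProj R.part 1 s
    conv_lhs => rw [← parityProj_add R.part r, ← parityProj_add R.part s]
    simp only [add_mul, mul_add, map_add]
    rw [parityProj_of_mem (i := 0) _ (m 0 0), parityProj_of_mem_ne _ (m 0 1) (by decide),
      parityProj_of_mem_ne _ (m 1 0) (by decide), parityProj_of_mem (i := 0) _ (m 1 1)]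
    simp
  rw [e]
  exact Ideal.add_mem_iff_left _ ht

theorem evenProj_add (R : SAlgf k) (r s : R.carrier) :
    R.evenProj (r + s) = R.evenProj r + R.evenProj s := Subtype.ext (map_add _ _ _)

theorem evenProj_of_mem (R : SAlgf k) (r : R.evenSub) : R.evenProj r = r :=
  Subtype.ext (parityProj_of_mem R.part r.2)

theorem evenProj_odd (R : SAlgf k) {r : R.carrier} (hr : r ∈ R.part 1) : R.evenProj r = 0 :=
  Subtype.ext (parityProj_of_mem_ne R.part hr (by decide))

end SAlgf

namespace Spec

variable {R S : SAlgf k}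

theorem ext {p q : Spec R} (h : ∀ r, r ∈ p.1 ↔ r ∈ q.1) : p = q :=
  Subtype.ext (Ideal.ext h)

theorem odd_mem (p : Spec R) {r : R.carrier} (hr : r ∈ R.part 1) : r ∈ p.1 :=
  have := p.2.2
  (this.mem_or_mem (by rw [R.odd_sq r hr]; exact zero_mem _)).elim id id

theorem mem_iff (p : Spec R) (r : R.carrier) : r ∈ p.1 ↔ parityProj R.part 0 r ∈ p.1 := by
  conv_lhs => rw [← parityProj_add R.part r]
  exact Ideal.add_mem_iff_left _ (p.odd_mem (parityProj_mem _ _ _))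

theorem inv_mem (p : Spec R) (r : R.carrier) (hr : r ∈ p.1) : R.inv r ∈ p.1 :=
  p.1.sub_mem (p.2.1 r hr 0) (p.2.1 r hr 1)

/-- The prime of `R` with a given even part. -/
def ofEven (q : PrimeSpectrum R.evenSub) : Spec R :=
  ⟨{ carrier := {r | R.evenProj r ∈ q.asIdeal}
     add_mem' := fun {a b} ha hb => by
       rw [Set.mem_ofPred_eq, R.evenProj_add]; exact add_mem ha hb
     zero_mem' := by
       rw [Set.mem_ofPred_eq, show R.evenProj 0 = 0 from Subtype.ext (map_zero _)]
       exact zero_mem _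
     smul_mem' := fun a b hb => by
       rw [Set.mem_ofPred_eq, smul_eq_mul, R.evenProj_mul]
       exact Ideal.mul_mem_left _ _ hb }, by
    refine ⟨fun a ha i => ?_, ?_, fun {a b} h => ?_⟩
    · obtain rfl | rfl := zmod_two_cases i
      · change R.evenProj (R.evenProj a) ∈ q.asIdeal
        rw [R.evenProj_of_mem]; exact ha
      · change R.evenProj _ ∈ q.asIdeal
        rw [R.evenProj_odd (parityProj_mem _ _ _)]; exact zero_mem _
    · rw [Ideal.ne_top_iff_one]
      change ¬ R.evenProj ((1 : R.evenSub) : R.carrier) ∈ q.asIdeal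
      rw [R.evenProj_of_mem]
      exact (Ideal.ne_top_iff_one _).1 q.isPrime.ne_top
    · exact q.isPrime.mem_or_mem ((R.evenProj_mul q a b).1 h)⟩

theorem mem_ofEven (q : PrimeSpectrum R.evenSub) (r : R.carrier) :
    r ∈ (ofEven q).1 ↔ R.evenProj r ∈ q.asIdeal := Iff.rfl

/-- The even part of a prime. -/
def toEven (p : Spec R) : PrimeSpectrum R.evenSub :=
  ⟨p.1.comap R.evenSub.val, have := p.2.2; Ideal.IsPrime.comap _⟩

theorem mem_toEven (p : Spec R) (r : R.evenSub) : r ∈ p.toEven.asIdeal ↔ (r : R.carrier) ∈ p.1 :=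
  Iff.rfl

theorem ofEven_toEven (p : Spec R) : ofEven p.toEven = p :=
  ext fun r => by rw [mem_ofEven, mem_toEven, mem_iff p r]; rfl

/-- The even part is Artinian, so its primes are maximal, and a prime of `R` is determined by its
even part. -/
theorem eq_of_le {p q : Spec R} (h : p.1 ≤ q.1) : p = q := by
  have hp : p.toEven.asIdeal.IsMaximal := inferInstance
  have : p.toEven = q.toEven :=
    PrimeSpectrum.ext (hp.eq_of_le q.toEven.isPrime.ne_top fun r hr => h hr)
  rw [← ofEven_toEven p, this, ofEven_toEven]

theorem mem_comap (φ : R ⟶ S) (p : Spec S) (r : R.carrier) :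
    r ∈ (comap φ p).1 ↔ homAlg φ r ∈ p.1 := Iff.rfl

theorem comap_comp {T : SAlgf k} (φ : R ⟶ S) (ψ : S ⟶ T) (p : Spec T) :
    comap (φ ≫ ψ) p = comap φ (comap ψ p) := rfl

theorem comap_injective (φ : R ⟶ S) (hφ : Function.Surjective (homAlg φ)) :
    Function.Injective (comap φ) := fun p q h => ext fun s => by
  obtain ⟨r, rfl⟩ := hφ s
  rw [← mem_comap, h, mem_comap]

theorem mem_of_isNilpotent (p : Spec R) {r : R.carrier} (hr : IsNilpotent r) : r ∈ p.1 := by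
  obtain ⟨n, hn⟩ := hr
  have := p.2.2
  exact this.mem_of_pow_mem n (by rw [hn]; exact zero_mem _)

theorem isNilpotent_of_forall {r : R.carrier} (h : ∀ p : Spec R, r ∈ p.1) : IsNilpotent r := by
  have h0 : IsNilpotent (R.evenProj r) := by
    rw [nilpotent_iff_mem_prime]
    intro J hJ
    exact (mem_ofEven ⟨J, hJ⟩ r).1 (h _)
  have h0' : IsNilpotent (parityProj R.part 0 r) := h0.map R.evenSub.val
  have h1 : IsNilpotent (parityProj R.part 1 r) :=
    ⟨2, by rw [pow_two, R.odd_sq _ (parityProj_mem _ _ _)]⟩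
  rw [← parityProj_add R.part r]
  exact Commute.isNilpotent_add (R.even_mul_comm (parityProj_mem _ _ _) _) h0' h1

theorem isIdempotentElem_eq_zero {e : R.carrier} (he : e * e = e) (h : ∀ p : Spec R, e ∈ p.1) :
    e = 0 := by
  obtain ⟨n, hn⟩ := isNilpotent_of_forall h
  have : ∀ n : ℕ, e ^ (n + 1) = e := fun n => by
    induction n with
    | zero => simp
    | succ n ih => rw [pow_succ, ih, he]
  rw [← this n, pow_succ, hn, zero_mul]

theorem one_sub_mem_iff (p : Spec R) {e : R.carrier} (he : e * e = e) :
    1 - e ∈ p.1 ↔ e ∉ p.1 := by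
  have := p.2.2
  constructor
  · intro h h'
    exact (Ideal.ne_top_iff_one _).1 this.ne_top (by simpa using p.1.add_mem h h')
  · intro h
    refine (this.mem_or_mem (x := e) (y := 1 - e) ?_).resolve_left h
    rw [mul_sub, he, mul_one, sub_self]; exact zero_mem _

theorem isIdempotentElem_eq_one {e : R.carrier} (he : e * e = e) (h : ∀ p : Spec R, e ∉ p.1) :
    e = 1 := by
  have h2 : (1 - e) * (1 - e) = 1 - e := by rw [mul_sub, mul_one, sub_mul, he, one_mul]; simp
  have := isIdempotentElem_eq_zero h2 fun p => (one_sub_mem_iff p he).2 (h p)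
  exact (sub_eq_zero.1 this).symm

/-- Both `e * (1 - f)` and `(1 - e) * f` are idempotents lying in every prime; an idempotent that is
nilpotent is zero. -/
theorem idempotent_unique {e f : R.carrier} (he0 : e ∈ R.part 0) (he : e * e = e)
    (hf : f * f = f) (h : ∀ p : Spec R, e ∈ p.1 ↔ f ∈ p.1) : e = f := by
  have hc := R.even_mul_comm he0 f
  have h1 : e * (1 - f) = 0 := by
    refine isIdempotentElem_eq_zero ?_ fun p => ?_
    · have h2 : (1 - f) * (1 - f) = 1 - f := by rw [mul_sub, mul_one, sub_mul, hf, one_mul]; simp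
      have hc' : (1 - f) * e = e * (1 - f) := by rw [mul_sub, sub_mul, hc, one_mul, mul_one]
      rw [mul_assoc, ← mul_assoc (1 - f), hc', mul_assoc, h2, ← mul_assoc, he]
    · by_cases hp : e ∈ p.1
      · rw [R.even_mul_comm he0]; exact p.1.mul_mem_left _ hp
      · exact p.1.mul_mem_left _ ((one_sub_mem_iff p hf).2 fun hf' => hp ((h p).2 hf'))
  have h3 : (1 - e) * f = 0 := by
    refine isIdempotentElem_eq_zero ?_ fun p => ?_
    · have h2 : (1 - e) * (1 - e) = 1 - e := by rw [mul_sub, mul_one, sub_mul, he, one_mul]; simp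
      have hc' : f * (1 - e) = (1 - e) * f := by rw [mul_sub, sub_mul, hc, one_mul, mul_one]
      rw [mul_assoc, ← mul_assoc f, hc', mul_assoc, hf, ← mul_assoc, h2]
    · by_cases hp : e ∈ p.1
      · exact p.1.mul_mem_left _ ((h p).1 hp)
      · have hc' : f * (1 - e) = (1 - e) * f := by rw [mul_sub, sub_mul, hc, one_mul, mul_one]
        rw [← hc']
        exact p.1.mul_mem_left _ ((one_sub_mem_iff p he).2 hp)
  rw [mul_sub, mul_one, sub_eq_zero] at h1
  rw [sub_mul, one_mul, sub_eq_zero] at h3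
  rw [h1, ← h3]

/-- The spectrum of the Artinian even part is discrete, so every subset is clopen. The idempotent is
the indicator function of `U`: it is outside `p` exactly for `p` in `U`. -/
theorem exists_idempotent (U : Set (Spec R)) :
    ∃ e ∈ R.part 0, e * e = e ∧ ∀ p : Spec R, e ∈ p.1 ↔ p ∉ U := by
  obtain ⟨e, he, h⟩ := PrimeSpectrum.exists_idempotent_basicOpen_eq_of_isClopen
    (isClopen_discrete (ofEven ⁻¹' U))
  refine ⟨e, e.2, congrArg Subtype.val he, fun p => ?_⟩
  have : p.toEven ∈ ofEven ⁻¹' U ↔ p.toEven ∈ (PrimeSpectrum.basicOpen e : Set _) := by rw [h]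
  rw [Set.mem_preimage, ofEven_toEven, SetLike.mem_coe, PrimeSpectrum.mem_basicOpen,
    mem_toEven] at this
  tauto

theorem exists_le {J : Ideal R.carrier} (hJ : ∀ r ∈ J, ∀ i, parityProj R.part i r ∈ J)
    (h1 : J ≠ ⊤) : ∃ p : Spec R, J ≤ p.1 := by
  have hne : J.comap R.evenSub.val ≠ ⊤ := by
    rw [Ideal.ne_top_iff_one] at h1 ⊢
    exact h1
  obtain ⟨M, hM, hle⟩ := Ideal.exists_le_maximal _ hne
  exact ⟨ofEven ⟨M, hM.isPrime⟩, fun r hr => hle (hJ r hr 0)⟩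

theorem eq_of_le_ideal (p : Spec R) {J : Ideal R.carrier}
    (hJ : ∀ r ∈ J, ∀ i, parityProj R.part i r ∈ J) (h1 : J ≠ ⊤) (h : p.1 ≤ J) : p.1 = J := by
  obtain ⟨q, hq⟩ := exists_le hJ h1
  obtain rfl := eq_of_le (h.trans hq)
  exact le_antisymm h hq

/-- Lying over without integrality: if no prime of `S` lay over `p`, the indicator idempotent of `p`
would map into every prime of `S`, hence to zero, against injectivity. -/
theorem exists_comap_eq (φ : R ⟶ S) (hφ : Function.Injective (homAlg φ)) (p : Spec R) :
    ∃ q : Spec S, comap φ q = p := by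
  obtain ⟨e, he0, he, h⟩ := exists_idempotent ({p} : Set (Spec R))
  have hp : e ∉ p.1 := fun h' => (h p).1 h' rfl
  by_contra! hc
  have h0 : homAlg φ e = 0 := isIdempotentElem_eq_zero (by rw [← map_mul, he]) fun q =>
    (h (comap φ q)).2 fun h' => hc q h'
  rw [hφ (h0.trans (map_zero _).symm)] at hp
  exact hp (zero_mem _)

theorem nonempty_of_nontrivial [Nontrivial R.carrier] : Nonempty (Spec R) :=
  (exists_le (J := (⊥ : Ideal R.carrier)) (fun r hr i => by
    rw [Ideal.mem_bot] at hr ⊢; rw [hr, map_zero]) bot_ne_top).nonempty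

/-- If all primes coincide, the prime consists of the nilpotent elements. -/
theorem mem_iff_isNilpotent (h : ∀ p q : Spec R, p = q) (p : Spec R) (r : R.carrier) :
    r ∈ p.1 ↔ IsNilpotent r :=
  ⟨fun hr => isNilpotent_of_forall fun q => h p q ▸ hr, p.mem_of_isNilpotent⟩

/-- The unique prime consists of nilpotents, so it lies in the Jacobson radical, which is nilpotent
in an Artinian ring. This ends the Nakayama induction below. -/
theorem exists_pow_eq_bot (h : ∀ p q : Spec R, p = q) (p : Spec R) :
    ∃ n : ℕ, (p.1.restrictScalars k : Submodule k R.carrier) ^ n = ⊥ := by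
  have : IsArtinianRing R.carrier := IsArtinianRing.of_finite k R.carrier
  obtain ⟨n, hn⟩ := IsArtinianRing.isNilpotent_jacobson_bot (R := R.carrier)
  have hle : p.1 ≤ Ideal.jacobson ⊥ := fun x hx => by
    rw [Ideal.mem_jacobson_iff]
    intro y
    have hu : IsUnit (1 + y * x) :=
      IsNilpotent.isUnit_one_add ((mem_iff_isNilpotent h p _).1 (p.1.mul_mem_left y hx))
    obtain ⟨z, hz⟩ := hu.exists_left_inv
    refine ⟨z, ?_⟩
    rw [Ideal.mem_bot, mul_assoc, ← sub_eq_zero.2 hz, mul_add, mul_one]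
    abel
  have key : ∀ m : ℕ, (p.1.restrictScalars k : Submodule k R.carrier) ^ m ≤
      ((Ideal.jacobson ⊥ : Ideal R.carrier) ^ m).restrictScalars k := fun m => by
    induction m with
    | zero =>
      intro x _
      rw [Submodule.pow_zero (M := Ideal.jacobson ⊥), Ideal.one_eq_top]
      exact Submodule.mem_top
    | succ m ih =>
      rw [pow_succ, Submodule.mul_le]
      intro a ha b hb
      change a * b ∈ (Ideal.jacobson ⊥ : Ideal R.carrier) ^ (m + 1)
      rw [Submodule.pow_succ (M := Ideal.jacobson ⊥)]
      exact Ideal.mul_mem_mul (ih ha) (hle hb)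
  refine ⟨n, le_bot_iff.1 ((key n).trans ?_)⟩
  rw [hn]
  exact fun x hx => hx

end Spec

/-! ### Domains and residue superalgebras -/

namespace SAlgf

variable {K R : SAlgf k}

/-- The zero ideal of a domain. -/
def botSpec (K : SAlgf k) [IsDomain K.carrier] : Spec K :=
  ⟨⊥, fun r hr i => by rw [Ideal.mem_bot] at hr ⊢; rw [hr, map_zero], by
    refine ⟨bot_ne_top, fun {a b} h => ?_⟩
    simpa using h⟩

theorem spec_eq_bot [IsDomain K.carrier] (p : Spec K) : p = K.botSpec :=
  (Spec.eq_of_le (p := K.botSpec) bot_le).symm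

theorem mem_spec_iff [IsDomain K.carrier] (p : Spec K) (r : K.carrier) : r ∈ p.1 ↔ r = 0 := by
  rw [spec_eq_bot p]; rfl

theorem comap_eq_ker [IsDomain K.carrier] (φ : R ⟶ K) (p : Spec K) (r : R.carrier) :
    r ∈ (Spec.comap φ p).1 ↔ homAlg φ r = 0 := by
  rw [Spec.mem_comap, mem_spec_iff]

theorem isDomain_of_ker (π : R ⟶ K) (hπ : Function.Surjective (homAlg π)) (p : Spec R)
    (h : ∀ r, homAlg π r = 0 ↔ r ∈ p.1) : IsDomain K.carrier := by
  have hp := p.2.2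
  have h1 : (1 : K.carrier) ≠ 0 := fun h1 => by
    rw [← map_one (homAlg π), h] at h1
    exact (Ideal.ne_top_iff_one _).1 hp.ne_top h1
  have : Nontrivial K.carrier := ⟨1, 0, h1⟩
  have : NoZeroDivisors K.carrier := ⟨fun {a b} hab => by
    obtain ⟨a, rfl⟩ := hπ a
    obtain ⟨b, rfl⟩ := hπ b
    rw [← map_mul, h] at hab
    rw [h, h]
    exact hp.mem_or_mem hab⟩
  exact NoZeroDivisors.to_isDomain _

/-- The zero ideal is the only prime of a domain here, and the pullback of any prime of `R` contains
the kernel. -/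
theorem injective_of_isDomain [IsDomain K.carrier] [Nontrivial R.carrier] (φ : K ⟶ R) :
    Function.Injective (homAlg φ) := by
  obtain ⟨q⟩ := Spec.nonempty_of_nontrivial (R := R)
  refine (injective_iff_map_eq_zero _).2 fun r hr => ?_
  rw [← mem_spec_iff (Spec.comap φ q), Spec.mem_comap, hr]
  exact zero_mem _

variable [NeZero (2 : k)]

theorem exists_residue (p : Spec R) : ∃ (K : SAlgf k) (_ : IsDomain K.carrier) (π : R ⟶ K),
    Function.Surjective (homAlg π) ∧ ∀ r, homAlg π r = 0 ↔ r ∈ p.1 := by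
  obtain ⟨K, π, hπ, h⟩ := R.exists_quot p.1 p.inv_mem
  exact ⟨K, isDomain_of_ker π hπ p h, π, hπ, h⟩

end SAlgf
end
end SuperFormal

namespace SuperFormal

noncomputable section

variable {k : Type u} [Field k]

theorem map_comp_apply' (X : FormalFunctor k) {R S T : SAlgf k} (φ : R ⟶ S) (ψ : S ⟶ T)
    (a : X.obj R) : X.map (φ ≫ ψ) a = X.map ψ (X.map φ a) :=
  Functor.map_comp_apply X φ ψ a

theorem map_id_apply' (X : FormalFunctor k) {R : SAlgf k} (a : X.obj R) : X.map (𝟙 R) a = a :=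
  Functor.map_id_apply X R a

theorem app_map {X Y : FormalFunctor k} (f : X ⟶ Y) {R S : SAlgf k} (φ : R ⟶ S) (a : X.obj R) :
    f.app S (X.map φ a) = Y.map φ (f.app R a) :=
  NatTrans.naturality_apply f φ a

/-! ### Presentations of formal superschemes -/

/-- A presentation of a functor as a directed union of finite affine superschemes with closed
immersions as transition maps. -/
structure Pres (Z : FormalFunctor k) where
  Λ : Type u
  [preorder : Preorder Λ]
  [directed : IsDirectedOrder Λ]
  [nonempty : Nonempty Λ]
  alg : Λ → SAlgf k
  tr : ∀ {l m : Λ}, l ≤ m → (alg m ⟶ alg l)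
  tr_surj : ∀ {l m : Λ} (h : l ≤ m), Function.Surjective (homAlg (tr h))
  elt : ∀ l, Z.obj (alg l)
  map_tr : ∀ {l m : Λ} (h : l ≤ m), Z.map (tr h) (elt m) = elt l
  inj : ∀ (l : Λ) {S : SAlgf k} (φ ψ : alg l ⟶ S), Z.map φ (elt l) = Z.map ψ (elt l) → φ = ψ
  surj : ∀ {S : SAlgf k} (a : Z.obj S), ∃ (l : Λ) (φ : alg l ⟶ S), Z.map φ (elt l) = a

attribute [instance] Pres.preorder Pres.directed Pres.nonempty

/-- An element that is not defined over a smaller superalgebra. -/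
def IsMinimal (Z : FormalFunctor k) {R : SAlgf k} (a : Z.obj R) : Prop :=
  ∀ (S : SAlgf k) (φ : S ⟶ R) (b : Z.obj S), Z.map φ b = a → Function.Surjective (homAlg φ)

namespace Pres

variable {Z : FormalFunctor k} (P : Pres Z)

theorem tr_comp {l m n : P.Λ} (h : l ≤ m) (h' : m ≤ n) :
    P.tr h' ≫ P.tr h = P.tr (h.trans h') :=
  P.inj n _ _ (by rw [map_comp_apply', P.map_tr, P.map_tr, P.map_tr])

theorem tr_self {l : P.Λ} (h : l ≤ l) : P.tr h = 𝟙 _ :=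
  P.inj l _ _ (by rw [P.map_tr, map_id_apply'])

theorem surj_above {S : SAlgf k} (a : Z.obj S) (l₀ : P.Λ) :
    ∃ (l : P.Λ) (_ : l₀ ≤ l) (φ : P.alg l ⟶ S), Z.map φ (P.elt l) = a := by
  obtain ⟨l, φ, rfl⟩ := P.surj a
  obtain ⟨m, h0, h1⟩ := exists_ge_ge l₀ l
  exact ⟨m, h0, P.tr h1 ≫ φ, by rw [map_comp_apply', P.map_tr]⟩

/-- Transport of a presentation along an isomorphism. -/
def ofIso {Z' : FormalFunctor k} (e : Z ≅ Z') : Pres Z' where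
  Λ := P.Λ
  alg := P.alg
  tr := P.tr
  tr_surj := P.tr_surj
  elt l := e.hom.app _ (P.elt l)
  map_tr h := by rw [← app_map, P.map_tr]
  inj l S φ ψ h := P.inj l φ ψ (by
    rw [← app_map, ← app_map] at h
    have := congrArg (e.inv.app S) h
    simpa using this)
  surj {S} a := by
    obtain ⟨l, φ, h⟩ := P.surj (e.inv.app S a)
    exact ⟨l, φ, by rw [← app_map, h]; simp⟩

/-- If the element were defined over `S`, it would come from some `A_m` through `S`; by injectivity
of the presentation that map is the surjective composite `A_m → A_l → R`, so `S → R` is onto. -/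
theorem isMinimal_map {l : P.Λ} {R : SAlgf k} (φ : P.alg l ⟶ R)
    (hφ : Function.Surjective (homAlg φ)) : IsMinimal Z (Z.map φ (P.elt l)) := by
  intro S ψ b hb r
  obtain ⟨m, h, θ, rfl⟩ := P.surj_above b l
  have : θ ≫ ψ = P.tr h ≫ φ := P.inj m _ _ (by
    rw [map_comp_apply', hb, map_comp_apply', P.map_tr])
  obtain ⟨s, rfl⟩ := hφ r
  obtain ⟨t, rfl⟩ := P.tr_surj h s
  exact ⟨homAlg θ t, by rw [← SAlgf.homAlg_comp, this, SAlgf.homAlg_comp]⟩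

theorem exists_surjective [NeZero (2 : k)] {R : SAlgf k} (a : Z.obj R) (l₀ : P.Λ) :
    ∃ (l : P.Λ) (_ : l₀ ≤ l) (S : SAlgf k) (π : P.alg l ⟶ S) (ι : S ⟶ R),
      Function.Surjective (homAlg π) ∧ Function.Injective (homAlg ι) ∧
      Z.map ι (Z.map π (P.elt l)) = a := by
  obtain ⟨l, h, φ, rfl⟩ := P.surj_above a l₀
  obtain ⟨S, π, ι, rfl, hπ, hι⟩ := SAlgf.exists_factor φ
  exact ⟨l, h, S, π, ι, hπ, hι, (map_comp_apply' Z π ι _).symm⟩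

/-- A compatible family of elements defines a morphism. -/
def desc {T : FormalFunctor k} (t : ∀ l, T.obj (P.alg l))
    (ht : ∀ {l m : P.Λ} (h : l ≤ m), T.map (P.tr h) (t m) = t l) : Z ⟶ T :=
  have key : ∀ {S : SAlgf k} (l m : P.Λ) (φ : P.alg l ⟶ S) (ψ : P.alg m ⟶ S),
      Z.map φ (P.elt l) = Z.map ψ (P.elt m) → T.map φ (t l) = T.map ψ (t m) :=
    fun {S} l m φ ψ h => by
      obtain ⟨n, hl, hm⟩ := exists_ge_ge l m
      have : P.tr hl ≫ φ = P.tr hm ≫ ψ := P.inj n _ _ (by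
        rw [map_comp_apply', P.map_tr, h, map_comp_apply', P.map_tr])
      rw [← ht hl, ← ht hm, ← map_comp_apply', ← map_comp_apply', this]
  { app S := ↾fun a => T.map (P.surj a).choose_spec.choose (t (P.surj a).choose)
    naturality {R S} φ := by
      ext a
      refine Eq.trans ?_ (map_comp_apply' T _ φ _)
      refine key _ _ _ _ ?_
      rw [map_comp_apply', (P.surj a).choose_spec.choose_spec]
      exact (P.surj (Z.map φ a)).choose_spec.choose_spec }

theorem desc_elt {T : FormalFunctor k} (t : ∀ l, T.obj (P.alg l))
    (ht : ∀ {l m : P.Λ} (h : l ≤ m), T.map (P.tr h) (t m) = t l) (l : P.Λ) :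
    (P.desc t ht).app _ (P.elt l) = t l := by
  have h := (P.surj (P.elt l)).choose_spec.choose_spec
  change T.map (P.surj (P.elt l)).choose_spec.choose (t (P.surj (P.elt l)).choose) = t l
  obtain ⟨n, hl, hm⟩ := exists_ge_ge l (P.surj (P.elt l)).choose
  have : P.tr hl = P.tr hm ≫ (P.surj (P.elt l)).choose_spec.choose := P.inj n _ _ (by
    rw [map_comp_apply', P.map_tr, P.map_tr, h])
  rw [← ht hl, this, map_comp_apply', ht]

/-- The presentation of a colimit of finite affine superschemes. -/
def ofColimit {Λ : Type u} [Preorder Λ] [IsDirectedOrder Λ] [Nonempty Λ]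
    (A : Λ ⥤ (SAlgf k)ᵒᵖ)
    (hA : ∀ (l m : Λ) (h : l ⟶ m), Function.Surjective (homAlg (A.map h).unop)) :
    Pres (Limits.colimit (A ⋙ coyoneda)) :=
  have hc (S : SAlgf k) := Limits.isColimitOfPreserves ((evaluation _ (Type u)).obj S)
    (Limits.colimit.isColimit (A ⋙ coyoneda))
  have hmap {l : Λ} {S : SAlgf k} (φ : (A.obj l).unop ⟶ S) :
      (Limits.colimit (A ⋙ coyoneda)).map φ
        ((Limits.colimit.ι (A ⋙ coyoneda) l).app _ (𝟙 (A.obj l).unop)) =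
      (Limits.colimit.ι (A ⋙ coyoneda) l).app S φ := by
    rw [← app_map]
    exact congrArg _ (Category.id_comp φ)
  { Λ := Λ
    alg l := (A.obj l).unop
    tr {l m} h := (A.map (homOfLE h)).unop
    tr_surj h := hA _ _ _
    elt l := (Limits.colimit.ι (A ⋙ coyoneda) l).app _ (𝟙 (A.obj l).unop)
    map_tr {l m} h := by
      rw [hmap]
      have := congrArg (fun t => t.app (A.obj l).unop (𝟙 (A.obj l).unop))
        (Limits.colimit.w (A ⋙ coyoneda) (homOfLE h))
      refine Eq.trans ?_ this
      exact congrArg ((Limits.colimit.ι (A ⋙ coyoneda) m).app (A.obj l).unop)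
        (Category.comp_id (A.map (homOfLE h)).unop).symm
    inj l S φ ψ h := by
      rw [hmap, hmap] at h
      obtain ⟨m, f, hf⟩ := (Limits.Types.FilteredColimit.isColimit_eq_iff' (hc S) (i := l) φ ψ).1 h
      refine SAlgf.hom_ext fun r => ?_
      obtain ⟨s, rfl⟩ := hA l m f r
      exact congrArg (fun t : (A.obj m).unop ⟶ S => homAlg t s) hf
    surj {S} a := by
      obtain ⟨l, φ, h⟩ := Limits.Types.jointly_surjective_of_isColimit (hc S) a
      exact ⟨l, φ, (hmap φ).trans h⟩ }

end Pres

theorem IsFormalSuperscheme.nonempty_pres {Z : FormalFunctor k} (h : IsFormalSuperscheme Z) :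
    Nonempty (Pres Z) := by
  obtain ⟨Λ, _, _, _, A, hA, ⟨e⟩⟩ := h
  exact ⟨(Pres.ofColimit A hA).ofIso e.symm⟩

/-! ### Points -/

theorem Points.exists_mk {X : FormalFunctor k} (x : Points X) :
    ∃ (R : SAlgf k) (a : X.obj R) (p : Spec R), Points.mk X R a p = x := by
  obtain ⟨⟨⟨R, a⟩, p⟩, rfl⟩ := Quot.exists_rep x
  exact ⟨R, a, p, rfl⟩

namespace Pres

variable {Z : FormalFunctor k} (P : Pres Z)

theorem mk_comap_tr {l m : P.Λ} (h : l ≤ m) (p : Spec (P.alg l)) :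
    Points.mk Z _ (P.elt m) (Spec.comap (P.tr h) p) = Points.mk Z _ (P.elt l) p := by
  rw [← Points.mk_map, P.map_tr]

theorem exists_mk_above (x : Points Z) (l₀ : P.Λ) :
    ∃ (l : P.Λ) (_ : l₀ ≤ l) (p : Spec (P.alg l)), Points.mk Z _ (P.elt l) p = x := by
  obtain ⟨R, a, p, rfl⟩ := x.exists_mk
  obtain ⟨l, h, φ, rfl⟩ := P.surj_above a l₀
  exact ⟨l, h, Spec.comap φ p, (Points.mk_map _ _ _ _).symm⟩

/-- The primes occurring in a presentation that represent a point. -/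
def primesOf (R : SAlgf k) (a : Z.obj R) (q : Spec R) : Set (Σ l : P.Λ, Spec (P.alg l)) :=
  {z | ∃ (n : P.Λ) (h : z.1 ≤ n) (φ : P.alg n ⟶ R), Z.map φ (P.elt n) = a ∧
    Spec.comap (P.tr h) z.2 = Spec.comap φ q}

theorem primesOf_map {R S : SAlgf k} (ψ : R ⟶ S) (a : Z.obj R) (q : Spec S) :
    P.primesOf S (Z.map ψ a) q = P.primesOf R a (Spec.comap ψ q) := by
  ext ⟨m, p⟩
  constructor
  · rintro ⟨n, h, φ, hφ, hp⟩
    obtain ⟨N, hN, θ, rfl⟩ := P.surj_above a n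
    have : P.tr hN ≫ φ = θ ≫ ψ := P.inj N _ _ (by
      rw [map_comp_apply', P.map_tr, hφ, map_comp_apply'])
    refine ⟨N, h.trans hN, θ, rfl, ?_⟩
    rw [← P.tr_comp h hN, Spec.comap_comp, hp, ← Spec.comap_comp, this, Spec.comap_comp]
  · rintro ⟨n, h, φ, rfl, hp⟩
    exact ⟨n, h, φ ≫ ψ, map_comp_apply' _ _ _ _, hp⟩

/-- Separating elements of the colimit `|Z|` requires an invariant of points. The set `primesOf` of
all primes of the `A_l` that agree with a given representative at some higher level is constant on
equivalence classes by `primesOf_map`, and it recovers the prime because closed immersions are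
injective on primes. -/
theorem mk_injective (l : P.Λ) : Function.Injective (Points.mk Z _ (P.elt l)) := by
  intro p q hpq
  let F : Points Z → Set (Σ l : P.Λ, Spec (P.alg l)) :=
    Quot.lift (fun z => P.primesOf z.1.unop.1 z.1.unop.2 z.2) (by
      rintro ⟨⟨S, b⟩, q⟩ ⟨⟨R, a⟩, p⟩ ⟨⟨φ, hφ⟩, h⟩
      change P.primesOf S b q = P.primesOf R a p
      have hφ' : Z.map φ a = b := hφ
      have h' : p = Spec.comap φ q := h
      rw [h', ← hφ']
      exact P.primesOf_map φ a q)
  have h1 : (⟨l, p⟩ : Σ l : P.Λ, Spec (P.alg l)) ∈ P.primesOf _ (P.elt l) p :=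
    ⟨l, le_rfl, 𝟙 _, map_id_apply' _ _, by rw [P.tr_self]⟩
  have h2 : P.primesOf _ (P.elt l) p = P.primesOf _ (P.elt l) q := congrArg F hpq
  rw [h2] at h1
  obtain ⟨n, h, φ, hφ, hc⟩ := h1
  have : φ = P.tr h := P.inj n _ _ (by rw [hφ, P.map_tr])
  rw [this] at hc
  exact Spec.comap_injective _ (P.tr_surj h) hc

theorem mk_map_injective {l : P.Λ} {R : SAlgf k} (φ : P.alg l ⟶ R)
    (hφ : Function.Surjective (homAlg φ)) :
    Function.Injective (Points.mk Z R (Z.map φ (P.elt l))) := fun p q h => by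
  rw [Points.mk_map, Points.mk_map] at h
  exact Spec.comap_injective _ hφ (P.mk_injective l h)

theorem mk_injective_of_isMinimal (P : Pres Z) {R : SAlgf k} {a : Z.obj R} (ha : IsMinimal Z a) :
    Function.Injective (Points.mk Z R a) := by
  obtain ⟨l, φ, rfl⟩ := P.surj a
  exact P.mk_map_injective φ (ha _ φ _ rfl)

theorem spec_eq_of_mem_component (P : Pres Z) {x : Points Z} {R : SAlgf k} {a : Z.obj R}
    (hx : a ∈ (component Z x).obj R) (ha : IsMinimal Z a) (p q : Spec R) : p = q :=
  P.mk_injective_of_isMinimal ha ((hx p).trans (hx q).symm)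

end Pres

/-! ### Idempotents of components -/

section PointIdem

variable (X : FormalFunctor k) {R : SAlgf k} (a : X.obj R) (x : Points X)

/-- The idempotent of `R` that is the indicator function of the preimage of `x` under
`Spec R → |X|`. -/
def pointIdem : R.carrier := (Spec.exists_idempotent {p : Spec R | Points.mk X R a p = x}).choose

theorem pointIdem_even : pointIdem X a x ∈ R.part 0 :=
  (Spec.exists_idempotent {p : Spec R | Points.mk X R a p = x}).choose_spec.1

theorem pointIdem_mul_self : pointIdem X a x * pointIdem X a x = pointIdem X a x :=
  (Spec.exists_idempotent {p : Spec R | Points.mk X R a p = x}).choose_spec.2.1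

theorem pointIdem_mem_iff (p : Spec R) : pointIdem X a x ∈ p.1 ↔ Points.mk X R a p ≠ x :=
  (Spec.exists_idempotent {p : Spec R | Points.mk X R a p = x}).choose_spec.2.2 p

/-- Idempotents are determined by the primes containing them, so the chosen ones are automatically
natural. -/
theorem pointIdem_map {S : SAlgf k} (φ : R ⟶ S) :
    homAlg φ (pointIdem X a x) = pointIdem X (X.map φ a) x := by
  refine Spec.idempotent_unique ?_ ?_ (pointIdem_mul_self _ _ _) fun p => ?_
  · exact φ.map_mem (pointIdem_even X a x)
  · rw [← map_mul, pointIdem_mul_self]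
  · rw [pointIdem_mem_iff, Points.mk_map, ← pointIdem_mem_iff, Spec.mem_comap]

theorem mem_component_iff : a ∈ (component X x).obj R ↔ pointIdem X a x = 1 := by
  constructor
  · intro h
    refine Spec.isIdempotentElem_eq_one (pointIdem_mul_self _ _ _) fun p => ?_
    rw [pointIdem_mem_iff, not_not]
    exact h p
  · intro h p
    by_contra hp
    rw [← ne_eq, ← pointIdem_mem_iff, h] at hp
    exact (Ideal.ne_top_iff_one _).1 p.2.2.ne_top hp

end PointIdem

/-! ### Closed subfunctors -/

/-- Closed subfunctors: the condition to lie in the subfunctor is given by superideals. -/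
def IsClosedSub {X : FormalFunctor k} (G : Subfunctor X) : Prop :=
  ∀ (R : SAlgf k) (a : X.obj R), ∃ I : Ideal R.carrier, (∀ r ∈ I, R.inv r ∈ I) ∧
    ∀ (S : SAlgf k) (φ : R ⟶ S), X.map φ a ∈ G.obj S ↔ ∀ r ∈ I, homAlg φ r = 0

/-- Membership means the vanishing of an ideal of elements of `R`, which an injection detects. -/
theorem IsClosedSub.mem_of_injective {X : FormalFunctor k} {G : Subfunctor X}
    (hG : IsClosedSub G) {R S : SAlgf k} (ι : R ⟶ S) (hι : Function.Injective (homAlg ι))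
    {a : X.obj R} (ha : X.map ι a ∈ G.obj S) : a ∈ G.obj R := by
  obtain ⟨I, -, hI⟩ := hG R a
  have h := (hI R (𝟙 R)).2 fun r hr => hι (by
    rw [map_zero]; exact (hI S ι).1 ha r hr)
  rwa [map_id_apply'] at h

theorem IsClosedSub.preimage {X Y : FormalFunctor k} {G : Subfunctor Y} (hG : IsClosedSub G)
    (f : X ⟶ Y) : IsClosedSub (G.preimage f) := fun R a => by
  obtain ⟨I, h1, hI⟩ := hG R (f.app R a)
  refine ⟨I, h1, fun S φ => ?_⟩
  rw [← hI, ← app_map]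
  rfl

/-- The ideal is the annihilator of the idempotent `e` of `x`. It contains `1 - e`, so a morphism
kills it exactly when it sends `e` to 1. -/
theorem isClosedSub_component [NeZero (2 : k)] (X : FormalFunctor k) (x : Points X) :
    IsClosedSub (component X x) := fun R a => by
  have he := R.even_mul_comm (pointIdem_even X a x)
  refine ⟨{ carrier := {r | pointIdem X a x * r = 0}
            add_mem' := fun {r s} (hr : _ = _) (hs : _ = _) => by
              change _ * (r + s) = 0
              rw [mul_add, hr, hs, add_zero]
            zero_mem' := mul_zero _
            smul_mem' := fun r s (hs : _ = _) => by
              change _ * (r * s) = 0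
              rw [← mul_assoc, he, mul_assoc, hs, mul_zero] }, ?_, ?_⟩
  · intro r (hr : _ = _)
    change _ * R.inv r = 0
    rw [← R.mem_zero_iff.1 (pointIdem_even X a x), ← map_mul, hr, map_zero]
  · intro S φ
    rw [mem_component_iff, ← pointIdem_map]
    constructor
    · intro h r (hr : _ = _)
      rw [← one_mul (homAlg φ r), ← h, ← map_mul, hr, map_zero]
    · intro h
      have := h (1 - pointIdem X a x) (by
        change _ * (1 - _) = 0
        rw [mul_sub, pointIdem_mul_self, mul_one, sub_self])
      rw [map_sub, map_one, sub_eq_zero] at this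
      exact this.symm

/-! ### Presentations, minimal elements and points of closed subfunctors -/

section ClosedSub

variable [NeZero (2 : k)] {X : FormalFunctor k} {G : Subfunctor X}

theorem IsClosedSub.exists_quot (hG : IsClosedSub G) {R : SAlgf k} (a : X.obj R) :
    ∃ (Q : SAlgf k) (π : R ⟶ Q), Function.Surjective (homAlg π) ∧ X.map π a ∈ G.obj Q ∧
      ∀ (S : SAlgf k) (φ : R ⟶ S), X.map φ a ∈ G.obj S → ∃ ψ : Q ⟶ S, π ≫ ψ = φ := by
  obtain ⟨I, h1, hI⟩ := hG R a
  obtain ⟨Q, π, hπ, hk⟩ := R.exists_quot I h1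
  exact ⟨Q, π, hπ, (hI _ _).2 fun r hr => (hk r).2 hr, fun S φ hφ =>
    SAlgf.exists_lift_of_surjective π hπ φ fun r hr => (hI _ _).1 hφ r ((hk r).1 hr)⟩

/-- Each `A_l` is replaced by its universal quotient over which the element lands in the subfunctor;
transition maps stay surjective. -/
theorem Pres.exists_sub (P : Pres X) (hG : IsClosedSub G) : Nonempty (Pres G.toFunctor) := by
  choose Q π hπ hmem hl using fun l => hG.exists_quot (P.elt l)
  have htr : ∀ {l m : P.Λ} (h : l ≤ m), ∃ ψ : Q m ⟶ Q l, π m ≫ ψ = P.tr h ≫ π l :=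
    fun {l m} h => hl m _ _ (by rw [map_comp_apply', P.map_tr]; exact hmem l)
  choose t ht using @htr
  refine ⟨{ Λ := P.Λ, alg := Q, tr := t, tr_surj := ?_,
            elt := fun l => ⟨X.map (π l) (P.elt l), hmem l⟩, map_tr := ?_, inj := ?_,
            surj := ?_ }⟩
  · intro l m h q
    obtain ⟨r, rfl⟩ := hπ l q
    obtain ⟨s, rfl⟩ := P.tr_surj h r
    exact ⟨homAlg (π m) s, by rw [← SAlgf.homAlg_comp, ht, SAlgf.homAlg_comp]⟩
  · intro l m h
    refine Subtype.ext ?_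
    change X.map (t h) (X.map (π m) (P.elt m)) = X.map (π l) (P.elt l)
    rw [← map_comp_apply', ht, map_comp_apply', P.map_tr]
  · intro l S φ ψ h
    have h' : X.map φ (X.map (π l) (P.elt l)) = X.map ψ (X.map (π l) (P.elt l)) :=
      congrArg Subtype.val h
    rw [← map_comp_apply', ← map_comp_apply'] at h'
    have := P.inj l _ _ h'
    refine SAlgf.hom_ext fun q => ?_
    obtain ⟨r, rfl⟩ := hπ l q
    rw [← SAlgf.homAlg_comp, this, SAlgf.homAlg_comp]
  · rintro S ⟨a, ha⟩
    obtain ⟨l, φ, rfl⟩ := P.surj a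
    obtain ⟨ψ, rfl⟩ := hl l S φ ha
    exact ⟨l, ψ, Subtype.ext (map_comp_apply' X (π l) ψ _).symm⟩

/-- A closed condition that holds over `R` already holds over any subalgebra on which the element is
defined, so shrinking the algebra does not leave the subfunctor. -/
theorem IsClosedSub.isMinimal_iff (hG : IsClosedSub G) {R : SAlgf k} (a : G.toFunctor.obj R) :
    IsMinimal G.toFunctor a ↔ IsMinimal X (a : X.obj R) := by
  constructor
  · intro h S φ b hb
    obtain ⟨Q, π, ι, rfl, hπ, hι⟩ := SAlgf.exists_factor φ
    have hQ : X.map π b ∈ G.obj Q := hG.mem_of_injective ι hι (by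
      rw [← map_comp_apply', hb]; exact a.2)
    have hs := h Q ι ⟨X.map π b, hQ⟩ (Subtype.ext (by
      change X.map ι (X.map π b) = a
      rw [← map_comp_apply', hb]))
    exact hs.comp hπ
  · intro h S φ b hb
    exact h S φ b.1 (congrArg Subtype.val hb)

/-- The points of a closed subfunctor are points of the ambient functor. -/
theorem IsClosedSub.points_injective (P : Pres X) (hG : IsClosedSub G) :
    Function.Injective (Points.map G.ι) := by
  intro x y hxy
  obtain ⟨R, ⟨a, ha⟩, p, rfl⟩ := x.exists_mk
  obtain ⟨S, ⟨b, hb⟩, q, rfl⟩ := y.exists_mk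
  change Points.mk X R a p = Points.mk X S b q at hxy
  obtain ⟨l, φ, rfl⟩ := P.surj a
  obtain ⟨m, hm, ψ, rfl⟩ := P.surj_above b l
  rw [Points.mk_map, Points.mk_map, ← P.mk_comap_tr hm] at hxy
  have hpq := P.mk_injective m hxy
  obtain ⟨Kp, _, πp, hπp, hkp⟩ := SAlgf.exists_residue p
  obtain ⟨Kq, _, πq, hπq, hkq⟩ := SAlgf.exists_residue q
  -- Both representatives induce the same prime `r` of a common `A_m`. Its residue algebra `K`
  -- embeds into those of `p` and `q`, and the two points are compared over `K`.
  set r := Spec.comap ψ q with hr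
  obtain ⟨K, _, π, hπ, hk⟩ := SAlgf.exists_residue r
  obtain ⟨α, hα⟩ := SAlgf.exists_lift_of_surjective π hπ (P.tr hm ≫ φ ≫ πp) fun s hs => by
    rw [hk, ← hpq] at hs
    exact (hkp _).2 hs
  obtain ⟨β, hβ⟩ := SAlgf.exists_lift_of_surjective π hπ (ψ ≫ πq) fun s hs => by
    rw [hk, hr] at hs
    exact (hkq _).2 hs
  -- Membership descends along the embedding of `K` into the residue algebra of `p`, because the
  -- subfunctor is closed.
  have hmem : X.map π (P.elt m) ∈ G.obj K :=
    hG.mem_of_injective α (SAlgf.injective_of_isDomain α) (by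
      rw [← map_comp_apply', hα, map_comp_apply', P.map_tr, map_comp_apply']
      exact G.map πp ha)
  have comp : ∀ {T L : SAlgf k} [IsDomain L.carrier] (t : Spec T) (ρ : T ⟶ L)
      (_ : ∀ s, homAlg ρ s = 0 ↔ s ∈ t.1) (c : G.toFunctor.obj T) (d : G.toFunctor.obj K)
      (γ : K ⟶ L) (_ : G.toFunctor.map γ d = G.toFunctor.map ρ c),
      Points.mk G.toFunctor T c t = Points.mk G.toFunctor K d K.botSpec := by
    intro T L _ t ρ hρ c d γ hγ
    have e1 : Spec.comap ρ L.botSpec = t := Spec.ext fun s => by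
      rw [SAlgf.comap_eq_ker, hρ]
    have e2 : Spec.comap γ L.botSpec = K.botSpec := SAlgf.spec_eq_bot _
    rw [← e1, ← e2, ← Points.mk_map, ← Points.mk_map, hγ]
  refine (comp p πp hkp _ ⟨_, hmem⟩ α (Subtype.ext ?_)).trans
    (comp q πq hkq _ ⟨_, hmem⟩ β (Subtype.ext ?_)).symm
  · change X.map α (X.map π (P.elt m)) = X.map πp (X.map φ (P.elt l))
    rw [← map_comp_apply', hα, map_comp_apply', P.map_tr, map_comp_apply']
  · change X.map β (X.map π (P.elt m)) = X.map πq (X.map ψ (P.elt m))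
    rw [← map_comp_apply', hβ, map_comp_apply']

end ClosedSub

end
end SuperFormal

namespace SuperFormal

noncomputable section

/-! ### Contractions of tensors with functionals -/

section Contraction

variable {k : Type u} [Field k] {V W U : Type u} [AddCommGroup V] [Module k V]
  [AddCommGroup W] [Module k W] [AddCommGroup U] [Module k U]

/-- Contraction of the second factor of a tensor with a functional. -/
def contractRight (α : W →ₗ[k] k) : V ⊗[k] W →ₗ[k] V :=
  (TensorProduct.rid k V).toLinearMap ∘ₗ TensorProduct.map LinearMap.id α

/-- Contraction of the first factor of a tensor with a functional. -/
def contractLeft (ρ : V →ₗ[k] k) : V ⊗[k] W →ₗ[k] W :=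
  (TensorProduct.lid k W).toLinearMap ∘ₗ TensorProduct.map ρ LinearMap.id

/-- The functional `α ⊗ β`. -/
def tensorFunctional (α : V →ₗ[k] k) (β : W →ₗ[k] k) : V ⊗[k] W →ₗ[k] k :=
  (TensorProduct.lid k k).toLinearMap ∘ₗ TensorProduct.map α β

@[simp] theorem contractRight_tmul (α : W →ₗ[k] k) (v : V) (w : W) :
    contractRight α (v ⊗ₜ[k] w) = α w • v := by simp [contractRight]

@[simp] theorem contractLeft_tmul (ρ : V →ₗ[k] k) (v : V) (w : W) :
    contractLeft ρ (v ⊗ₜ[k] w) = ρ v • w := by simp [contractLeft]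

@[simp] theorem tensorFunctional_tmul (α : V →ₗ[k] k) (β : W →ₗ[k] k) (v : V) (w : W) :
    tensorFunctional α β (v ⊗ₜ[k] w) = α v * β w := by simp [tensorFunctional]

theorem apply_contractRight (α : V →ₗ[k] k) (β : W →ₗ[k] k) (t : V ⊗[k] W) :
    α (contractRight β t) = tensorFunctional α β t := by
  induction t with
  | zero => simp
  | add x y hx hy => simp only [map_add, hx, hy]
  | tmul v w => simp [mul_comm]

theorem apply_contractLeft (α : V →ₗ[k] k) (β : W →ₗ[k] k) (t : V ⊗[k] W) :
    β (contractLeft α t) = tensorFunctional α β t := by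
  induction t with
  | zero => simp
  | add x y hx hy => simp only [map_add, hx, hy]
  | tmul v w => simp

theorem contractRight_add (α β : W →ₗ[k] k) (t : V ⊗[k] W) :
    contractRight (α + β) t = contractRight α t + contractRight β t := by
  simp [contractRight, TensorProduct.map_add_right]

theorem contractRight_smul (c : k) (α : W →ₗ[k] k) (t : V ⊗[k] W) :
    contractRight (c • α) t = c • contractRight α t := by
  simp [contractRight, TensorProduct.map_smul_right]

theorem contractLeft_add (α β : V →ₗ[k] k) (t : V ⊗[k] W) :
    contractLeft (α + β) t = contractLeft α t + contractLeft β t := by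
  simp [contractLeft, TensorProduct.map_add_left]

theorem contractLeft_smul (c : k) (α : V →ₗ[k] k) (t : V ⊗[k] W) :
    contractLeft (c • α) t = c • contractLeft α t := by
  simp [contractLeft, TensorProduct.map_smul_left]

theorem contractLeft_sub (α β : V →ₗ[k] k) (t : V ⊗[k] W) :
    contractLeft (α - β) t = contractLeft α t - contractLeft β t := by
  induction t with
  | zero => simp
  | add x y hx hy => simp only [map_add, hx, hy]; abel
  | tmul v w => simp [sub_smul]

theorem contractRight_sub (α β : W →ₗ[k] k) (t : V ⊗[k] W) :
    contractRight (α - β) t = contractRight α t - contractRight β t := by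
  induction t with
  | zero => simp
  | add x y hx hy => simp only [map_add, hx, hy]; abel
  | tmul v w => simp [sub_smul]

theorem contractRight_map {V' W' : Type u} [AddCommGroup V'] [Module k V'] [AddCommGroup W']
    [Module k W'] (f : V →ₗ[k] V') (g : W →ₗ[k] W') (α : W' →ₗ[k] k) (t : V ⊗[k] W) :
    contractRight α (TensorProduct.map f g t) = f (contractRight (α ∘ₗ g) t) := by
  induction t with
  | zero => simp
  | add x y hx hy => simp only [map_add, hx, hy]
  | tmul v w => simp

theorem contractLeft_map {V' W' : Type u} [AddCommGroup V'] [Module k V'] [AddCommGroup W']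
    [Module k W'] (f : V →ₗ[k] V') (g : W →ₗ[k] W') (α : V' →ₗ[k] k) (t : V ⊗[k] W) :
    contractLeft α (TensorProduct.map f g t) = g (contractLeft (α ∘ₗ f) t) := by
  induction t with
  | zero => simp
  | add x y hx hy => simp only [map_add, hx, hy]
  | tmul v w => simp

theorem tensorFunctional_map {V' W' : Type u} [AddCommGroup V'] [Module k V'] [AddCommGroup W']
    [Module k W'] (f : V →ₗ[k] V') (g : W →ₗ[k] W') (α : V' →ₗ[k] k) (β : W' →ₗ[k] k)
    (t : V ⊗[k] W) :
    tensorFunctional α β (TensorProduct.map f g t) = tensorFunctional (α ∘ₗ f) (β ∘ₗ g) t := by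
  rw [← apply_contractRight, contractRight_map, ← apply_contractRight]; rfl

theorem tensorFunctional_assoc (α : U →ₗ[k] k) (β : V →ₗ[k] k) (γ : W →ₗ[k] k)
    (t : (U ⊗[k] V) ⊗[k] W) :
    tensorFunctional α (tensorFunctional β γ) (TensorProduct.assoc k _ _ _ t) =
      tensorFunctional (tensorFunctional α β) γ t := by
  induction t with
  | zero => simp
  | add x y hx hy => simp only [map_add, hx, hy]
  | tmul s c =>
    induction s with
    | zero => simp
    | add x y hx hy => simp only [map_add, TensorProduct.add_tmul, hx, hy]
    | tmul a b => simp [mul_assoc]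

/-- The coordinates of `t` along a basis of `W` are contractions with the coordinate functionals.
All coalgebra identities below are tested on functionals in this way, with no finiteness assumption
on `W`. -/
theorem tensor_eq_zero {t : V ⊗[k] W} (h : ∀ α : W →ₗ[k] k, contractRight α t = 0) : t = 0 := by
  let b := Module.Basis.ofVectorSpace k W
  classical
  refine (TensorProduct.equivFinsuppOfBasisRight (M := V) b).injective ?_
  rw [map_zero]
  ext i
  have key : ∀ t : V ⊗[k] W, TensorProduct.equivFinsuppOfBasisRight b t i =
      contractRight (b.coord i) t := fun t => by
    induction t with
    | zero => simp
    | add x y hx hy => simp only [map_add, Finsupp.add_apply, hx, hy]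
    | tmul v w => simp
  rw [key, h]
  rfl

theorem tensor_ext {s t : V ⊗[k] W} (h : ∀ α : W →ₗ[k] k, contractRight α s = contractRight α t) :
    s = t := by
  rw [← sub_eq_zero]
  exact tensor_eq_zero fun α => by rw [map_sub, h, sub_self]

theorem eq_of_forall_dual {v w : V} (h : ∀ α : V →ₗ[k] k, α v = α w) : v = w := by
  rw [← sub_eq_zero, ← Module.forall_dual_apply_eq_zero_iff k]
  intro α
  rw [map_sub, h, sub_self]

theorem tensor_ext₂ {s t : V ⊗[k] W}
    (h : ∀ (α : V →ₗ[k] k) (β : W →ₗ[k] k), tensorFunctional α β s = tensorFunctional α β t) :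
    s = t :=
  tensor_ext fun β => eq_of_forall_dual fun α => by
    rw [apply_contractRight, apply_contractRight, h]

theorem contractRight_tensorFunctional (α : V →ₗ[k] k) (β : W →ₗ[k] k) (t : U ⊗[k] (V ⊗[k] W)) :
    contractRight (tensorFunctional α β) t =
      contractRight α (contractRight β ((TensorProduct.assoc k U V W).symm t)) := by
  induction t with
  | zero => simp
  | add x y hx hy => simp only [map_add, hx, hy]
  | tmul u s =>
    induction s with
    | zero => simp
    | add x y hx hy => simp only [map_add, TensorProduct.tmul_add, hx, hy]
    | tmul v w => simp [smul_smul, mul_comm]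

theorem tensor_ext_assoc {s t : U ⊗[k] (V ⊗[k] W)}
    (h : ∀ (α : V →ₗ[k] k) (β : W →ₗ[k] k), contractRight (tensorFunctional α β) s =
      contractRight (tensorFunctional α β) t) : s = t := by
  refine (TensorProduct.assoc k U V W).symm.injective ?_
  refine tensor_ext fun β => tensor_ext fun α => ?_
  rw [← contractRight_tensorFunctional, h, contractRight_tensorFunctional]

/-- For a projection `p` onto `B`, the functional `α ∘ p - α` vanishes on `B`; hence applying `p` in
the second factor changes no contraction of `t`. -/
theorem mem_range_map_id {B : Submodule k W} {t : V ⊗[k] W}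
    (h : ∀ α : W →ₗ[k] k, (∀ b ∈ B, α b = 0) → contractRight α t = 0) :
    t ∈ LinearMap.range (TensorProduct.map (LinearMap.id : V →ₗ[k] V) B.subtype) := by
  obtain ⟨p, hp⟩ := B.subtype.exists_leftInverse_of_injective B.ker_subtype
  refine ⟨TensorProduct.map LinearMap.id p t, tensor_ext fun α => ?_⟩
  rw [contractRight_map, contractRight_map, LinearMap.id_apply, LinearMap.id_apply, ← sub_eq_zero]
  have := h (α ∘ₗ B.subtype ∘ₗ p - α) fun b hb => by
    have : p b = ⟨b, hb⟩ := LinearMap.congr_fun hp ⟨b, hb⟩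
    simp [this]
  rw [contractRight_sub] at this
  exact this

theorem mem_range_map_id_iff {B : Submodule k W} {t : V ⊗[k] W} :
    t ∈ LinearMap.range (TensorProduct.map (LinearMap.id : V →ₗ[k] V) B.subtype) ↔
      ∀ α : W →ₗ[k] k, (∀ b ∈ B, α b = 0) → contractRight α t = 0 := by
  refine ⟨?_, mem_range_map_id⟩
  rintro ⟨s, rfl⟩ α hα
  have h0 : α ∘ₗ B.subtype = 0 := LinearMap.ext fun b => hα b b.2
  rw [contractRight_map, h0]
  simp [contractRight]

theorem mem_range_map_map {B : Submodule k W} {t : W ⊗[k] W}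
    (hr : ∀ α : W →ₗ[k] k, (∀ b ∈ B, α b = 0) → contractRight α t = 0)
    (hl : ∀ α : W →ₗ[k] k, (∀ b ∈ B, α b = 0) → contractLeft α t = 0) :
    t ∈ LinearMap.range (TensorProduct.map B.subtype B.subtype) := by
  obtain ⟨p, hp⟩ := B.subtype.exists_leftInverse_of_injective B.ker_subtype
  have key : ∀ α : W →ₗ[k] k, ∀ b ∈ B, (α ∘ₗ B.subtype ∘ₗ p - α) b = 0 := fun α b hb => by
    have : p b = ⟨b, hb⟩ := LinearMap.congr_fun hp ⟨b, hb⟩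
    simp [this]
  refine ⟨TensorProduct.map p p t, tensor_ext₂ fun α β => ?_⟩
  rw [tensorFunctional_map, tensorFunctional_map]
  have e1 : ∀ α β : W →ₗ[k] k, tensorFunctional (α ∘ₗ B.subtype ∘ₗ p) β t =
      tensorFunctional α β t := fun α β => by
    have h := hl _ (key α)
    rw [contractLeft_sub, sub_eq_zero] at h
    rw [← apply_contractLeft, h, apply_contractLeft]
  have e2 : ∀ α β : W →ₗ[k] k, tensorFunctional α (β ∘ₗ B.subtype ∘ₗ p) t =
      tensorFunctional α β t := fun α β => by
    have h := hr _ (key β)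
    rw [contractRight_sub, sub_eq_zero] at h
    rw [← apply_contractRight, h, apply_contractRight]
  exact (e1 α _).trans (e2 α β)

theorem mem_range_map_left {B : Submodule k V} {t : V ⊗[k] W}
    (h : ∀ α : V →ₗ[k] k, (∀ b ∈ B, α b = 0) → contractLeft α t = 0) :
    t ∈ LinearMap.range (TensorProduct.map B.subtype (LinearMap.id : W →ₗ[k] W)) := by
  obtain ⟨p, hp⟩ := B.subtype.exists_leftInverse_of_injective B.ker_subtype
  have key : ∀ α : V →ₗ[k] k, ∀ b ∈ B, (α ∘ₗ B.subtype ∘ₗ p - α) b = 0 := fun α b hb => by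
    have : p b = ⟨b, hb⟩ := LinearMap.congr_fun hp ⟨b, hb⟩
    simp [this]
  refine ⟨TensorProduct.map p LinearMap.id t, tensor_ext₂ fun α β => ?_⟩
  rw [tensorFunctional_map, tensorFunctional_map]
  have h := h _ (key α)
  rw [contractLeft_sub, sub_eq_zero] at h
  rw [← apply_contractLeft]
  exact (congrArg β h).trans (apply_contractLeft _ _ _)

theorem contractRight_mem {B : Submodule k W} {t : W ⊗[k] W}
    (ht : t ∈ LinearMap.range (TensorProduct.map B.subtype B.subtype)) (α : W →ₗ[k] k) :
    contractRight α t ∈ B := by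
  obtain ⟨s, rfl⟩ := ht
  rw [contractRight_map]
  exact Subtype.mem _

/-- A linear map from a dual space to a finite-dimensional space whose components are evaluations
is contraction with a tensor. -/
theorem exists_contractRight_eq [Module.Finite k V] (h : (W →ₗ[k] k) →ₗ[k] V)
    (hh : ∀ ρ : V →ₗ[k] k, ∃ w : W, ∀ α, ρ (h α) = α w) :
    ∃ t : V ⊗[k] W, ∀ α, contractRight α t = h α := by
  let b := Module.finBasis k V
  choose w hw using fun i => hh (b.coord i)
  refine ⟨∑ i, b i ⊗ₜ w i, fun α => ?_⟩
  rw [map_sum]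
  conv_rhs => rw [← b.sum_repr (h α)]
  exact Finset.sum_congr rfl fun i _ => by
    rw [contractRight_tmul, ← hw i α]; rfl

end Contraction

/-! ### Parity of tensors -/

section TensorParity

variable {k : Type u} [Field k] {V W : Type u} [AddCommGroup V] [Module k V]
  [AddCommGroup W] [Module k W] (𝒱 : ZMod 2 → Submodule k V) (𝒲 : ZMod 2 → Submodule k W)
  [DirectSum.Decomposition 𝒱] [DirectSum.Decomposition 𝒲]

theorem map_parityProj_mem (i j : ZMod 2) (t : V ⊗[k] W) :
    TensorProduct.map (parityProj 𝒱 i) (parityProj 𝒲 j) t ∈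
      LinearMap.range (TensorProduct.map (𝒱 i).subtype (𝒲 j).subtype) := by
  refine ⟨TensorProduct.map ((parityProj 𝒱 i).codRestrict _ (parityProj_mem 𝒱 i))
    ((parityProj 𝒲 j).codRestrict _ (parityProj_mem 𝒲 j)) t, ?_⟩
  rw [← LinearMap.comp_apply, ← TensorProduct.map_comp]
  rfl

theorem map_parityInv (t : V ⊗[k] W) :
    t + TensorProduct.map (parityInv 𝒱) (parityInv 𝒲) t =
      (2 : k) • (TensorProduct.map (parityProj 𝒱 0) (parityProj 𝒲 0) t +
        TensorProduct.map (parityProj 𝒱 1) (parityProj 𝒲 1) t) ∧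
    t - TensorProduct.map (parityInv 𝒱) (parityInv 𝒲) t =
      (2 : k) • (TensorProduct.map (parityProj 𝒱 0) (parityProj 𝒲 1) t +
        TensorProduct.map (parityProj 𝒱 1) (parityProj 𝒲 0) t) := by
  induction t with
  | zero => simp
  | add x y hx hy =>
    constructor
    · simp only [map_add]
      rw [add_add_add_comm, hx.1, hy.1]; simp only [smul_add]; abel
    · simp only [map_add]
      rw [add_sub_add_comm, hx.2, hy.2]; simp only [smul_add]; abel
  | tmul v w =>
    simp only [TensorProduct.map_tmul, parityInv_apply]
    have hv := parityProj_add 𝒱 v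
    have hw := parityProj_add 𝒲 w
    set v0 := parityProj 𝒱 0 v
    set v1 := parityProj 𝒱 1 v
    set w0 := parityProj 𝒲 0 w
    set w1 := parityProj 𝒲 1 w
    rw [← hv, ← hw]
    simp only [TensorProduct.add_tmul, TensorProduct.tmul_add, TensorProduct.sub_tmul,
      TensorProduct.tmul_sub, two_smul]
    constructor <;> abel

theorem tensorFunctional_twist (α : W →ₗ[k] k) (β : V →ₗ[k] k) (t : V ⊗[k] W) :
    tensorFunctional α β (twist 𝒱 𝒲 t) = ∑ i : ZMod 2, ∑ j : ZMod 2, koszul k i j •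
      tensorFunctional (β ∘ₗ parityProj 𝒱 i) (α ∘ₗ parityProj 𝒲 j) t := by
  simp only [twist, LinearMap.sum_apply, map_sum, LinearMap.smul_apply, map_smul,
    LinearMap.comp_apply]
  refine Finset.sum_congr rfl fun i _ => Finset.sum_congr rfl fun j _ => congrArg _ ?_
  rw [← tensorFunctional_map]
  generalize TensorProduct.map (parityProj 𝒱 i) (parityProj 𝒲 j) t = t
  induction t with
  | zero => simp
  | add x y hx hy => simp only [map_add, hx, hy]
  | tmul a b => simp [mul_comm]

variable [NeZero (2 : k)]

theorem mem_tensorPart_zero_iff (t : V ⊗[k] W) :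
    t ∈ tensorPart 𝒱 𝒲 0 ↔ TensorProduct.map (parityInv 𝒱) (parityInv 𝒲) t = t := by
  constructor
  · intro h
    have hle : tensorPart 𝒱 𝒲 0 ≤
        LinearMap.ker (TensorProduct.map (parityInv 𝒱) (parityInv 𝒲) - LinearMap.id) := by
      refine iSup_le fun p => ?_
      rintro _ ⟨s, rfl⟩
      rw [LinearMap.mem_ker, LinearMap.sub_apply, sub_eq_zero, LinearMap.id_apply,
        ← LinearMap.comp_apply, ← TensorProduct.map_comp]
      obtain rfl | rfl := zmod_two_cases p
      · have e1 : parityInv 𝒱 ∘ₗ (𝒱 0).subtype = (𝒱 0).subtype :=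
          LinearMap.ext fun v => parityInv_of_mem_zero 𝒱 v.2
        have e2 : parityInv 𝒲 ∘ₗ (𝒲 (0 - 0)).subtype = (𝒲 (0 - 0)).subtype :=
          LinearMap.ext fun v => parityInv_of_mem_zero 𝒲 (by simp)
        rw [e1, e2]
      · have e1 : parityInv 𝒱 ∘ₗ (𝒱 1).subtype = -(𝒱 1).subtype :=
          LinearMap.ext fun v => parityInv_of_mem_one 𝒱 v.2
        have e2 : parityInv 𝒲 ∘ₗ (𝒲 (0 - 1)).subtype = -(𝒲 (0 - 1)).subtype :=
          LinearMap.ext fun v => parityInv_of_mem_one 𝒲 v.2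
        rw [e1, e2, ← neg_one_smul k (𝒱 1).subtype, ← neg_one_smul k (𝒲 (0 - 1)).subtype,
          TensorProduct.map_smul_left, TensorProduct.map_smul_right, smul_smul]
        simp
    have := hle h
    rwa [LinearMap.mem_ker, LinearMap.sub_apply, sub_eq_zero] at this
  · intro h
    have h2 := (map_parityInv 𝒱 𝒲 t).1
    rw [h, ← two_smul k t] at h2
    rw [smul_right_injective _ (NeZero.ne (2 : k)) h2]
    exact add_mem (Submodule.mem_iSup_of_mem 0 (map_parityProj_mem 𝒱 𝒲 0 0 t))
      (Submodule.mem_iSup_of_mem 1 (map_parityProj_mem 𝒱 𝒲 1 1 t))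

theorem mem_tensorPart_one_iff (t : V ⊗[k] W) :
    t ∈ tensorPart 𝒱 𝒲 1 ↔ TensorProduct.map (parityInv 𝒱) (parityInv 𝒲) t = -t := by
  constructor
  · intro h
    have hle : tensorPart 𝒱 𝒲 1 ≤
        LinearMap.ker (TensorProduct.map (parityInv 𝒱) (parityInv 𝒲) + LinearMap.id) := by
      refine iSup_le fun p => ?_
      rintro _ ⟨s, rfl⟩
      rw [LinearMap.mem_ker, LinearMap.add_apply, add_eq_zero_iff_eq_neg, LinearMap.id_apply,
        ← LinearMap.comp_apply, ← TensorProduct.map_comp]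
      obtain rfl | rfl := zmod_two_cases p
      · have e1 : parityInv 𝒱 ∘ₗ (𝒱 0).subtype = (𝒱 0).subtype :=
          LinearMap.ext fun v => parityInv_of_mem_zero 𝒱 v.2
        have e2 : parityInv 𝒲 ∘ₗ (𝒲 (1 - 0)).subtype = -(𝒲 (1 - 0)).subtype :=
          LinearMap.ext fun v => parityInv_of_mem_one 𝒲 (by simp)
        rw [e1, e2, ← neg_one_smul k (𝒲 (1 - 0)).subtype, TensorProduct.map_smul_right]
        simp
      · have e1 : parityInv 𝒱 ∘ₗ (𝒱 1).subtype = -(𝒱 1).subtype :=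
          LinearMap.ext fun v => parityInv_of_mem_one 𝒱 v.2
        have e2 : parityInv 𝒲 ∘ₗ (𝒲 (1 - 1)).subtype = (𝒲 (1 - 1)).subtype :=
          LinearMap.ext fun v => parityInv_of_mem_zero 𝒲 (by simp)
        rw [e1, e2, ← neg_one_smul k (𝒱 1).subtype, TensorProduct.map_smul_left]
        simp
    have := hle h
    rwa [LinearMap.mem_ker, LinearMap.add_apply, add_eq_zero_iff_eq_neg] at this
  · intro h
    have h2 := (map_parityInv 𝒱 𝒲 t).2
    rw [h, sub_neg_eq_add, ← two_smul k t] at h2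
    rw [smul_right_injective _ (NeZero.ne (2 : k)) h2]
    exact add_mem (Submodule.mem_iSup_of_mem 0 (by
        rw [show (1 : ZMod 2) - 0 = 1 from rfl]; exact map_parityProj_mem 𝒱 𝒲 0 1 t))
      (Submodule.mem_iSup_of_mem 1 (by
        rw [show (1 : ZMod 2) - 1 = 0 from rfl]; exact map_parityProj_mem 𝒱 𝒲 1 0 t))

end TensorParity

end
end SuperFormal

namespace SuperFormal

noncomputable section

variable {k : Type u} [Field k]

namespace SuperCoalg

variable (A : SuperCoalg k)

/-- The comultiplication of a super-coalgebra. -/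
def Δ : A.carrier →ₗ[k] A.carrier ⊗[k] A.carrier := Coalgebra.comul

/-- The counit of a super-coalgebra. -/
def ε : A.carrier →ₗ[k] k := Coalgebra.counit

/-- The parity involution of a super-coalgebra. -/
def inv : A.carrier →ₗ[k] A.carrier := parityInv A.part

/-- The convolution product of functionals. -/
def conv (α β : A.carrier →ₗ[k] k) : A.carrier →ₗ[k] k := tensorFunctional α β ∘ₗ A.Δ

theorem conv_apply (α β : A.carrier →ₗ[k] k) (a : A.carrier) :
    A.conv α β a = tensorFunctional α β (A.Δ a) := rfl

theorem inv_inv (a : A.carrier) : A.inv (A.inv a) = a := parityInv_parityInv _ a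

theorem Δ_inv [NeZero (2 : k)] (a : A.carrier) :
    A.Δ (A.inv a) = TensorProduct.map A.inv A.inv (A.Δ a) := by
  have h0 := (mem_tensorPart_zero_iff A.part A.part _).1
    (A.comul_mem 0 _ (parityProj_mem A.part 0 a))
  have h1 := (mem_tensorPart_one_iff A.part A.part _).1
    (A.comul_mem 1 _ (parityProj_mem A.part 1 a))
  conv_rhs => rw [← parityProj_add A.part a, map_add, map_add]
  change _ = TensorProduct.map (parityInv A.part) (parityInv A.part)
    (Coalgebra.comul (parityProj A.part 0 a)) + TensorProduct.map (parityInv A.part)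
    (parityInv A.part) (Coalgebra.comul (parityProj A.part 1 a))
  rw [h0, h1, inv, parityInv_apply, map_sub, sub_eq_add_neg]
  rfl

theorem contractRight_ε (a : A.carrier) : contractRight A.ε (A.Δ a) = a := by
  have h : TensorProduct.map LinearMap.id A.ε (A.Δ a) = a ⊗ₜ 1 :=
    Coalgebra.lTensor_counit_comul (R := k) a
  rw [contractRight, LinearMap.comp_apply, h]
  simp

theorem contractLeft_ε (a : A.carrier) : contractLeft A.ε (A.Δ a) = a := by
  have h : TensorProduct.map A.ε LinearMap.id (A.Δ a) = 1 ⊗ₜ a :=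
    Coalgebra.rTensor_counit_comul (R := k) a
  rw [contractLeft, LinearMap.comp_apply, h]
  simp

theorem coassoc (a : A.carrier) :
    TensorProduct.assoc k _ _ _ (TensorProduct.map A.Δ LinearMap.id (A.Δ a)) =
      TensorProduct.map LinearMap.id A.Δ (A.Δ a) :=
  Coalgebra.coassoc_apply (R := k) a

theorem conv_ε (α : A.carrier →ₗ[k] k) : A.conv α A.ε = α := LinearMap.ext fun a => by
  rw [conv_apply, ← apply_contractRight, contractRight_ε]

theorem conv_assoc (α β γ : A.carrier →ₗ[k] k) :
    A.conv (A.conv α β) γ = A.conv α (A.conv β γ) := LinearMap.ext fun a => by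
  have h := congrArg (tensorFunctional α (tensorFunctional β γ)) (A.coassoc a)
  have e1 : ∀ t : A.carrier ⊗[k] A.carrier,
      tensorFunctional α (tensorFunctional β γ) (TensorProduct.map LinearMap.id A.Δ t) =
      tensorFunctional α (A.conv β γ) t := fun t => tensorFunctional_map _ _ _ _ _
  rw [e1, tensorFunctional_assoc] at h
  rw [conv_apply, conv_apply, ← h, tensorFunctional_map]
  rfl

theorem contractLeft_conv (α β : A.carrier →ₗ[k] k) (a : A.carrier) :
    contractLeft (A.conv α β) (A.Δ a) = contractLeft β (A.Δ (contractLeft α (A.Δ a))) :=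
  eq_of_forall_dual fun γ => by
    rw [apply_contractLeft, apply_contractLeft, ← conv_apply, ← conv_apply, conv_assoc,
      conv_apply, ← apply_contractLeft]

theorem contractLeft_inv [NeZero (2 : k)] (α : A.carrier →ₗ[k] k) (a : A.carrier) :
    contractLeft α (A.Δ (A.inv a)) = A.inv (contractLeft (α ∘ₗ A.inv) (A.Δ a)) := by
  rw [Δ_inv, contractLeft_map]

theorem conv_swap (α β : A.carrier →ₗ[k] k) :
    A.conv α β = ∑ i : ZMod 2, ∑ j : ZMod 2, koszul k i j •
      A.conv (β ∘ₗ parityProj A.part i) (α ∘ₗ parityProj A.part j) := LinearMap.ext fun a => by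
  have h : twist A.part A.part (A.Δ a) = A.Δ a := A.super_cocomm a
  rw [conv_apply, ← h, tensorFunctional_twist]
  simp only [LinearMap.sum_apply, LinearMap.smul_apply, conv_apply]

theorem comp_parityProj_even {α : A.carrier →ₗ[k] k} (h : α ∘ₗ A.inv = α) [NeZero (2 : k)] :
    α ∘ₗ parityProj A.part 0 = α ∧ α ∘ₗ parityProj A.part 1 = 0 := by
  have h' : ∀ a, α (parityInv A.part a) = α a := fun a => LinearMap.congr_fun h a
  constructor <;> refine LinearMap.ext fun a => ?_
  · rw [LinearMap.comp_apply, parityProj_zero_eq, map_smul, map_add, h', ← two_smul k (α a),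
      smul_smul, inv_mul_cancel₀ (NeZero.ne _), one_smul]
  · rw [LinearMap.comp_apply, parityProj_one_eq, map_smul, map_sub, h', sub_self, smul_zero]; rfl

theorem comp_parityProj_odd {α : A.carrier →ₗ[k] k} (h : α ∘ₗ A.inv = -α) [NeZero (2 : k)] :
    α ∘ₗ parityProj A.part 0 = 0 ∧ α ∘ₗ parityProj A.part 1 = α := by
  have h' : ∀ a, α (parityInv A.part a) = - α a := fun a => LinearMap.congr_fun h a
  constructor <;> refine LinearMap.ext fun a => ?_
  · rw [LinearMap.comp_apply, parityProj_zero_eq, map_smul, map_add, h', add_neg_cancel,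
      smul_zero]; rfl
  · rw [LinearMap.comp_apply, parityProj_one_eq, map_smul, map_sub, h', sub_neg_eq_add,
      ← two_smul k (α a), smul_smul, inv_mul_cancel₀ (NeZero.ne _), one_smul]

theorem conv_zero_left (β : A.carrier →ₗ[k] k) : A.conv 0 β = 0 := LinearMap.ext fun a => by
  simp only [conv_apply, LinearMap.zero_apply, ← apply_contractRight]

theorem conv_zero_right (β : A.carrier →ₗ[k] k) : A.conv β 0 = 0 := LinearMap.ext fun a => by
  simp only [conv_apply, LinearMap.zero_apply, ← apply_contractLeft]

theorem sum_zmod_two {M : Type*} [AddCommMonoid M] (f : ZMod 2 → M) :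
    ∑ i : ZMod 2, f i = f 0 + f 1 := Fin.sum_univ_two f

theorem parityProj_sum_conv (α β : A.carrier →ₗ[k] k) :
    A.conv α (β ∘ₗ parityProj A.part 0) + A.conv α (β ∘ₗ parityProj A.part 1) = A.conv α β :=
  LinearMap.ext fun a => by
    simp only [LinearMap.add_apply, conv_apply, ← apply_contractLeft, LinearMap.comp_apply,
      ← map_add, parityProj_add]

/-- An even functional meets no sign in super-cocommutativity. -/
theorem conv_comm_of_even [NeZero (2 : k)] {α : A.carrier →ₗ[k] k} (h : α ∘ₗ A.inv = α)
    (β : A.carrier →ₗ[k] k) : A.conv α β = A.conv β α := by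
  rw [conv_swap A β α]
  simp only [sum_zmod_two, (A.comp_parityProj_even h).1, (A.comp_parityProj_even h).2,
    conv_zero_left, smul_zero, add_zero, koszul]
  simp [parityProj_sum_conv]

/-- The Koszul sign gives `α * α = -(α * α)` for the convolution product, and 2 is invertible. -/
theorem conv_self_of_odd [NeZero (2 : k)] {α : A.carrier →ₗ[k] k} (h : α ∘ₗ A.inv = -α) :
    A.conv α α = 0 := by
  have h1 := conv_swap A α α
  have hk : koszul k 1 1 = -1 := by simp [koszul]
  simp only [sum_zmod_two, (A.comp_parityProj_odd h).1, (A.comp_parityProj_odd h).2,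
    conv_zero_left, conv_zero_right, smul_zero, zero_add, hk] at h1
  replace h1 := h1.trans (neg_one_smul k (A.conv α α))
  have h2 : (2 : k) • A.conv α α = 0 := by
    rw [two_smul]; nth_rewrite 2 [h1]; exact add_neg_cancel (A.conv α α)
  exact (smul_eq_zero.1 h2).resolve_left (NeZero.ne _)

end SuperCoalg

/-! ### Group-like elements as homomorphisms from the dual algebra -/

section GroupLike

variable {R : SAlgf k} {A : SuperCoalg k}

theorem contractRight_tensorOver (α β : A.carrier →ₗ[k] k) (v w : R.carrier ⊗[k] A.carrier) :
    contractRight (tensorFunctional α β) (tensorOver R A (v ⊗ₜ w)) =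
      ∑ i : ZMod 2, ∑ j : ZMod 2, koszul k i j •
        (contractRight (α ∘ₗ parityProj A.part i) v *
          parityProj R.part j (contractRight β w)) := by
  induction v with
  | zero => simp
  | add x y hx hy =>
    simp only [map_add, TensorProduct.add_tmul, hx, hy, add_mul, smul_add, Finset.sum_add_distrib]
  | tmul r a =>
    induction w with
    | zero => simp
    | add x y hx hy =>
      simp only [map_add, TensorProduct.tmul_add, hx, hy, mul_add, smul_add,
        Finset.sum_add_distrib]
    | tmul s b =>
      rw [tensorOver_tmul]
      simp only [map_sum, map_smul, contractRight_tmul, tensorFunctional_tmul,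
        LinearMap.comp_apply, mul_smul, smul_mul_assoc, mul_smul_comm]
      exact Finset.sum_congr rfl fun i _ => Finset.sum_congr rfl fun j _ => by
        rw [smul_comm (β b)]

theorem contractRight_baseMap {S : SAlgf k} (φ : R ⟶ S) (α : A.carrier →ₗ[k] k)
    (v : R.carrier ⊗[k] A.carrier) :
    contractRight α (baseMap φ A v) = homAlg φ (contractRight α v) :=
  contractRight_map _ _ _ _

variable [NeZero (2 : k)]

theorem tensorPart_iff (v : R.carrier ⊗[k] A.carrier) : v ∈ tensorPart R.part A.part 0 ↔
    ∀ α : A.carrier →ₗ[k] k, R.inv (contractRight α v) = contractRight (α ∘ₗ A.inv) v := by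
  rw [mem_tensorPart_zero_iff]
  have key : ∀ α : A.carrier →ₗ[k] k,
      contractRight α (TensorProduct.map (parityInv R.part) (parityInv A.part) v) =
        R.inv (contractRight (α ∘ₗ A.inv) v) := fun α => contractRight_map _ _ _ _
  constructor
  · intro h α
    rw [← h, key, h, R.inv_inv]
  · intro h
    refine tensor_ext fun α => ?_
    rw [key, h]
    congr 2
    exact LinearMap.ext fun a => congrArg α (A.inv_inv a)

theorem contractRight_parityProj {v : R.carrier ⊗[k] A.carrier}
    (h : ∀ α : A.carrier →ₗ[k] k, R.inv (contractRight α v) = contractRight (α ∘ₗ A.inv) v)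
    (α : A.carrier →ₗ[k] k) (i : ZMod 2) :
    contractRight (α ∘ₗ parityProj A.part i) v = parityProj R.part i (contractRight α v) := by
  have e0 : α ∘ₗ parityProj A.part 0 = (2 : k)⁻¹ • (α + α ∘ₗ A.inv) :=
    LinearMap.ext fun a => by
      rw [LinearMap.comp_apply, parityProj_zero_eq, map_smul, map_add]; rfl
  have e1 : α ∘ₗ parityProj A.part 1 = (2 : k)⁻¹ • (α - α ∘ₗ A.inv) :=
    LinearMap.ext fun a => by
      rw [LinearMap.comp_apply, parityProj_one_eq, map_smul, map_sub]; rfl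
  obtain rfl | rfl := zmod_two_cases i
  · rw [e0, contractRight_smul, contractRight_add, ← h, parityProj_zero_eq]; rfl
  · rw [e1, contractRight_smul, contractRight_sub, ← h, parityProj_one_eq]; rfl

/-- For an even tensor the parity of the `A`-factor equals that of the `R`-factor, so the sign
`(-1)^{|a||s|}` equals `(-1)^{|r||s|}` and is absorbed by exchanging the factors in `R`. Hence the
reversed order of the product. -/
theorem contractRight_tensorOver_self {v : R.carrier ⊗[k] A.carrier}
    (h : ∀ α : A.carrier →ₗ[k] k, R.inv (contractRight α v) = contractRight (α ∘ₗ A.inv) v)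
    (α β : A.carrier →ₗ[k] k) :
    contractRight (tensorFunctional α β) (tensorOver R A (v ⊗ₜ v)) =
      contractRight β v * contractRight α v := by
  rw [contractRight_tensorOver]
  simp only [contractRight_parityProj h]
  have e : ∀ i j : ZMod 2, koszul k i j •
      (parityProj R.part i (contractRight α v) * parityProj R.part j (contractRight β v)) =
      parityProj R.part j (contractRight β v) * parityProj R.part i (contractRight α v) :=
    fun i j => R.koszul_smul_mul (parityProj_mem _ _ _) (parityProj_mem _ _ _)
  simp only [e, SuperCoalg.sum_zmod_two]
  rw [← add_mul, parityProj_add, ← add_mul, parityProj_add, ← mul_add, parityProj_add]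

/-- Functionals separate tensors, so being group-like can be read off from contractions. It says
that contraction is a parity-preserving unital antihomomorphism from the convolution algebra of `A`;
the reversed order is carried through consistently. -/
theorem isGroupLike_iff (v : R.carrier ⊗[k] A.carrier) : IsGroupLike R A v ↔
    (∀ α : A.carrier →ₗ[k] k, R.inv (contractRight α v) = contractRight (α ∘ₗ A.inv) v) ∧
    contractRight A.ε v = 1 ∧
    ∀ α β : A.carrier →ₗ[k] k,
      contractRight (A.conv α β) v = contractRight β v * contractRight α v := by
  have key : ∀ α β : A.carrier →ₗ[k] k,
      contractRight (tensorFunctional α β) (TensorProduct.map LinearMap.id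
        (Coalgebra.comul (R := k)) v) = contractRight (A.conv α β) v :=
    fun α β => contractRight_map _ _ _ _
  constructor
  · intro h
    have h0 := (tensorPart_iff v).1 h.even
    refine ⟨h0, h.counit, fun α β => ?_⟩
    rw [← key, h.comul, contractRight_tensorOver_self h0]
  · rintro ⟨h0, h1, h2⟩
    refine ⟨(tensorPart_iff v).2 h0, ?_, h1⟩
    refine tensor_ext_assoc fun α β => ?_
    rw [key, h2, contractRight_tensorOver_self h0]

theorem isGroupLike_of_injective {S : SAlgf k} (ι : R ⟶ S) (hι : Function.Injective (homAlg ι))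
    {v : R.carrier ⊗[k] A.carrier} (hv : IsGroupLike S A (baseMap ι A v)) : IsGroupLike R A v := by
  rw [isGroupLike_iff] at hv ⊢
  obtain ⟨h0, h1, h2⟩ := hv
  simp only [contractRight_baseMap] at h0 h1 h2
  refine ⟨fun α => hι ?_, hι ?_, fun α β => hι ?_⟩
  · rw [SAlgf.inv_hom, h0]
  · rw [h1, map_one]
  · rw [h2, map_mul]

/-- The homomorphism from the dual of `A` given by an element of `Sp* A`. -/
def dualHom (v : (spStar A).obj R) : (A.carrier →ₗ[k] k) →ₗ[k] R.carrier where
  toFun α := contractRight α v.1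
  map_add' α β := contractRight_add α β _
  map_smul' c α := contractRight_smul c α _

/-- The transpose of `dualHom`. -/
def dualMapTo (v : (spStar A).obj R) : (R.carrier →ₗ[k] k) →ₗ[k] A.carrier where
  toFun ρ := contractLeft ρ v.1
  map_add' ρ ρ' := contractLeft_add ρ ρ' _
  map_smul' c ρ := contractLeft_smul c ρ _

end GroupLike
end
end SuperFormal

namespace SuperFormal

noncomputable section

variable {k : Type u} [Field k]

/-! ### Group-like elements, their transposes and minimality -/

section DualMap

variable {R : SAlgf k} {A : SuperCoalg k} (v : (spStar A).obj R)

theorem apply_dualMapTo (α : A.carrier →ₗ[k] k) (ρ : R.carrier →ₗ[k] k) :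
    α (dualMapTo v ρ) = ρ (dualHom v α) :=
  (apply_contractLeft ρ α v.1).trans (apply_contractRight ρ α v.1).symm

theorem dualHom_map {S : SAlgf k} (φ : R ⟶ S) (α : A.carrier →ₗ[k] k) :
    dualHom ((spStar A).map φ v) α = homAlg φ (dualHom v α) :=
  contractRight_baseMap φ α v.1

theorem dualMapTo_map {S : SAlgf k} (φ : R ⟶ S) (ρ : S.carrier →ₗ[k] k) :
    dualMapTo ((spStar A).map φ v) ρ = dualMapTo v (ρ ∘ₗ (homAlg φ).toLinearMap) :=
  eq_of_forall_dual fun α => by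
    rw [apply_dualMapTo, dualHom_map, apply_dualMapTo]; rfl

theorem ext_dualHom {v w : (spStar A).obj R} (h : ∀ α, dualHom v α = dualHom w α) : v = w :=
  Subtype.ext (tensor_ext h)

theorem dualMapTo_injective (hv : Function.Surjective (dualHom v)) :
    Function.Injective (dualMapTo v) := by
  refine (injective_iff_map_eq_zero (dualMapTo v)).2 fun ρ hρ => LinearMap.ext fun r => ?_
  obtain ⟨α, rfl⟩ := hv r
  rw [← apply_dualMapTo, hρ, map_zero]; rfl

theorem mem_spStarSub_iff (B : Submodule k A.carrier) : v ∈ (spStarSub A B).obj R ↔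
    ∀ α : A.carrier →ₗ[k] k, (∀ b ∈ B, α b = 0) → dualHom v α = 0 :=
  mem_range_map_id_iff

variable [NeZero (2 : k)]

theorem dualHom_inv (α : A.carrier →ₗ[k] k) :
    R.inv (dualHom v α) = dualHom v (α ∘ₗ A.inv) := ((isGroupLike_iff v.1).1 v.2).1 α

theorem dualHom_ε : dualHom v A.ε = 1 := ((isGroupLike_iff v.1).1 v.2).2.1

theorem dualHom_conv (α β : A.carrier →ₗ[k] k) :
    dualHom v (A.conv α β) = dualHom v β * dualHom v α := ((isGroupLike_iff v.1).1 v.2).2.2 α β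

theorem inv_dualMapTo (ρ : R.carrier →ₗ[k] k) :
    A.inv (dualMapTo v ρ) = dualMapTo v (ρ ∘ₗ R.inv.toLinearMap) :=
  eq_of_forall_dual fun α => by
    change (α ∘ₗ A.inv) (dualMapTo v ρ) = _
    rw [apply_dualMapTo, apply_dualMapTo, ← dualHom_inv]; rfl

theorem contractRight_Δ_dualMapTo (β : A.carrier →ₗ[k] k) (ρ : R.carrier →ₗ[k] k) :
    contractRight β (A.Δ (dualMapTo v ρ)) =
      dualMapTo v (ρ ∘ₗ LinearMap.mulLeft k (dualHom v β)) :=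
  eq_of_forall_dual fun α => by
    rw [apply_contractRight, ← SuperCoalg.conv_apply, apply_dualMapTo, apply_dualMapTo,
      dualHom_conv]
    rfl

theorem contractLeft_Δ_dualMapTo (α : A.carrier →ₗ[k] k) (ρ : R.carrier →ₗ[k] k) :
    contractLeft α (A.Δ (dualMapTo v ρ)) =
      dualMapTo v (ρ ∘ₗ LinearMap.mulRight k (dualHom v α)) :=
  eq_of_forall_dual fun β => by
    rw [apply_contractLeft, ← SuperCoalg.conv_apply, apply_dualMapTo, apply_dualMapTo,
      dualHom_conv]
    rfl

/-- The subalgebra over which an element of `Sp* A` is defined. -/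
def dualHomRange : Subalgebra k R.carrier :=
  { LinearMap.range (dualHom v) with
    mul_mem' := by
      rintro _ _ ⟨α, rfl⟩ ⟨β, rfl⟩
      exact ⟨A.conv β α, dualHom_conv v β α⟩
    one_mem' := ⟨A.ε, dualHom_ε v⟩
    algebraMap_mem' := fun c => ⟨c • A.ε, by
      rw [map_smul, dualHom_ε, Algebra.algebraMap_eq_smul_one]⟩ }

/-- The image of the dual algebra is a sub-superalgebra over which `v` is already defined, so
minimality forces it to be all of `R`. Thus `R` is a quotient of the dual algebra and its dual
embeds in `A`. -/
theorem dualHom_surjective (hv : IsMinimal (spStar A) v) : Function.Surjective (dualHom v) := by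
  obtain ⟨S, ι, hι, hr⟩ := R.exists_sub (dualHomRange v) (by
    rintro _ ⟨α, rfl⟩
    exact ⟨α ∘ₗ A.inv, (dualHom_inv v α).symm⟩)
  have hmem : v.1 ∈ LinearMap.range
      (TensorProduct.map (homAlg ι).toLinearMap (LinearMap.id : A.carrier →ₗ[k] A.carrier)) := by
    have h1 : v.1 ∈ LinearMap.range (TensorProduct.map
        (LinearMap.range (dualHom v)).subtype (LinearMap.id : A.carrier →ₗ[k] A.carrier)) := by
      refine mem_range_map_left fun ρ hρ => eq_of_forall_dual fun (α : A.carrier →ₗ[k] k) => ?_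
      rw [map_zero]
      exact (apply_dualMapTo v α ρ).trans (hρ _ ⟨α, rfl⟩)
    obtain ⟨t, ht⟩ := h1
    have h2 : ∀ r : LinearMap.range (dualHom v), ∃ s, homAlg ι s = r := fun r => (hr r).2 r.2
    obtain ⟨g, hg⟩ := (homAlg ι).toLinearMap.exists_leftInverse_of_injective
      (LinearMap.ker_eq_bot.2 hι)
    refine ⟨TensorProduct.map (g ∘ₗ (LinearMap.range (dualHom v)).subtype) LinearMap.id t, ?_⟩
    rw [← LinearMap.comp_apply, ← TensorProduct.map_comp, ← ht]
    congr 2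
    refine LinearMap.ext fun r => ?_
    obtain ⟨s, hs⟩ := h2 r
    change homAlg ι (g r) = r
    rw [← hs]
    exact congrArg _ (LinearMap.congr_fun hg s)
  obtain ⟨b, hb⟩ := hmem
  have hb' : baseMap ι A b = v.1 := hb
  have hs := hv S ι ⟨b, isGroupLike_of_injective ι hι (hb' ▸ v.2)⟩ (Subtype.ext hb)
  intro r
  exact (hr r).1 (hs r)

end DualMap

/-! ### Sub-super-coalgebras and ideals -/

namespace SuperCoalg

variable {A : SuperCoalg k}

theorem IsSub.contractRight_mem {C : Submodule k A.carrier} (hC : A.IsSub C) {c : A.carrier}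
    (hc : c ∈ C) (β : A.carrier →ₗ[k] k) : contractRight β (A.Δ c) ∈ C :=
  SuperFormal.contractRight_mem (hC.comul_mem c hc) β

theorem IsSub.inv_mem {C : Submodule k A.carrier} (hC : A.IsSub C) {c : A.carrier}
    (hc : c ∈ C) : A.inv c ∈ C :=
  C.sub_mem (hC.graded c hc 0) (hC.graded c hc 1)

end SuperCoalg

section SubIdeal

variable {R : SAlgf k} {A : SuperCoalg k} (v : (spStar A).obj R)

/-- The image in `A` of the functionals on `R` that vanish on an ideal. -/
def idealSub (J : Ideal R.carrier) : Submodule k A.carrier :=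
  (J.restrictScalars k).dualAnnihilator.map (dualMapTo v)

theorem mem_idealSub {J : Ideal R.carrier} {a : A.carrier} : a ∈ idealSub v J ↔
    ∃ ρ : R.carrier →ₗ[k] k, (∀ r ∈ J, ρ r = 0) ∧ dualMapTo v ρ = a := by
  simp only [idealSub, Submodule.mem_map, Submodule.mem_dualAnnihilator]
  rfl

theorem dualHom_mem_of_forall {J : Ideal R.carrier} {α : A.carrier →ₗ[k] k}
    (h : ∀ a ∈ idealSub v J, α a = 0) : dualHom v α ∈ J := by
  have : dualHom v α ∈ ((J.restrictScalars k).dualAnnihilator).dualCoannihilator := by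
    rw [Submodule.mem_dualCoannihilator]
    intro ρ hρ
    rw [← apply_dualMapTo]
    exact h _ ⟨ρ, hρ, rfl⟩
  rwa [Subspace.dualAnnihilator_dualCoannihilator_eq] at this

theorem apply_eq_zero_of_dualHom_mem {J : Ideal R.carrier} {α : A.carrier →ₗ[k] k}
    (h : dualHom v α ∈ J) {a : A.carrier} (ha : a ∈ idealSub v J) : α a = 0 := by
  obtain ⟨ρ, hρ, rfl⟩ := (mem_idealSub v).1 ha
  rw [apply_dualMapTo, hρ _ h]

theorem idealSub_anti {I J : Ideal R.carrier} (h : I ≤ J) : idealSub v J ≤ idealSub v I := by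
  intro a ha
  obtain ⟨ρ, hρ, rfl⟩ := (mem_idealSub v).1 ha
  exact (mem_idealSub v).2 ⟨ρ, fun r hr => hρ r (h hr), rfl⟩

variable [NeZero (2 : k)]

/-- The functionals vanishing on a two-sided parity-stable ideal form the dual of the quotient
algebra, and contracting the comultiplication corresponds to multiplying in `R`. -/
theorem isSub_idealSub {J : Ideal R.carrier} (hJ : ∀ r ∈ J, R.inv r ∈ J) :
    A.IsSub (idealSub v J) where
  graded a ha i := by
    refine parityProj_mem_of_parityInv A.part (fun b hb => ?_) ha i
    obtain ⟨ρ, hρ, rfl⟩ := (mem_idealSub v).1 hb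
    refine (mem_idealSub v).2 ⟨ρ ∘ₗ R.inv.toLinearMap, fun r hr => hρ _ (hJ r hr), ?_⟩
    exact (inv_dualMapTo v ρ).symm
  comul_mem a ha := by
    have := R.isTwoSided hJ
    obtain ⟨ρ, hρ, rfl⟩ := (mem_idealSub v).1 ha
    refine mem_range_map_map (fun α hα => ?_) (fun α hα => ?_)
    · refine (contractRight_Δ_dualMapTo v α ρ).trans ?_
      have : ρ ∘ₗ LinearMap.mulLeft k (dualHom v α) = 0 := LinearMap.ext fun r =>
        hρ _ (J.mul_mem_right r (dualHom_mem_of_forall v hα))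
      rw [this, map_zero]
    · refine (contractLeft_Δ_dualMapTo v α ρ).trans ?_
      have : ρ ∘ₗ LinearMap.mulRight k (dualHom v α) = 0 := LinearMap.ext fun r =>
        hρ _ (J.mul_mem_left r (dualHom_mem_of_forall v hα))
      rw [this, map_zero]

/-- The ideal of `R` corresponding to a sub-super-coalgebra. -/
def annIdeal (hv : Function.Surjective (dualHom v)) {C : Submodule k A.carrier}
    (hC : A.IsSub C) : Ideal R.carrier where
  carrier := {r | ∀ ρ : R.carrier →ₗ[k] k, dualMapTo v ρ ∈ C → ρ r = 0}
  add_mem' ha hb ρ hρ := by rw [map_add, ha ρ hρ, hb ρ hρ, add_zero]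
  zero_mem' ρ _ := map_zero ρ
  smul_mem' s r hr ρ hρ := by
    obtain ⟨β, rfl⟩ := hv s
    have := hC.contractRight_mem hρ β
    rw [contractRight_Δ_dualMapTo] at this
    exact hr _ this

theorem inv_mem_annIdeal (hv : Function.Surjective (dualHom v))
    {C : Submodule k A.carrier} (hC : A.IsSub C) (r : R.carrier)
    (hr : r ∈ annIdeal v hv hC) : R.inv r ∈ annIdeal v hv hC := fun ρ hρ => by
  have := hC.inv_mem hρ
  rw [inv_dualMapTo] at this
  exact hr _ this

theorem idealSub_annIdeal_le (hv : Function.Surjective (dualHom v))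
    {C : Submodule k A.carrier} (hC : A.IsSub C) :
    idealSub v (annIdeal v hv hC) ≤ C := by
  rintro _ ⟨ρ, hρ, rfl⟩
  have e : (annIdeal v hv hC).restrictScalars k = (C.comap (dualMapTo v)).dualCoannihilator := by
    ext r
    rw [Submodule.mem_dualCoannihilator]
    rfl
  rw [e] at hρ
  have h2 := Subspace.dualCoannihilator_dualAnnihilator_eq (W := C.comap (dualMapTo v))
  have h3 : ρ ∈ C.comap (dualMapTo v) := h2 ▸ hρ
  exact h3

/-- A sub-super-coalgebra meeting the dual of `R` in a nonzero element has a proper annihilator in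
`R`, hence contained in the unique prime `p`. Dualizing, it contains the dual of `R / p`. -/
theorem idealSub_le_of_isSub (hv : Function.Surjective (dualHom v))
    (hR : ∀ p q : Spec R, p = q) (p : Spec R)
    {C : Submodule k A.carrier} (hC : A.IsSub C) (ρ : R.carrier →ₗ[k] k)
    (h1 : dualMapTo v ρ ∈ C) (h0 : dualMapTo v ρ ≠ 0) : idealSub v p.1 ≤ C := by
  refine le_trans ?_ (idealSub_annIdeal_le v hv hC)
  obtain ⟨q, hq⟩ := Spec.exists_le (J := annIdeal v hv hC)
    (fun r hr i => R.proj_mem (inv_mem_annIdeal v hv hC) hr i) (by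
      rintro htop
      refine h0 ?_
      have : ρ = 0 := LinearMap.ext fun r =>
        (show r ∈ annIdeal v hv hC from htop ▸ Submodule.mem_top) ρ h1
      rw [this, map_zero])
  exact idealSub_anti v (hR q p ▸ hq)

theorem isSimpleSub_idealSub (hv : Function.Surjective (dualHom v))
    (hR : ∀ p q : Spec R, p = q) (p : Spec R) :
    A.IsSimpleSub (idealSub v p.1) where
  isSub := isSub_idealSub v p.inv_mem
  ne_bot h := by
    refine p.2.2.ne_top ((Ideal.eq_top_iff_one _).2 ?_)
    rw [← dualHom_ε v]
    refine dualHom_mem_of_forall v fun a ha => ?_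
    rw [h, Submodule.mem_bot] at ha
    rw [ha, map_zero]
  eq_bot_or_eq C hC hle := by
    by_cases hb : C = ⊥
    · exact Or.inl hb
    · obtain ⟨c, hc, hc0⟩ := Submodule.exists_mem_ne_zero_of_ne_bot hb
      obtain ⟨ρ, -, rfl⟩ := (mem_idealSub v).1 (hle hc)
      exact Or.inr (le_antisymm hle (idealSub_le_of_isSub v hv hR p hC ρ hc hc0))

end SubIdeal

/-! ### Elements of a super-coalgebra come from finite-dimensional superalgebras -/

theorem eq_top_of_forall_eq_zero {V : Type u} [AddCommGroup V] [Module k V]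
    [Module.Finite k V] {Q : Submodule k (V →ₗ[k] k)}
    (h : ∀ v : V, (∀ ρ ∈ Q, ρ v = 0) → v = 0) : Q = ⊤ := by
  have hQ : Submodule.dualCoannihilator Q = ⊥ := by
    refine (Submodule.eq_bot_iff _).2 fun v hv => h v ?_
    rwa [Submodule.mem_dualCoannihilator] at hv
  have h2 := Subspace.dualCoannihilator_dualAnnihilator_eq (W := Q)
  rw [hQ, Submodule.dualAnnihilator_bot] at h2
  exact h2.symm

namespace SuperCoalg

variable [NeZero (2 : k)] (A : SuperCoalg k)

/-- The operator `c ↦ α(c₁) c₂`. -/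
def leftOp (α : A.carrier →ₗ[k] k) : A.carrier →ₗ[k] A.carrier := contractLeft α ∘ₗ A.Δ

/-- The space of all `α(d₁) d₂` is finite-dimensional because the comultiplication of `d` is a
finite sum, is stable by coassociativity, and contains `d` by the counit. Adding its image under the
involution makes it graded. -/
theorem exists_stable (d : A.carrier) : ∃ C : Submodule k A.carrier, Module.Finite k C ∧ d ∈ C ∧
    (∀ c ∈ C, A.inv c ∈ C) ∧ ∀ α, ∀ c ∈ C, A.leftOp α c ∈ C := by
  have hfin : ∀ t : A.carrier ⊗[k] A.carrier, ∃ F : Submodule k A.carrier, Module.Finite k F ∧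
      ∀ α : A.carrier →ₗ[k] k, contractLeft α t ∈ F := by
    intro t
    induction t with
    | zero => exact ⟨⊥, inferInstance, fun α => by rw [map_zero]; exact zero_mem _⟩
    | add x y hx hy =>
      obtain ⟨F, hF, h1⟩ := hx
      obtain ⟨G, hG, h2⟩ := hy
      refine ⟨F ⊔ G, inferInstance, fun α => ?_⟩
      rw [map_add]
      exact add_mem (Submodule.mem_sup_left (h1 α)) (Submodule.mem_sup_right (h2 α))
    | tmul a b =>
      refine ⟨k ∙ b, inferInstance, fun α => ?_⟩
      rw [contractLeft_tmul]
      exact Submodule.smul_mem _ _ (Submodule.mem_span_singleton_self b)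
  obtain ⟨F, hF, h⟩ := hfin (A.Δ d)
  let op : (A.carrier →ₗ[k] k) →ₗ[k] A.carrier :=
    { toFun α := contractLeft α (A.Δ d)
      map_add' α β := contractLeft_add α β _
      map_smul' c α := contractLeft_smul c α _ }
  let C₀ := LinearMap.range op
  have hC₀ : C₀ ≤ F := by rintro _ ⟨α, rfl⟩; exact h α
  have hst : ∀ α, ∀ c ∈ C₀, A.leftOp α c ∈ C₀ := by
    rintro α _ ⟨β, rfl⟩
    exact ⟨A.conv β α, A.contractLeft_conv β α d⟩
  have : Module.Finite k C₀ := Submodule.finiteDimensional_of_le hC₀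
  refine ⟨C₀ ⊔ C₀.map A.inv, inferInstance,
    Submodule.mem_sup_left ⟨A.ε, A.contractLeft_ε d⟩, ?_, ?_⟩
  · intro c hc
    obtain ⟨x, hx, _, ⟨y, hy, rfl⟩, rfl⟩ := Submodule.mem_sup.1 hc
    rw [map_add, inv_inv]
    exact add_mem (Submodule.mem_sup_right ⟨x, hx, rfl⟩) (Submodule.mem_sup_left hy)
  · intro α c hc
    obtain ⟨x, hx, _, ⟨y, hy, rfl⟩, rfl⟩ := Submodule.mem_sup.1 hc
    rw [map_add]
    refine add_mem (Submodule.mem_sup_left (hst α x hx)) (Submodule.mem_sup_right ?_)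
    exact ⟨_, hst (α ∘ₗ A.inv) y hy, (A.contractLeft_inv α y).symm⟩

/-- This is the local finiteness of coalgebras. The dual algebra acts on a finite-dimensional stable
subspace `C` containing `d`; its image in the endomorphisms of `C` is a finite-dimensional
superalgebra, supercommutative by super-cocommutativity, and carries a group-like element. -/
theorem exists_dualMapTo_eq (d : A.carrier) :
    ∃ (R : SAlgf k) (v : (spStar A).obj R) (ρ : R.carrier →ₗ[k] k), dualMapTo v ρ = d := by
  obtain ⟨C, hC, hd, hinv, hst⟩ := A.exists_stable d
  let L : (A.carrier →ₗ[k] k) →ₗ[k] Module.End k C :=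
    { toFun α := (A.leftOp α).restrict (hst α)
      map_add' α β := LinearMap.ext fun c => Subtype.ext (contractLeft_add α β _)
      map_smul' x α := LinearMap.ext fun c => Subtype.ext (contractLeft_smul x α _) }
  have hL : ∀ α (c : C), (L α c : A.carrier) = contractLeft α (A.Δ c) := fun α c => rfl
  have Lconv : ∀ α β, L (A.conv α β) = L β * L α := fun α β => LinearMap.ext fun c =>
    Subtype.ext (A.contractLeft_conv α β c)
  have Lε : L A.ε = 1 := LinearMap.ext fun c => Subtype.ext (A.contractLeft_ε c)
  let S : Subalgebra k (Module.End k C) :=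
    { LinearMap.range L with
      mul_mem' := by
        rintro _ _ ⟨α, rfl⟩ ⟨β, rfl⟩
        exact ⟨A.conv β α, Lconv β α⟩
      one_mem' := ⟨A.ε, Lε⟩
      algebraMap_mem' := fun c => ⟨c • A.ε, by
        rw [map_smul, Lε, Algebra.algebraMap_eq_smul_one]⟩ }
  let τ : C →ₗ[k] C := A.inv.restrict hinv
  have hτ : τ ∘ₗ τ = LinearMap.id := LinearMap.ext fun c => Subtype.ext (A.inv_inv c)
  have Linv : ∀ α, τ ∘ₗ L α ∘ₗ τ = L (α ∘ₗ A.inv) := fun α => LinearMap.ext fun c =>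
    Subtype.ext (by
      change A.inv (contractLeft α (A.Δ (A.inv c))) = _
      rw [A.contractLeft_inv, A.inv_inv]; rfl)
  have hSinv : ∀ T ∈ S, τ ∘ₗ T ∘ₗ τ ∈ S := by
    rintro _ ⟨α, rfl⟩
    exact ⟨α ∘ₗ A.inv, (Linv α).symm⟩
  let σ : S →ₐ[k] S :=
    AlgHom.ofLinearMap
      { toFun T := ⟨τ ∘ₗ T.1 ∘ₗ τ, hSinv _ T.2⟩
        map_add' T T' := Subtype.ext (by
          change τ ∘ₗ (T.1 + T'.1) ∘ₗ τ = _
          rw [LinearMap.add_comp, LinearMap.comp_add]; rfl)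
        map_smul' x T := Subtype.ext (by
          change τ ∘ₗ (x • T.1) ∘ₗ τ = _
          rw [LinearMap.smul_comp, LinearMap.comp_smul]; rfl) }
      (Subtype.ext hτ)
      (fun T T' => Subtype.ext (by
        change τ ∘ₗ (T.1 ∘ₗ T'.1) ∘ₗ τ = (τ ∘ₗ T.1 ∘ₗ τ) ∘ₗ (τ ∘ₗ T'.1 ∘ₗ τ)
        have : (τ ∘ₗ T.1 ∘ₗ τ) ∘ₗ (τ ∘ₗ T'.1 ∘ₗ τ) = τ ∘ₗ T.1 ∘ₗ (τ ∘ₗ τ) ∘ₗ T'.1 ∘ₗ τ := rfl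
        rw [this, hτ]; rfl))
  let ℓ : (A.carrier →ₗ[k] k) →ₗ[k] S := L.codRestrict (Subalgebra.toSubmodule S)
    (fun α => ⟨α, rfl⟩)
  have hℓ : Function.Surjective ℓ := by
    rintro ⟨_, α, rfl⟩; exact ⟨α, rfl⟩
  have ℓconv : ∀ α β, ℓ (A.conv α β) = ℓ β * ℓ α := fun α β => Subtype.ext (Lconv α β)
  have ℓinv : ∀ α, σ (ℓ α) = ℓ (α ∘ₗ A.inv) := fun α => Subtype.ext (Linv α)
  have heven : ∀ T : S, σ T = T → ∃ α, α ∘ₗ A.inv = α ∧ ℓ α = T := fun T hT => by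
    obtain ⟨α, rfl⟩ := hℓ T
    refine ⟨(2 : k)⁻¹ • (α + α ∘ₗ A.inv), ?_, ?_⟩
    · refine LinearMap.ext fun a => ?_
      simp [A.inv_inv, add_comm]
    · rw [map_smul, map_add, ← ℓinv, hT, ← two_smul k (ℓ α), smul_smul,
        inv_mul_cancel₀ (NeZero.ne _), one_smul]
  have hodd : ∀ T : S, σ T = -T → ∃ α, α ∘ₗ A.inv = -α ∧ ℓ α = T := fun T hT => by
    obtain ⟨α, rfl⟩ := hℓ T
    refine ⟨(2 : k)⁻¹ • (α - α ∘ₗ A.inv), ?_, ?_⟩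
    · refine LinearMap.ext fun a => ?_
      simp [A.inv_inv]
      ring
    · have h2 : ℓ α - -ℓ α = (2 : k) • ℓ α := by rw [two_smul]; exact sub_neg_eq_add (ℓ α) (ℓ α)
      rw [map_smul, map_sub, ← ℓinv, hT, h2, smul_smul, inv_mul_cancel₀ (NeZero.ne _), one_smul]
  have hσσ : ∀ T, σ (σ T) = T := fun T => by
    obtain ⟨α, rfl⟩ := hℓ T
    rw [ℓinv, ℓinv]
    congr 1
    exact LinearMap.ext fun a => congrArg α (A.inv_inv a)
  let R := SAlgf.ofInv S σ hσσ
    (fun T T' hT => by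
      obtain ⟨α, hα, rfl⟩ := heven T hT
      obtain ⟨β, rfl⟩ := hℓ T'
      rw [← ℓconv, ← ℓconv, A.conv_comm_of_even hα])
    (fun T hT => by
      obtain ⟨α, hα, rfl⟩ := hodd T hT
      rw [← ℓconv, A.conv_self_of_odd hα, map_zero])
  -- To turn `ℓ` into a tensor, each functional on `S` must be evaluation at an element of `A`. This
  -- holds for the matrix coefficients `T ↦ γ(T c)`, and these span the dual of `S` since they
  -- separate its elements.
  have hrep : ∀ ρ : S →ₗ[k] k, ∃ a : A.carrier, ∀ α, ρ (ℓ α) = α a := by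
    let Q : Submodule k (S →ₗ[k] k) :=
      { carrier := {ρ | ∃ a : A.carrier, ∀ α, ρ (ℓ α) = α a}
        add_mem' := by
          rintro ρ ρ' ⟨a, ha⟩ ⟨b, hb⟩
          exact ⟨a + b, fun α => by rw [LinearMap.add_apply, ha, hb, map_add]⟩
        zero_mem' := ⟨0, fun α => by rw [map_zero]; rfl⟩
        smul_mem' := by
          rintro x ρ ⟨a, ha⟩
          exact ⟨x • a, fun α => by rw [LinearMap.smul_apply, ha, map_smul]⟩ }
    have hQ' : Q = ⊤ := by
      refine eq_top_of_forall_eq_zero (V := S) fun T hT => ?_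
      refine Subtype.ext (LinearMap.ext fun c => Subtype.ext (eq_of_forall_dual
        fun (γ : A.carrier →ₗ[k] k) => ?_))
      refine (hT (γ ∘ₗ C.subtype ∘ₗ LinearMap.applyₗ c ∘ₗ (Subalgebra.toSubmodule S).subtype)
        ⟨contractRight γ (A.Δ c), fun α => ?_⟩).trans (map_zero γ).symm
      change γ (contractLeft α (A.Δ c)) = _
      rw [apply_contractLeft, apply_contractRight]
    intro ρ
    have : ρ ∈ Q := hQ' ▸ Submodule.mem_top
    exact this
  obtain ⟨v, hv⟩ := exists_contractRight_eq (V := S) ℓ hrep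
  have hvg : IsGroupLike R A v := by
    refine (isGroupLike_iff (R := R) v).2 ⟨fun α => ?_, ?_, fun α β => ?_⟩
    · have e := SAlgf.inv_ofInv S σ hσσ (fun T T' hT => by
          obtain ⟨α, hα, rfl⟩ := heven T hT
          obtain ⟨β, rfl⟩ := hℓ T'
          rw [← ℓconv, ← ℓconv, A.conv_comm_of_even hα])
        (fun T hT => by
          obtain ⟨α, hα, rfl⟩ := hodd T hT
          rw [← ℓconv, A.conv_self_of_odd hα, map_zero]) (ℓ α)
      have e1 : R.inv (ℓ α) = ℓ (α ∘ₗ A.inv) := e.trans (ℓinv α)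
      rw [← hv, ← hv] at e1
      exact e1
    · exact (hv A.ε).trans (Subtype.ext Lε)
    · exact (hv _).trans ((ℓconv α β).trans (by rw [← hv, ← hv]; rfl))
  -- The functional `T ↦ ε(T d)` represents `d`, because `ε` is the unit for convolution.
  refine ⟨R, ⟨v, hvg⟩, A.ε ∘ₗ C.subtype ∘ₗ LinearMap.applyₗ ⟨d, hd⟩ ∘ₗ
    (Subalgebra.toSubmodule S).subtype, ?_⟩
  refine eq_of_forall_dual fun (α : A.carrier →ₗ[k] k) => ?_
  refine (apply_dualMapTo (R := R) ⟨v, hvg⟩ α _).trans ?_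
  have e2 : dualHom (R := R) ⟨v, hvg⟩ α = ℓ α := hv α
  refine (congrArg _ e2).trans ?_
  change A.ε (contractLeft α (A.Δ d)) = α d
  rw [apply_contractLeft, ← conv_apply, conv_ε]

end SuperCoalg

end
end SuperFormal

namespace SuperFormal

noncomputable section

variable {k : Type u} [Field k]

/-! ### The super-coalgebra of a formal superscheme -/

section DualComul

variable (V : Type u) [Ring V] [Algebra k V] [Module.Finite k V]

/-- The comultiplication of the dual of a finite-dimensional algebra, with factors reversed. -/
def dualComul : (V →ₗ[k] k) →ₗ[k] (V →ₗ[k] k) ⊗[k] (V →ₗ[k] k) :=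
  (TensorProduct.dualDistribEquiv k V V).symm.toLinearMap ∘ₗ
    (LinearMap.mul' k V ∘ₗ (TensorProduct.comm k V V).toLinearMap).dualMap

variable {V}

theorem tensorFunctional_dualComul {α β : (V →ₗ[k] k) →ₗ[k] k} {a b : V} (hα : ∀ ρ, α ρ = ρ a)
    (hβ : ∀ ρ, β ρ = ρ b) (ρ : V →ₗ[k] k) :
    tensorFunctional α β (dualComul V ρ) = ρ (b * a) := by
  have key : ∀ t : (V →ₗ[k] k) ⊗[k] (V →ₗ[k] k),
      tensorFunctional α β t = TensorProduct.dualDistribEquiv k V V t (a ⊗ₜ b) := fun t => by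
    induction t with
    | zero => simp
    | add x y hx hy => simp only [map_add, LinearMap.add_apply, hx, hy]
    | tmul x y =>
      rw [tensorFunctional_tmul, hα, hβ]
      rfl
  rw [key, dualComul, LinearMap.comp_apply]
  erw [LinearEquiv.apply_symm_apply]
  simp

end DualComul

namespace Pres

variable {Z : FormalFunctor k} (P : Pres Z)

open Classical in
/-- The direct limit of the duals of the algebras of a presentation. -/
def DualLimit : Type u :=
  Module.DirectLimit (R := k) (fun l => (P.alg l).carrier →ₗ[k] k)
    (fun _ _ h => (homAlg (P.tr h)).toLinearMap.dualMap)

open Classical in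
instance : AddCommGroup P.DualLimit :=
  inferInstanceAs (AddCommGroup (Module.DirectLimit (R := k)
    (fun l => (P.alg l).carrier →ₗ[k] k) (fun _ _ h => (homAlg (P.tr h)).toLinearMap.dualMap)))

open Classical in
instance : Module k P.DualLimit :=
  inferInstanceAs (Module k (Module.DirectLimit (R := k)
    (fun l => (P.alg l).carrier →ₗ[k] k) (fun _ _ h => (homAlg (P.tr h)).toLinearMap.dualMap)))

open Classical in
/-- The canonical maps to the direct limit. -/
def ofDual (l : P.Λ) : ((P.alg l).carrier →ₗ[k] k) →ₗ[k] P.DualLimit :=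
  Module.DirectLimit.of k P.Λ (fun l => (P.alg l).carrier →ₗ[k] k)
    (fun _ _ h => (homAlg (P.tr h)).toLinearMap.dualMap) l

open Classical in
theorem ofDual_tr {l m : P.Λ} (h : l ≤ m) (ρ : (P.alg l).carrier →ₗ[k] k) :
    P.ofDual m (ρ ∘ₗ (homAlg (P.tr h)).toLinearMap) = P.ofDual l ρ :=
  Module.DirectLimit.of_f (hij := h)

open Classical in
theorem exists_ofDual (x : P.DualLimit) : ∃ l ρ, P.ofDual l ρ = x :=
  Module.DirectLimit.exists_of x

theorem ofDual_injective (l : P.Λ) : Function.Injective (P.ofDual l) := by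
  classical
  have : DirectedSystem (fun l => (P.alg l).carrier →ₗ[k] k)
      (fun _ _ h => (homAlg (P.tr h)).toLinearMap.dualMap) :=
    ⟨fun l ρ => LinearMap.ext fun a => by
      rw [P.tr_self]; rfl, fun l m n h h' ρ => LinearMap.ext fun a => by
      rw [← P.tr_comp h h']; rfl⟩
  intro ρ ρ' h
  obtain ⟨m, hm, e⟩ := Module.DirectLimit.exists_eq_of_of_eq (R := k) h
  refine LinearMap.ext fun a => ?_
  obtain ⟨b, rfl⟩ := P.tr_surj hm a
  exact LinearMap.congr_fun e b

open Classical in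
/-- The universal property of the direct limit. -/
def dualLift {M : Type u} [AddCommGroup M] [Module k M]
    (g : ∀ l, ((P.alg l).carrier →ₗ[k] k) →ₗ[k] M)
    (hg : ∀ (l m : P.Λ) (h : l ≤ m) (ρ : (P.alg l).carrier →ₗ[k] k),
      g m (ρ ∘ₗ (homAlg (P.tr h)).toLinearMap) = g l ρ) : P.DualLimit →ₗ[k] M :=
  Module.DirectLimit.lift k P.Λ (fun l => (P.alg l).carrier →ₗ[k] k)
    (fun _ _ h => (homAlg (P.tr h)).toLinearMap.dualMap) g hg

open Classical in
theorem dualLift_ofDual {M : Type u} [AddCommGroup M] [Module k M]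
    (g : ∀ l, ((P.alg l).carrier →ₗ[k] k) →ₗ[k] M)
    (hg : ∀ (l m : P.Λ) (h : l ≤ m) (ρ : (P.alg l).carrier →ₗ[k] k),
      g m (ρ ∘ₗ (homAlg (P.tr h)).toLinearMap) = g l ρ) (l : P.Λ)
    (ρ : (P.alg l).carrier →ₗ[k] k) : P.dualLift g hg (P.ofDual l ρ) = g l ρ :=
  Module.DirectLimit.lift_of _ _ _

/-- A functional on the direct limit of the duals gives a compatible family of elements. -/
def ev (l : P.Λ) : (P.DualLimit →ₗ[k] k) →ₗ[k] (P.alg l).carrier :=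
  (Module.evalEquiv k (P.alg l).carrier).symm.toLinearMap ∘ₗ (P.ofDual l).dualMap

theorem apply_ev (l : P.Λ) (α : P.DualLimit →ₗ[k] k) (ρ : (P.alg l).carrier →ₗ[k] k) :
    ρ (P.ev l α) = α (P.ofDual l ρ) :=
  Module.apply_evalEquiv_symm_apply k (P.alg l).carrier ρ _

theorem tr_ev {l m : P.Λ} (h : l ≤ m) (α : P.DualLimit →ₗ[k] k) :
    homAlg (P.tr h) (P.ev m α) = P.ev l α :=
  eq_of_forall_dual fun (ρ : (P.alg l).carrier →ₗ[k] k) => by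
    rw [apply_ev, ← P.ofDual_tr h, ← apply_ev]; rfl

/-- The dual of `A_l` embeds in the limit, so evaluation at any element of `A_l` extends to a
functional on the limit. -/
theorem ev_surjective (l : P.Λ) : Function.Surjective (P.ev l) := fun a => by
  obtain ⟨g, hg⟩ := (P.ofDual l).exists_leftInverse_of_injective
    (LinearMap.ker_eq_bot.2 (P.ofDual_injective l))
  refine ⟨LinearMap.applyₗ a ∘ₗ g, eq_of_forall_dual fun (ρ : (P.alg l).carrier →ₗ[k] k) => ?_⟩
  rw [apply_ev]
  exact congrArg (fun ρ : (P.alg l).carrier →ₗ[k] k => ρ a) (LinearMap.congr_fun hg ρ)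

theorem ev_eq {l : P.Λ} {α : P.DualLimit →ₗ[k] k} {a : (P.alg l).carrier}
    (h : ∀ ρ, α (P.ofDual l ρ) = ρ a) : P.ev l α = a :=
  eq_of_forall_dual fun (ρ : (P.alg l).carrier →ₗ[k] k) => by rw [apply_ev, h]

/-- The comultiplication. -/
def limComul : P.DualLimit →ₗ[k] P.DualLimit ⊗[k] P.DualLimit :=
  P.dualLift (fun l => TensorProduct.map (P.ofDual l) (P.ofDual l) ∘ₗ dualComul _)
    fun l m h ρ => tensor_ext₂ fun α β => by
      rw [LinearMap.comp_apply, LinearMap.comp_apply, tensorFunctional_map, tensorFunctional_map,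
        tensorFunctional_dualComul (fun ρ => (P.apply_ev m α ρ).symm)
          (fun ρ => (P.apply_ev m β ρ).symm),
        tensorFunctional_dualComul (fun ρ => (P.apply_ev l α ρ).symm)
          (fun ρ => (P.apply_ev l β ρ).symm), ← P.tr_ev h α, ← P.tr_ev h β,
        ← map_mul (homAlg (P.tr h))]
      rfl

theorem tensorFunctional_limComul (l : P.Λ) (ρ : (P.alg l).carrier →ₗ[k] k)
    (α β : P.DualLimit →ₗ[k] k) :
    tensorFunctional α β (P.limComul (P.ofDual l ρ)) = ρ (P.ev l β * P.ev l α) := by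
  rw [limComul, dualLift_ofDual, LinearMap.comp_apply, tensorFunctional_map,
    tensorFunctional_dualComul (fun ρ => (P.apply_ev l α ρ).symm)
      (fun ρ => (P.apply_ev l β ρ).symm)]

/-- Functionals on the limit behave like compatible families of elements of the `A_l`. Through `ev`,
the super-coalgebra axioms of the limit become algebra axioms in each `A_l`, with factors reversed
as in `dualComul`. -/
theorem ev_limComul (l : P.Λ) (α β : P.DualLimit →ₗ[k] k) :
    P.ev l (tensorFunctional α β ∘ₗ P.limComul) = P.ev l β * P.ev l α :=
  P.ev_eq fun ρ => P.tensorFunctional_limComul l ρ α β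

/-- The counit. -/
def limCounit : P.DualLimit →ₗ[k] k :=
  P.dualLift (fun _ => LinearMap.applyₗ 1) fun _ _ h ρ => by simp

theorem ev_limCounit (l : P.Λ) : P.ev l P.limCounit = 1 :=
  P.ev_eq fun ρ => P.dualLift_ofDual _ _ l ρ

/-- The parity involution. -/
def limInv : P.DualLimit →ₗ[k] P.DualLimit :=
  P.dualLift (fun l => P.ofDual l ∘ₗ (P.alg l).inv.toLinearMap.dualMap) fun l m h ρ => by
    rw [LinearMap.comp_apply, LinearMap.comp_apply, ← P.ofDual_tr h]
    congr 1
    refine LinearMap.ext fun a => congrArg ρ ?_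
    exact SAlgf.inv_hom _ _

theorem ev_limInv (l : P.Λ) (α : P.DualLimit →ₗ[k] k) :
    P.ev l (α ∘ₗ P.limInv) = (P.alg l).inv (P.ev l α) :=
  P.ev_eq fun ρ => by
    have h : P.limInv (P.ofDual l ρ) = P.ofDual l (ρ ∘ₗ (P.alg l).inv.toLinearMap) :=
      P.dualLift_ofDual _ _ l ρ
    rw [LinearMap.comp_apply, h, ← apply_ev]
    rfl

theorem eq_of_ev {l : P.Λ} {α β : P.DualLimit →ₗ[k] k} (h : P.ev l α = P.ev l β)
    (ρ : (P.alg l).carrier →ₗ[k] k) : α (P.ofDual l ρ) = β (P.ofDual l ρ) := by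
  rw [← apply_ev, ← apply_ev, h]

theorem limInv_limInv (x : P.DualLimit) : P.limInv (P.limInv x) = x :=
  eq_of_forall_dual fun (α : P.DualLimit →ₗ[k] k) => by
    obtain ⟨l, ρ, rfl⟩ := P.exists_ofDual x
    refine P.eq_of_ev (α := (α ∘ₗ P.limInv) ∘ₗ P.limInv) ?_ ρ
    rw [ev_limInv, ev_limInv, SAlgf.inv_inv]

theorem limCounit_limInv (x : P.DualLimit) : P.limCounit (P.limInv x) = P.limCounit x := by
  obtain ⟨l, ρ, rfl⟩ := P.exists_ofDual x
  refine P.eq_of_ev (α := P.limCounit ∘ₗ P.limInv) ?_ ρ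
  rw [ev_limInv, ev_limCounit, map_one]

theorem limComul_limInv (x : P.DualLimit) :
    TensorProduct.map P.limInv P.limInv (P.limComul x) = P.limComul (P.limInv x) :=
  tensor_ext₂ fun α β => by
    obtain ⟨l, ρ, rfl⟩ := P.exists_ofDual x
    rw [tensorFunctional_map]
    refine P.eq_of_ev (α := tensorFunctional (α ∘ₗ P.limInv) (β ∘ₗ P.limInv) ∘ₗ P.limComul)
      (β := (tensorFunctional α β ∘ₗ P.limComul) ∘ₗ P.limInv) ?_ ρ
    rw [ev_limComul, ev_limInv, ev_limInv, ev_limInv, ev_limComul, map_mul]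

instance : Coalgebra k P.DualLimit where
  comul := P.limComul
  counit := P.limCounit
  coassoc := LinearMap.ext fun x => tensor_ext_assoc fun β γ =>
    eq_of_forall_dual fun (α : P.DualLimit →ₗ[k] k) => by
      obtain ⟨l, ρ, rfl⟩ := P.exists_ofDual x
      rw [apply_contractRight, apply_contractRight]
      change tensorFunctional α (tensorFunctional β γ) (TensorProduct.assoc k _ _ _
        (TensorProduct.map P.limComul LinearMap.id (P.limComul (P.ofDual l ρ)))) =
        tensorFunctional α (tensorFunctional β γ)
          (TensorProduct.map LinearMap.id P.limComul (P.limComul (P.ofDual l ρ)))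
      rw [tensorFunctional_assoc, tensorFunctional_map, tensorFunctional_map,
        tensorFunctional_limComul, tensorFunctional_limComul, ev_limComul, ev_limComul, mul_assoc]
      rfl
  rTensor_counit_comp_comul := LinearMap.ext fun x => tensor_ext₂ fun α β => by
    obtain ⟨l, ρ, rfl⟩ := P.exists_ofDual x
    change tensorFunctional α β (TensorProduct.map P.limCounit LinearMap.id
      (P.limComul (P.ofDual l ρ))) = tensorFunctional α β (1 ⊗ₜ P.ofDual l ρ)
    have e : α ∘ₗ P.limCounit = α 1 • P.limCounit := LinearMap.ext fun y => by
      rw [LinearMap.comp_apply, LinearMap.smul_apply, smul_eq_mul, mul_comm, ← smul_eq_mul,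
        ← map_smul, smul_eq_mul, mul_one]
    rw [tensorFunctional_map, tensorFunctional_limComul, e, map_smul, ev_limCounit,
      tensorFunctional_tmul, mul_smul_comm, mul_one, map_smul, ← apply_ev]
    rfl
  lTensor_counit_comp_comul := LinearMap.ext fun x => tensor_ext₂ fun α β => by
    obtain ⟨l, ρ, rfl⟩ := P.exists_ofDual x
    change tensorFunctional α β (TensorProduct.map LinearMap.id P.limCounit
      (P.limComul (P.ofDual l ρ))) = tensorFunctional α β (P.ofDual l ρ ⊗ₜ 1)
    have e : β ∘ₗ P.limCounit = β 1 • P.limCounit := LinearMap.ext fun y => by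
      rw [LinearMap.comp_apply, LinearMap.smul_apply, smul_eq_mul, mul_comm, ← smul_eq_mul,
        ← map_smul, smul_eq_mul, mul_one]
    rw [tensorFunctional_map, tensorFunctional_limComul, e, map_smul, ev_limCounit,
      tensorFunctional_tmul, smul_mul_assoc, one_mul, map_smul, ← apply_ev, smul_eq_mul, mul_comm]
    rfl

theorem exists_mem_range_map_ofDual {V : Type u} [AddCommGroup V] [Module k V]
    (v : V ⊗[k] P.DualLimit) : ∃ l, v ∈ LinearMap.range
      (TensorProduct.map (LinearMap.id : V →ₗ[k] V) (P.ofDual l)) := by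
  have mono : ∀ {l m : P.Λ} (_ : l ≤ m) {v : V ⊗[k] P.DualLimit}, v ∈ LinearMap.range
      (TensorProduct.map (LinearMap.id : V →ₗ[k] V) (P.ofDual l)) → v ∈ LinearMap.range
      (TensorProduct.map (LinearMap.id : V →ₗ[k] V) (P.ofDual m)) := by
    rintro l m h _ ⟨t, rfl⟩
    refine ⟨TensorProduct.map LinearMap.id (homAlg (P.tr h)).toLinearMap.dualMap t, ?_⟩
    rw [← LinearMap.comp_apply, ← TensorProduct.map_comp]
    have : P.ofDual m ∘ₗ (homAlg (P.tr h)).toLinearMap.dualMap = P.ofDual l :=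
      LinearMap.ext fun ρ => P.ofDual_tr h ρ
    rw [this]; rfl
  induction v with
  | zero => exact ⟨Classical.arbitrary _, zero_mem _⟩
  | add x y hx hy =>
    obtain ⟨l, hl⟩ := hx
    obtain ⟨m, hm⟩ := hy
    obtain ⟨n, h1, h2⟩ := exists_ge_ge l m
    exact ⟨n, add_mem (mono h1 hl) (mono h2 hm)⟩
  | tmul a x =>
    obtain ⟨l, ρ, rfl⟩ := P.exists_ofDual x
    exact ⟨l, a ⊗ₜ ρ, by simp⟩

variable [NeZero (2 : k)]

theorem ev_comp_parityProj (l : P.Λ) [DirectSum.Decomposition (eigenPart P.limInv)]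
    (α : P.DualLimit →ₗ[k] k) (i : ZMod 2) :
    P.ev l (α ∘ₗ parityProj (eigenPart P.limInv) i) =
      parityProj (P.alg l).part i (P.ev l α) := by
  have e0 : α ∘ₗ parityProj (eigenPart P.limInv) 0 = (2 : k)⁻¹ • (α + α ∘ₗ P.limInv) :=
    LinearMap.ext fun a => by
      rw [LinearMap.comp_apply, parityProj_zero_eq, map_smul, map_add, parityInv_eigenPart]; rfl
  have e1 : α ∘ₗ parityProj (eigenPart P.limInv) 1 = (2 : k)⁻¹ • (α - α ∘ₗ P.limInv) :=
    LinearMap.ext fun a => by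
      rw [LinearMap.comp_apply, parityProj_one_eq, map_smul, map_sub, parityInv_eigenPart]; rfl
  obtain rfl | rfl := zmod_two_cases i
  · rw [e0, map_smul, map_add, ev_limInv, parityProj_zero_eq]; rfl
  · rw [e1, map_smul, map_sub, ev_limInv, parityProj_one_eq]; rfl

/-- The super-coalgebra of a presented formal superscheme. -/
def toSuperCoalg : SuperCoalg k :=
  letI := eigenDecomposition P.limInv P.limInv_limInv
  { carrier := P.DualLimit
    part := eigenPart P.limInv
    comul_mem := by
      have e : parityInv (eigenPart P.limInv) = P.limInv :=
        LinearMap.ext (parityInv_eigenPart P.limInv)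
      intro i a ha
      obtain rfl | rfl := zmod_two_cases i
      · rw [mem_tensorPart_zero_iff, e]
        refine (P.limComul_limInv a).trans ?_
        rw [(mem_eigenPart_zero _ _).1 ha]; rfl
      · rw [mem_tensorPart_one_iff, e]
        refine (P.limComul_limInv a).trans ?_
        rw [(mem_eigenPart_one _ _).1 ha, map_neg]; rfl
    counit_odd a ha := by
      have h : P.limCounit a = -P.limCounit a := by
        conv_lhs => rw [← P.limCounit_limInv, (mem_eigenPart_one _ _).1 ha, map_neg]
      change P.limCounit a = 0
      have h2 : (2 : k) * P.limCounit a = 0 := by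
        rw [two_mul]; nth_rewrite 2 [h]; exact add_neg_cancel _
      exact (mul_eq_zero.1 h2).resolve_left (NeZero.ne _)
    super_cocomm a := tensor_ext₂ fun α β => by
      obtain ⟨l, ρ, rfl⟩ := P.exists_ofDual a
      rw [tensorFunctional_twist]
      change ∑ i : ZMod 2, ∑ j : ZMod 2, koszul k i j • tensorFunctional _ _
        (P.limComul (P.ofDual l ρ)) = tensorFunctional α β (P.limComul (P.ofDual l ρ))
      simp only [tensorFunctional_limComul, ev_comp_parityProj]
      have e : ∀ i j : ZMod 2, koszul k i j • ρ (parityProj (P.alg l).part j (P.ev l α) *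
          parityProj (P.alg l).part i (P.ev l β)) = ρ (parityProj (P.alg l).part i (P.ev l β) *
          parityProj (P.alg l).part j (P.ev l α)) := fun i j => by
        rw [← map_smul, show koszul k i j = koszul k j i by simp only [koszul, and_comm],
          SAlgf.koszul_smul_mul _ (parityProj_mem _ _ _) (parityProj_mem _ _ _)]
      simp only [e, SuperCoalg.sum_zmod_two]
      rw [← map_add, ← map_add, ← map_add, ← mul_add, parityProj_add, ← mul_add, parityProj_add,
        ← add_mul, parityProj_add] }

theorem toSuperCoalg_inv : P.toSuperCoalg.inv = P.limInv :=
  letI := eigenDecomposition P.limInv P.limInv_limInv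
  LinearMap.ext (parityInv_eigenPart P.limInv)

theorem exists_spStar_elt (l : P.Λ) : ∃ v : (spStar P.toSuperCoalg).obj (P.alg l),
    ∀ α : P.DualLimit →ₗ[k] k, dualHom (A := P.toSuperCoalg) v α = P.ev l α := by
  obtain ⟨v, hv⟩ := exists_contractRight_eq (P.ev l) fun ρ => ⟨P.ofDual l ρ, fun α =>
    P.apply_ev l α ρ⟩
  refine ⟨⟨v, (isGroupLike_iff (A := P.toSuperCoalg) v).2 ⟨fun α => ?_, ?_, fun α β => ?_⟩⟩, hv⟩
  · rw [toSuperCoalg_inv]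
    refine (congrArg _ (hv α)).trans ((P.ev_limInv l α).symm.trans ?_)
    exact (hv _).symm
  · exact (hv _).trans (P.ev_limCounit l)
  · refine (hv _).trans ((P.ev_limComul l α β).trans ?_)
    exact congrArg₂ (· * ·) (hv β).symm (hv α).symm

/-- Every presented formal superscheme is `Sp*` of a super-coalgebra. -/
theorem exists_spStar_iso {Z : FormalFunctor k} (P : Pres Z) :
    ∃ A : SuperCoalg k, Nonempty (spStar A ≅ Z) := by
  choose v hv using P.exists_spStar_elt
  have hmap : ∀ {l : P.Λ} {S : SAlgf k} (φ : P.alg l ⟶ S) (α : P.DualLimit →ₗ[k] k),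
      dualHom (A := P.toSuperCoalg) ((spStar P.toSuperCoalg).map φ (v l)) α =
        homAlg φ (P.ev l α) := fun φ α => by
    refine (dualHom_map (A := P.toSuperCoalg) (v _) φ α).trans ?_
    rw [← hv]
  have hcomp : ∀ {l m : P.Λ} (h : l ≤ m), (spStar P.toSuperCoalg).map (P.tr h) (v m) = v l :=
    fun {l m} h => ext_dualHom fun α => (hmap _ α).trans ((P.tr_ev h α).trans (hv l α).symm)
  let F : Z ⟶ spStar P.toSuperCoalg := P.desc v hcomp
  have hF : ∀ {l : P.Λ} {S : SAlgf k} (φ : P.alg l ⟶ S), F.app S (Z.map φ (P.elt l)) =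
      (spStar P.toSuperCoalg).map φ (v l) := fun φ => by
    rw [app_map]; exact congrArg _ (P.desc_elt v hcomp _)
  have hbij : ∀ S : SAlgf k, Function.Bijective (F.app S) := by
    intro S
    constructor
    · intro a b hab
      obtain ⟨l, φ, rfl⟩ := P.surj a
      obtain ⟨m, h, ψ, rfl⟩ := P.surj_above b l
      have : P.tr h ≫ φ = ψ := SAlgf.hom_ext fun r => by
        obtain ⟨α, rfl⟩ := P.ev_surjective m r
        rw [hF, hF] at hab
        rw [SAlgf.homAlg_comp, tr_ev, ← hmap, ← hmap, hab]
      rw [← this, map_comp_apply', P.map_tr]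
    · intro w
      -- A tensor involves finitely many elements of the limit, so `w` comes from `S ⊗ (A_l)*`, that
      -- is, from a linear map `A_l → S`. Being group-like makes this map a morphism, since `ev` is
      -- onto `A_l`.
      obtain ⟨l, t, ht⟩ := P.exists_mem_range_map_ofDual w.1
      have hw : ∀ α : P.DualLimit →ₗ[k] k, dualHom (A := P.toSuperCoalg) w α =
          contractRight (α ∘ₗ P.ofDual l) t := fun α => by
        refine (congrArg (contractRight α) ht.symm).trans ?_
        exact contractRight_map _ _ _ _
      let φ₀ : (P.alg l).carrier →ₗ[k] S.carrier :=
        { toFun a := contractRight (LinearMap.applyₗ a) t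
          map_add' a b := by rw [map_add, contractRight_add]
          map_smul' c a := by rw [map_smul, contractRight_smul]; rfl }
      have hφ₀ : ∀ α : P.DualLimit →ₗ[k] k, φ₀ (P.ev l α) =
          dualHom (A := P.toSuperCoalg) w α := fun α => by
        refine Eq.trans ?_ (hw α).symm
        refine congrArg (fun β => contractRight β t) ?_
        exact LinearMap.ext fun ρ => P.apply_ev l α ρ
      let φ₁ : (P.alg l).carrier →ₐ[k] S.carrier := AlgHom.ofLinearMap φ₀
        (by
          rw [← P.ev_limCounit l, hφ₀]
          exact dualHom_ε (A := P.toSuperCoalg) w)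
        (fun a b => by
          obtain ⟨α, rfl⟩ := P.ev_surjective l a
          obtain ⟨β, rfl⟩ := P.ev_surjective l b
          rw [← ev_limComul, hφ₀, hφ₀, hφ₀]
          exact dualHom_conv (A := P.toSuperCoalg) w β α)
      refine ⟨Z.map (SAlgf.homMk φ₁ fun a => ?_) (P.elt l), ?_⟩
      · obtain ⟨α, rfl⟩ := P.ev_surjective l a
        rw [← ev_limInv]
        refine (hφ₀ _).trans (Eq.trans ?_ (congrArg S.inv (hφ₀ α).symm))
        rw [← P.toSuperCoalg_inv]
        exact (dualHom_inv (A := P.toSuperCoalg) w α).symm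
      · rw [hF]
        exact ext_dualHom fun α => (hmap _ α).trans (hφ₀ α)
  have : ∀ S, IsIso (F.app S) := fun S => (isIso_iff_bijective _).2 (hbij S)
  have : IsIso F := NatIso.isIso_of_isIso_app F
  exact ⟨_, ⟨(asIso F).symm⟩⟩

end Pres

end
end SuperFormal

namespace SuperFormal

noncomputable section

variable {k : Type u} [Field k]

/-! ### The coradical of a one-pointed super-coalgebra -/

theorem IsMinimal.of_iso {Z Z' : FormalFunctor k} (e : Z ≅ Z') {R : SAlgf k} {a : Z.obj R}
    (ha : IsMinimal Z a) : IsMinimal Z' (e.hom.app R a) := fun S φ b hb =>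
  ha S φ (e.inv.app S b) (by
    rw [← app_map, hb]
    simp)

theorem Pres.isMinimal_elt {Z : FormalFunctor k} (P : Pres Z) (l : P.Λ) :
    IsMinimal Z (P.elt l) := by
  have := P.isMinimal_map (𝟙 (P.alg l)) Function.surjective_id
  rwa [map_id_apply'] at this

variable [NeZero (2 : k)]

/-- Elements over a domain are defined over a minimal one. -/
theorem exists_minimal {Z : FormalFunctor k} (P : Pres Z) {R : SAlgf k} (a : Z.obj R) :
    ∃ (S : SAlgf k) (ι : S ⟶ R) (b : Z.obj S), Function.Injective (homAlg ι) ∧ IsMinimal Z b ∧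
      Z.map ι b = a := by
  obtain ⟨l, -, S, π, ι, hπ, hι, h⟩ := P.exists_surjective a (Classical.arbitrary _)
  exact ⟨S, ι, _, hι, P.isMinimal_map π hπ, h⟩

section Corad

variable {A : SuperCoalg k}

/-- Both sides are simple, and the left one contains a nonzero element of the dual of `T`, hence
contains the right one. -/
theorem idealSub_map_eq {R T : SAlgf k} {w : (spStar A).obj T} (hw : IsMinimal _ w) (φ : T ⟶ R)
    (hT : ∀ p q : Spec T, p = q) (hR : ∀ p q : Spec R, p = q)
    (hv : IsMinimal _ ((spStar A).map φ w)) (p : Spec R) (q : Spec T) :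
    idealSub ((spStar A).map φ w) p.1 = idealSub w q.1 := by
  have h1 := isSimpleSub_idealSub _ (dualHom_surjective _ hv) hR p
  have h2 := isSimpleSub_idealSub _ (dualHom_surjective _ hw) hT q
  obtain ⟨c, hc, hc0⟩ := Submodule.exists_mem_ne_zero_of_ne_bot h1.ne_bot
  obtain ⟨ρ, -, hρ⟩ := (mem_idealSub _).1 hc
  rw [dualMapTo_map] at hρ
  have hle := idealSub_le_of_isSub w (dualHom_surjective _ hw) hT q h1.isSub _
    (hρ.symm ▸ hc) (hρ.symm ▸ hc0)
  exact ((h1.eq_bot_or_eq _ h2.isSub hle).resolve_left h2.ne_bot).symm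

/-- Every simple sub-super-coalgebra contains a nonzero element coming from some minimal group-like
element `w`, hence equals the dual of a residue algebra. Comparing `w` and `v` at a common level of
the presentation shows that there is only one such simple, so the coradical is simple. -/
theorem corad_eq_idealSub (P : Pres (spStar A))
    (hA : ∀ (R : SAlgf k) (v : (spStar A).obj R), IsMinimal _ v → ∀ p q : Spec R, p = q)
    {R : SAlgf k} {v : (spStar A).obj R} (hv : IsMinimal _ v) (p : Spec R) :
    A.corad = idealSub v p.1 := by
  refine le_antisymm (sSup_le fun B hB => ?_)
    (le_sSup (isSimpleSub_idealSub v (dualHom_surjective _ hv) (hA _ _ hv) p))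
  obtain ⟨b, hb, hb0⟩ := Submodule.exists_mem_ne_zero_of_ne_bot hB.ne_bot
  obtain ⟨T, w₀, ρ, hρ⟩ := A.exists_dualMapTo_eq b
  obtain ⟨S, ι, w, -, hw, rfl⟩ := exists_minimal P w₀
  rw [dualMapTo_map] at hρ
  have : Nontrivial S.carrier := by
    by_contra h
    rw [not_nontrivial_iff_subsingleton] at h
    refine hb0 (hρ.symm.trans ?_)
    have : ρ ∘ₗ (homAlg ι).toLinearMap = 0 := LinearMap.ext fun s => by
      rw [Subsingleton.elim s 0, map_zero, map_zero]
    rw [this, map_zero]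
  obtain ⟨q⟩ := Spec.nonempty_of_nontrivial (R := S)
  have hs := isSimpleSub_idealSub w (dualHom_surjective _ hw) (hA _ _ hw) q
  have hle := idealSub_le_of_isSub w (dualHom_surjective _ hw) (hA _ _ hw) q hB.isSub _
    (hρ.symm ▸ hb) (hρ.symm ▸ hb0)
  rw [← (hB.eq_bot_or_eq _ hs.isSub hle).resolve_left hs.ne_bot]
  obtain ⟨l, φ, rfl⟩ := P.surj v
  obtain ⟨m, hm, ψ, rfl⟩ := P.surj_above w l
  rw [← P.map_tr hm, ← map_comp_apply'] at hv ⊢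
  rw [idealSub_map_eq (P.isMinimal_elt m) _ (hA _ _ (P.isMinimal_elt m)) (hA _ _ hv) hv p (Spec.comap ψ q),
    idealSub_map_eq (P.isMinimal_elt m) _ (hA _ _ (P.isMinimal_elt m)) (hA _ _ hw) hw q (Spec.comap ψ q)]

end Corad

/-! ### The reduced subscheme of a point -/

variable {Z : FormalFunctor k}

/-- The coradical is dual to the residue algebra, so a group-like element supported on it kills the
prime and factors through a domain; conversely a map to a domain kills that prime. This removes
super-coalgebras from the description of `{z}`; their existence is used so that the supremum
defining `pointSub` is not over an empty family. -/
theorem mem_pointSub_iff (P : Pres Z) (z : Points Z) {R : SAlgf k} (a : Z.obj R) :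
    a ∈ (pointSub Z z).obj R ↔ ∃ (K : SAlgf k) (_ : IsDomain K.carrier) (η : Z.obj K) (ψ : K ⟶ R),
      η ∈ (component Z z).obj K ∧ Z.map ψ η = a := by
  have hcl := isClosedSub_component Z z
  obtain ⟨P'⟩ := P.exists_sub hcl
  have one : ∀ {A : SuperCoalg k} (e : spStar A ≅ (component Z z).toFunctor) (R : SAlgf k)
      (v : (spStar A).obj R), IsMinimal _ v → ∀ p q : Spec R, p = q := fun e R v hv => by
    have h := (hcl.isMinimal_iff _).1 (hv.of_iso e)
    exact P.spec_eq_of_mem_component (e.hom.app R v).2 h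
  simp only [pointSub, Subfunctor.iSup_obj, Set.mem_iUnion, Subfunctor.image_obj, Set.mem_image]
  constructor
  · rintro ⟨A, e, v, hv, rfl⟩
    let Q := P'.ofIso e.symm
    obtain ⟨R₀, a₀, p₀, h₀⟩ := z.exists_mk
    obtain ⟨K₀, _, π₀, -, hk₀⟩ := SAlgf.exists_residue p₀
    have hη₀ : Z.map π₀ a₀ ∈ (component Z z).obj K₀ := fun p => by
      rw [Points.mk_map, ← h₀]
      congr 1
      exact Spec.ext fun r => by rw [SAlgf.comap_eq_ker, hk₀]
    obtain ⟨l₀, φ₀, -⟩ := Q.surj (e.inv.app K₀ ⟨_, hη₀⟩)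
    obtain ⟨l, hl, φ, rfl⟩ := Q.surj_above v l₀
    let p : Spec (Q.alg l) := Spec.comap (Q.tr hl ≫ φ₀) K₀.botSpec
    have hc := corad_eq_idealSub Q (one e) (Q.isMinimal_elt l) p
    obtain ⟨K, hK, π, hπ, hk⟩ := SAlgf.exists_residue p
    obtain ⟨ψ, rfl⟩ := SAlgf.exists_lift_of_surjective π hπ φ fun r hr => by
      obtain ⟨α, rfl⟩ := dualHom_surjective _ (Q.isMinimal_elt l) r
      rw [← dualHom_map]
      refine (mem_spStarSub_iff _ _).1 hv α fun b hb => ?_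
      rw [hc] at hb
      exact apply_eq_zero_of_dualHom_mem _ ((hk _).1 hr) hb
    refine ⟨K, hK, (e.hom.app K ((spStar A).map π (Q.elt l))).1, ψ, Subtype.mem _, ?_⟩
    rw [map_comp_apply']
    exact (app_map (e.hom ≫ (component Z z).ι) ψ _).symm
  · rintro ⟨K, hK, η, ψ, hη, rfl⟩
    obtain ⟨A, ⟨e⟩⟩ := P'.exists_spStar_iso
    let Q := P'.ofIso e.symm
    have key : e.inv.app K ⟨η, hη⟩ ∈ (spStarSub A A.corad).obj K := by
      obtain ⟨l, φ, h⟩ := Q.surj (e.inv.app K ⟨η, hη⟩)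
      rw [← h, mem_spStarSub_iff]
      intro α hα
      rw [corad_eq_idealSub Q (one e) (Q.isMinimal_elt l) (Spec.comap φ K.botSpec)] at hα
      rw [dualHom_map]
      exact (SAlgf.comap_eq_ker φ K.botSpec _).1 (dualHom_mem_of_forall _ hα)
    refine ⟨A, e, _, (spStarSub A A.corad).map ψ key, ?_⟩
    refine (app_map (e.hom ≫ (component Z z).ι) ψ _).trans ?_
    have h : e.hom.app K (e.inv.app K ⟨η, hη⟩) = ⟨η, hη⟩ :=
      congrArg (fun t : (component Z z).toFunctor ⟶ (component Z z).toFunctor =>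
        t.app K ⟨η, hη⟩) e.inv_hom_id
    exact congrArg (fun t : (component Z z).toFunctor.obj K => Z.map ψ t.1) h

/-- An element over a domain in the component has kernel lying over `z`. Since primes of `A_m` are
determined by their points, this kernel is the pullback of `p`. -/
theorem map_elt_mem_pointSub_iff (P : Pres Z) {z : Points Z} {l : P.Λ} {p : Spec (P.alg l)}
    (hp : Points.mk Z _ (P.elt l) p = z) {S : SAlgf k} (χ : P.alg l ⟶ S) :
    Z.map χ (P.elt l) ∈ (pointSub Z z).obj S ↔ ∀ r ∈ p.1, homAlg χ r = 0 := by
  rw [mem_pointSub_iff P]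
  constructor
  · rintro ⟨K, _, η, ψ, hη, h⟩ r hr
    obtain ⟨m, hm, κ, rfl⟩ := P.surj_above η l
    have e : P.tr hm ≫ χ = κ ≫ ψ := P.inj m _ _ (by
      rw [map_comp_apply', P.map_tr, map_comp_apply', h])
    have e2 : Spec.comap κ K.botSpec = Spec.comap (P.tr hm) p := P.mk_injective m (by
      rw [P.mk_comap_tr, hp, ← Points.mk_map]
      exact hη _)
    obtain ⟨s, rfl⟩ := P.tr_surj hm r
    have hs : s ∈ (Spec.comap κ K.botSpec).1 := e2 ▸ hr
    rw [SAlgf.comap_eq_ker] at hs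
    rw [← SAlgf.homAlg_comp, e, SAlgf.homAlg_comp, hs, map_zero]
  · intro h
    obtain ⟨K, hK, π, hπ, hk⟩ := SAlgf.exists_residue p
    obtain ⟨ψ, rfl⟩ := SAlgf.exists_lift_of_surjective π hπ χ fun r hr => h r ((hk r).1 hr)
    refine ⟨K, hK, Z.map π (P.elt l), ψ, fun q => ?_, (map_comp_apply' _ _ _ _).symm⟩
    rw [Points.mk_map, ← hp]
    congr 1
    exact Spec.ext fun r => by rw [SAlgf.comap_eq_ker, hk]

theorem isClosedSub_pointSub (P : Pres Z) (z : Points Z) : IsClosedSub (pointSub Z z) :=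
  fun R a => by
    obtain ⟨l₀, -, p₀, h₀⟩ := P.exists_mk_above z (Classical.arbitrary _)
    obtain ⟨l, hl, θ, rfl⟩ := P.surj_above a l₀
    have hp : Points.mk Z _ (P.elt l) (Spec.comap (P.tr hl) p₀) = z := by
      rw [P.mk_comap_tr, h₀]
    refine ⟨Ideal.span (homAlg θ '' (Spec.comap (P.tr hl) p₀).1), fun r hr => ?_, fun S φ => ?_⟩
    · induction hr using Submodule.span_induction with
      | mem x hx =>
        obtain ⟨s, hs, rfl⟩ := hx
        rw [← SAlgf.inv_hom]
        exact Ideal.subset_span ⟨_, Spec.inv_mem _ _ hs, rfl⟩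
      | zero => rw [map_zero]; exact zero_mem _
      | add x y _ _ hx hy => rw [map_add]; exact add_mem hx hy
      | smul c x _ hx => rw [smul_eq_mul, map_mul]; exact Ideal.mul_mem_left _ _ hx
    · rw [← map_comp_apply', map_elt_mem_pointSub_iff P hp]
      constructor
      · intro h r hr
        have : Ideal.span (homAlg θ '' (Spec.comap (P.tr hl) p₀).1) ≤ SAlgf.ker φ :=
          Ideal.span_le.2 (by rintro _ ⟨s, hs, rfl⟩; exact h s hs)
        exact this hr
      · intro h r hr
        exact h _ (Ideal.subset_span ⟨r, hr, rfl⟩)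

theorem isClosedSub_fiber {X Y : FormalFunctor k} (P : Pres Y) (f : X ⟶ Y) (y : Points Y) :
    IsClosedSub (fiber f y) :=
  (isClosedSub_pointSub P y).preimage f

end
end SuperFormal

namespace SuperFormal

noncomputable section

variable {k : Type u} [Field k]

/-! ### Algebraicity as a bound on dimensions -/

namespace SAlgf

/-- Products of nilpotent elements vanish. -/
def SqZero (R : SAlgf k) : Prop :=
  ∀ r s : R.carrier, IsNilpotent r → IsNilpotent s → r * s = 0

/-- A subspace closed under left multiplication, as a left ideal. -/
def idealOf {R : SAlgf k} (M : Submodule k R.carrier) (h : ∀ r, ∀ m ∈ M, r * m ∈ M) :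
    Ideal R.carrier :=
  { M with smul_mem' := fun r _ hm => h r _ hm }

theorem mul_mem_mul_left {R : SAlgf k} {M N : Submodule k R.carrier} (h : ∀ r, ∀ m ∈ M, r * m ∈ M)
    (r : R.carrier) {x : R.carrier} (hx : x ∈ M * N) : r * x ∈ M * N := by
  induction hx using Submodule.mul_induction_on' with
  | mem_mul_mem m hm n hn =>
    rw [← mul_assoc]
    exact Submodule.mul_mem_mul (h r m hm) hn
  | add x _ y _ hx hy => rw [mul_add]; exact add_mem hx hy

theorem inv_mem_mul {R : SAlgf k} {M N : Submodule k R.carrier} (hM : ∀ m ∈ M, R.inv m ∈ M)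
    (hN : ∀ m ∈ N, R.inv m ∈ N) {x : R.carrier} (hx : x ∈ M * N) : R.inv x ∈ M * N := by
  induction hx using Submodule.mul_induction_on' with
  | mem_mul_mem m hm n hn =>
    rw [map_mul]
    exact Submodule.mul_mem_mul (hM m hm) (hN n hn)
  | add x _ y _ hx hy => rw [map_add]; exact add_mem hx hy

/-- The prime as a subspace. -/
abbrev _root_.SuperFormal.Spec.sub {R : SAlgf k} (p : Spec R) : Submodule k R.carrier :=
  p.1.restrictScalars k

end SAlgf

/-- The dimensions of the minimal square-zero thickenings of `z` in `Z` are bounded. -/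
def BoundedAt (Z : FormalFunctor k) (z : Points Z) : Prop :=
  ∃ N : ℕ, ∀ (R : SAlgf k) (a : Z.obj R), a ∈ (component Z z).obj R → IsMinimal Z a →
    R.SqZero → Module.finrank k R.carrier ≤ N

/-- Functionals vanishing on `C` are those of the quotient by `C`, and pairs of them separate
tensors. -/
theorem mem_wedge_iff {A : SuperCoalg k} {C : Submodule k A.carrier} {a : A.carrier} :
    a ∈ A.wedge C C ↔ ∀ α β : A.carrier →ₗ[k] k, (∀ c ∈ C, α c = 0) → (∀ c ∈ C, β c = 0) →
      A.conv α β a = 0 := by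
  constructor
  · intro h α β hα hβ
    have h0 : TensorProduct.map C.mkQ C.mkQ (A.Δ a) = 0 := h
    have hα' : C ≤ LinearMap.ker α := hα
    have hβ' : C ≤ LinearMap.ker β := hβ
    have e := tensorFunctional_map C.mkQ C.mkQ (C.liftQ α hα') (C.liftQ β hβ') (A.Δ a)
    rw [h0, map_zero, Submodule.liftQ_mkQ, Submodule.liftQ_mkQ] at e
    exact e.symm
  · intro h
    change TensorProduct.map C.mkQ C.mkQ (A.Δ a) = 0
    refine tensor_ext₂ fun α β => ?_
    rw [tensorFunctional_map, map_zero]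
    refine h _ _ (fun c hc => ?_) (fun c hc => ?_) <;>
    · rw [LinearMap.comp_apply, Submodule.mkQ_apply, (Submodule.Quotient.mk_eq_zero C).2 hc,
        map_zero]

variable [NeZero (2 : k)]

section

variable {Z : FormalFunctor k} (z : Points Z)

theorem isMinimal_of_spStar {z : Points Z} {A : SuperCoalg k}
    (e : spStar A ≅ (component Z z).toFunctor) {R : SAlgf k} {v : (spStar A).obj R}
    (hv : IsMinimal _ v) : IsMinimal Z ((e.hom.app R v).1 : Z.obj R) :=
  ((isClosedSub_component Z z).isMinimal_iff _).1 (hv.of_iso e)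

theorem spec_eq_of_spStar (P : Pres Z) {z : Points Z} {A : SuperCoalg k}
    (e : spStar A ≅ (component Z z).toFunctor) (R : SAlgf k) (v : (spStar A).obj R)
    (hv : IsMinimal _ v) (p q : Spec R) : p = q :=
  P.spec_eq_of_mem_component (e.hom.app R v).2 (isMinimal_of_spStar e hv) p q

/-- The dual of a minimal square-zero thickening `R` embeds in `A`. Functionals vanishing on the
coradical map into the nilradical of `R`, whose products vanish, so the image lies in the wedge
square of the coradical. -/
theorem boundedAt_of_algebraicAt (P : Pres Z) (h : AlgebraicAt Z z) : BoundedAt Z z := by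
  obtain ⟨A, ⟨e⟩, hfin⟩ := h
  have hfin' : Module.Finite k (A.wedge A.corad A.corad) := hfin
  obtain ⟨P'⟩ := P.exists_sub (isClosedSub_component Z z)
  refine ⟨Module.finrank k (A.wedge A.corad A.corad), fun R a ha hmin hsq => ?_⟩
  by_cases hR : Nontrivial R.carrier
  swap
  · rw [not_nontrivial_iff_subsingleton] at hR
    rw [Module.finrank_zero_of_subsingleton]
    exact Nat.zero_le _
  obtain ⟨p⟩ := Spec.nonempty_of_nontrivial (R := R)
  let v := e.inv.app R ⟨a, ha⟩
  have hv : IsMinimal _ v :=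
    IsMinimal.of_iso e.symm (((isClosedSub_component Z z).isMinimal_iff ⟨a, ha⟩).2 hmin)
  have hs := dualHom_surjective v hv
  have hR := spec_eq_of_spStar P e R v hv
  have hc := corad_eq_idealSub (P'.ofIso e.symm) (spec_eq_of_spStar P e) hv p
  have hmem : ∀ ρ, dualMapTo v ρ ∈ A.wedge A.corad A.corad := fun ρ => by
    rw [mem_wedge_iff]
    intro α β hα hβ
    rw [hc] at hα hβ
    rw [apply_dualMapTo, dualHom_conv,
      hsq _ _ ((Spec.mem_iff_isNilpotent hR p _).1 (dualHom_mem_of_forall v hβ))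
        ((Spec.mem_iff_isNilpotent hR p _).1 (dualHom_mem_of_forall v hα)), map_zero]
  have hinj : Function.Injective ((dualMapTo v).codRestrict _ hmem) := fun ρ ρ' h =>
    dualMapTo_injective v hs (congrArg Subtype.val h)
  rw [← Subspace.dual_finrank_eq (K := k) (V := R.carrier)]
  exact LinearMap.finrank_le_finrank_of_injective hinj

/-- At each level `l`, the part of the wedge square coming from `A_l` is contained in the dual of
`A_l / p²`, a square-zero thickening of dimension at most `N`. Any finite set of elements comes from
one level, so the whole wedge square has rank at most `N`. -/
theorem algebraicAt_of_boundedAt (P : Pres Z) (h : BoundedAt Z z) : AlgebraicAt Z z := by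
  obtain ⟨N, hN⟩ := h
  obtain ⟨P'⟩ := P.exists_sub (isClosedSub_component Z z)
  obtain ⟨A, ⟨e⟩⟩ := P'.exists_spStar_iso
  refine ⟨A, ⟨e⟩, ?_⟩
  let Q := P'.ofIso e.symm
  have key : ∀ l, ∃ F : Submodule k A.carrier, Module.Finite k F ∧ Module.finrank k F ≤ N ∧
      ∀ ρ, dualMapTo (Q.elt l) ρ ∈ A.wedge A.corad A.corad → dualMapTo (Q.elt l) ρ ∈ F := by
    intro l
    by_cases hR : Nontrivial (Q.alg l).carrier
    swap
    · rw [not_nontrivial_iff_subsingleton] at hR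
      refine ⟨⊥, inferInstance, by simp, fun ρ _ => ?_⟩
      have : ρ = 0 := LinearMap.ext fun r => by
        rw [Subsingleton.elim r 0, map_zero, map_zero]
      rw [this, map_zero]
      exact zero_mem _
    obtain ⟨p⟩ := Spec.nonempty_of_nontrivial (R := Q.alg l)
    have hmin := Q.isMinimal_elt l
    have hs := dualHom_surjective _ hmin
    have hc := corad_eq_idealSub Q (spec_eq_of_spStar P e) hmin p
    let J := SAlgf.idealOf (p.sub * p.sub)
      fun r _ hm => SAlgf.mul_mem_mul_left (fun r m hm => p.1.mul_mem_left r hm) r hm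
    have hJp : J ≤ p.1 := fun x hx =>
      Submodule.mul_le.2 (fun m _ n hn => p.1.mul_mem_left m hn) hx
    obtain ⟨S, π, hπ, hk⟩ := SAlgf.exists_quot _ J fun x hx =>
      SAlgf.inv_mem_mul (fun r hr => p.inv_mem r hr) (fun r hr => p.inv_mem r hr) hx
    have hb := Q.isMinimal_map π hπ
    have hsq : S.SqZero := by
      have hn : ∀ r, IsNilpotent (homAlg π r) → r ∈ p.1 := fun r ⟨n, hn⟩ => by
        rw [← map_pow, hk] at hn
        have := p.2.2
        exact this.mem_of_pow_mem n (hJp hn)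
      intro x y hx hy
      obtain ⟨r, rfl⟩ := hπ x
      obtain ⟨s, rfl⟩ := hπ y
      rw [← map_mul, hk]
      exact Submodule.mul_mem_mul (hn r hx) (hn s hy)
    have hdim := hN S _ (e.hom.app S ((spStar A).map π (Q.elt l))).2 (isMinimal_of_spStar e hb) hsq
    refine ⟨LinearMap.range (dualMapTo ((spStar A).map π (Q.elt l))), inferInstance, ?_, ?_⟩
    · refine (LinearMap.finrank_range_le _).trans ?_
      rw [← Subspace.dual_finrank_eq (K := k) (V := S.carrier)] at hdim
      exact hdim
    · intro ρ hρ
      rw [mem_wedge_iff, hc] at hρ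
      -- Elements of `p` are the values of functionals vanishing on the coradical, so lying in the
      -- wedge says exactly that `ρ` kills `p²`.
      have hρ0 : ∀ r ∈ J, ρ r = 0 := by
        intro r hr
        have hle : p.sub * p.sub ≤ LinearMap.ker ρ := Submodule.mul_le.2 fun m hm n hn => by
          obtain ⟨β, rfl⟩ := hs m
          obtain ⟨α, rfl⟩ := hs n
          rw [LinearMap.mem_ker, ← dualHom_conv, ← apply_dualMapTo]
          exact hρ α β (fun c hcc => apply_eq_zero_of_dualHom_mem _ hn hcc)
            (fun c hcc => apply_eq_zero_of_dualHom_mem _ hm hcc)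
        exact hle hr
      obtain ⟨g, hg⟩ := (homAlg π).toLinearMap.exists_rightInverse_of_surjective
        (LinearMap.range_eq_top.2 hπ)
      refine ⟨ρ ∘ₗ g, ?_⟩
      rw [dualMapTo_map]
      congr 1
      refine LinearMap.ext fun r => ?_
      rw [← sub_eq_zero]
      have : homAlg π (g (homAlg π r)) = homAlg π r := LinearMap.congr_fun hg _
      refine (map_sub ρ _ _).symm.trans (hρ0 _ ((hk _).1 ?_))
      rw [map_sub]
      exact sub_eq_zero.2 this
  have mono : ∀ {l m : Q.Λ} (_ : l ≤ m), LinearMap.range (dualMapTo (Q.elt l)) ≤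
      LinearMap.range (dualMapTo (Q.elt m)) := by
    rintro l m hl _ ⟨ρ, rfl⟩
    exact ⟨ρ ∘ₗ (homAlg (Q.tr hl)).toLinearMap, by rw [← dualMapTo_map, Q.map_tr]⟩
  have cover : ∀ s : Finset (A.wedge A.corad A.corad), ∃ l, ∀ a ∈ s,
      (a : A.carrier) ∈ LinearMap.range (dualMapTo (Q.elt l)) := by
    classical
    intro s
    induction s using Finset.induction_on with
    | empty => exact ⟨Classical.arbitrary _, by simp⟩
    | insert a s _ ih =>
      obtain ⟨l, hl⟩ := ih
      obtain ⟨R, v, ρ, h⟩ := A.exists_dualMapTo_eq a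
      obtain ⟨m, hm, φ, rfl⟩ := Q.surj_above v l
      refine ⟨m, fun b hb => ?_⟩
      obtain rfl | hb := Finset.mem_insert.1 hb
      · exact ⟨_, (dualMapTo_map _ φ ρ).symm.trans h⟩
      · exact mono hm (hl b hb)
  have hrank : Module.rank k (A.wedge A.corad A.corad) ≤ N := rank_le fun s hs => by
    obtain ⟨l, hl⟩ := cover s
    obtain ⟨F, _, hF, h⟩ := key l
    have hmem : ∀ i : s, ((i : A.wedge A.corad A.corad) : A.carrier) ∈ F := fun i => by
      obtain ⟨ρ, hρ⟩ := hl i i.2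
      rw [← hρ]
      exact h ρ (hρ ▸ (i : A.wedge A.corad A.corad).2)
    have h2 : LinearIndependent k (fun i : s => ((i : A.wedge A.corad A.corad) : A.carrier)) :=
      hs.map' (A.wedge A.corad A.corad).subtype (Submodule.ker_subtype _)
    have h3 : LinearIndependent k (fun i : s => (⟨_, hmem i⟩ : F)) :=
      LinearIndependent.of_comp F.subtype h2
    have := h3.fintype_card_le_finrank
    rw [Fintype.card_coe] at this
    exact this.trans hF
  have : Module.Finite k (A.wedge A.corad A.corad) :=
    Module.rank_lt_aleph0_iff.1 (hrank.trans_lt (Cardinal.natCast_lt_aleph0))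
  exact this

theorem algebraicAt_iff (P : Pres Z) : AlgebraicAt Z z ↔ BoundedAt Z z :=
  ⟨boundedAt_of_algebraicAt z P, algebraicAt_of_boundedAt z P⟩

end

end
end SuperFormal

namespace SuperFormal

noncomputable section

variable {k : Type u} [Field k]

/-! ### Closed immersions in terms of elements -/

/-- The pullback square is read through the Yoneda lemma. -/
theorem IsClosedImmersion.exists_elt {X Y : FormalFunctor k} {f : X ⟶ Y}
    (hf : IsClosedImmersion f) (A : SAlgf k) (y : Y.obj A) :
    ∃ (B : SAlgf k) (π : A ⟶ B) (b : X.obj B), Function.Surjective (homAlg π) ∧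
      ∀ (S : SAlgf k) (x : X.obj S) (φ : A ⟶ S), f.app S x = Y.map φ y →
        ∃ β : B ⟶ S, π ≫ β = φ ∧ X.map β b = x := by
  obtain ⟨B, π, b, hπ, hp⟩ := hf A (coyonedaEquiv.symm y)
  refine ⟨B, π, coyonedaEquiv b, hπ, fun S x φ h => ?_⟩
  have hw : (coyonedaEquiv.symm x : SSpf S ⟶ X) ≫ f =
      coyoneda.map φ.op ≫ (coyonedaEquiv.symm y : SSpf A ⟶ Y) := by
    refine coyonedaEquiv.injective ?_
    change f.app S (X.map (𝟙 S) x) = Y.map (φ ≫ 𝟙 S) y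
    rw [map_id_apply', h, Category.comp_id]
  refine ⟨(hp.lift _ _ hw).app S (𝟙 S), ?_, ?_⟩
  · have := congrArg (fun t : SSpf S ⟶ SSpf A => t.app S (𝟙 S)) (hp.lift_snd _ _ hw)
    exact this.trans (Category.comp_id φ)
  · have := congrArg (fun t : SSpf S ⟶ X => t.app S (𝟙 S)) (hp.lift_fst _ _ hw)
    refine Eq.trans ?_ (this.trans (map_id_apply' X x))
    change X.map _ (b.app B (𝟙 B)) = b.app S _
    rw [← app_map]
    exact congrArg (b.app S) (Category.id_comp ((hp.lift _ _ hw).app S (𝟙 S)))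

/-- Only existence of `β` is required: it is unique because `π` is onto, and uniqueness gives
naturality of the lift. -/
theorem isClosedImmersion_of_exists {X Y : FormalFunctor k} {f : X ⟶ Y}
    (h : ∀ (A : SAlgf k) (y : Y.obj A), ∃ (B : SAlgf k) (π : A ⟶ B) (b : X.obj B),
      Function.Surjective (homAlg π) ∧ f.app B b = Y.map π y ∧
      ∀ (S : SAlgf k) (x : X.obj S) (φ : A ⟶ S), f.app S x = Y.map φ y →
        ∃ β : B ⟶ S, π ≫ β = φ ∧ X.map β b = x) : IsClosedImmersion f := by
  intro A a
  obtain ⟨B, π, b, hπ, hb, hl⟩ := h A (coyonedaEquiv a)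
  have ha : ∀ (S : SAlgf k) (φ : A ⟶ S), a.app S φ = Y.map φ (coyonedaEquiv a) := fun S φ => by
    change a.app S φ = Y.map φ (a.app A (𝟙 A))
    rw [← app_map]
    exact congrArg (a.app S) (Category.id_comp φ).symm
  have huniq : ∀ {S : SAlgf k} (β γ : B ⟶ S), π ≫ β = π ≫ γ → β = γ := fun β γ h =>
    SAlgf.hom_ext fun r => by
      obtain ⟨s, rfl⟩ := hπ r
      exact congrArg (fun t => homAlg t s) h
  have hc : ∀ (s : Limits.PullbackCone f a) (S : SAlgf k) (c : s.pt.obj S),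
      f.app S (s.fst.app S c) = Y.map (s.snd.app S c) (coyonedaEquiv a) := fun s S c => by
    rw [← ha]
    exact congrArg (fun t : s.pt ⟶ Y => t.app S c) s.condition
  refine ⟨B, π, coyonedaEquiv.symm b, hπ, ⟨⟨?_⟩, ⟨Limits.PullbackCone.IsLimit.mk _ ?_ ?_ ?_ ?_⟩⟩⟩
  · refine coyonedaEquiv.injective ?_
    change f.app B (X.map (𝟙 B) b) = a.app B (π ≫ 𝟙 B)
    rw [map_id_apply', hb, ha, Category.comp_id]
  · exact fun s =>
      { app S := ↾fun c => (hl S _ _ (hc s S c)).choose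
        naturality {S T} φ := by
          ext c
          refine huniq _ _ ?_
          have h1 := (hl T _ _ (hc s T (s.pt.map φ c))).choose_spec.1
          have h2 := (hl S _ _ (hc s S c)).choose_spec.1
          refine h1.trans ?_
          refine (app_map s.snd φ c).trans ?_
          change s.snd.app S c ≫ φ = π ≫ _ ≫ φ
          rw [← Category.assoc]
          exact congrArg (· ≫ φ) h2.symm }
  · intro s
    ext S c
    exact (hl S _ _ (hc s S c)).choose_spec.2
  · intro s
    ext S c
    exact (hl S _ _ (hc s S c)).choose_spec.1
  · intro s m h1 h2
    ext S c
    refine huniq _ _ ?_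
    refine Eq.trans ?_ (hl S _ _ (hc s S c)).choose_spec.1.symm
    exact congrArg (fun t : s.pt ⟶ SSpf A => t.app S c) h2

/-! ### The finiteness condition on the fibers -/

/-- The dimensions of the minimal square-zero thickenings of `x` in its fiber are bounded. -/
def FiberBoundedAt {X Y : FormalFunctor k} (f : X ⟶ Y) (x : Points X) : Prop :=
  ∃ N : ℕ, ∀ (R : SAlgf k) (a : X.obj R), a ∈ (component X x).obj R → IsMinimal X a →
    f.app R a ∈ (pointSub Y (Points.map f x)).obj R → R.SqZero → Module.finrank k R.carrier ≤ N

theorem SAlgf.even_of_isDomain (K : SAlgf k) [IsDomain K.carrier] (c : K.carrier) :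
    K.inv c = c := by
  have h1 : parityProj K.part 1 c = 0 := by
    have := K.odd_sq _ (parityProj_mem K.part 1 c)
    simpa using this
  rw [SAlgf.inv_apply, parityInv_apply, h1, sub_zero]
  conv_rhs => rw [← parityProj_add K.part c, h1, add_zero]

theorem SAlgf.SqZero.of_injective {R S : SAlgf k} (hR : R.SqZero) (ι : S ⟶ R)
    (hι : Function.Injective (homAlg ι)) : S.SqZero := fun r s hr hs => hι (by
  rw [map_mul, map_zero]
  exact hR _ _ (hr.map (homAlg ι)) (hs.map (homAlg ι)))

variable [NeZero (2 : k)]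

section Fiber

variable {X Y : FormalFunctor k} (P : Pres X) (Q : Pres Y) (f : X ⟶ Y)

theorem map_fiber_point (Q : Pres Y) {y : Points Y} (x' : Points (fiber f y).toFunctor) :
    Points.map f (Points.map (fiber f y).ι x') = y := by
  obtain ⟨R, ⟨a, ha⟩, p, rfl⟩ := x'.exists_mk
  obtain ⟨K, _, η, ψ, hη, h⟩ := (mem_pointSub_iff Q y _).1 ha
  change Points.mk Y R (f.app R a) p = y
  rw [← h, Points.mk_map]
  exact hη _

theorem exists_fiber_point (Q : Pres Y) (x : Points X) :
    ∃ x' : Points (fiber f (Points.map f x)).toFunctor,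
      Points.map (fiber f (Points.map f x)).ι x' = x := by
  obtain ⟨R, a, p, rfl⟩ := x.exists_mk
  obtain ⟨K, _, π, -, hk⟩ := SAlgf.exists_residue p
  have hp : ∀ q, Spec.comap π q = p := fun q =>
    Spec.ext fun r => by rw [SAlgf.comap_eq_ker, hk]
  have hmem : X.map π a ∈ (fiber f (Points.map f (Points.mk X R a p))).obj K := by
    refine (mem_pointSub_iff Q _ _).2 ⟨K, inferInstance, _, 𝟙 K, fun q => ?_, map_id_apply' _ _⟩
    rw [← Points.map_mk, Points.mk_map, hp]
  refine ⟨Points.mk _ K ⟨_, hmem⟩ K.botSpec, ?_⟩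
  change Points.mk X K (X.map π a) K.botSpec = _
  rw [Points.mk_map, hp]

theorem fiber_point_unique (P : Pres X) (Q : Pres Y) {y : Points Y} :
    Function.Injective (Points.map (fiber f y).ι) :=
  (isClosedSub_fiber Q f y).points_injective P

/-- The fiber is a closed subfunctor, so minimality is the same in it and in `X`, and since its
points inject into those of `X`, so are components. -/
theorem boundedAt_fiber_iff (P : Pres X) (Q : Pres Y) {y : Points Y}
    (x' : Points (fiber f y).toFunctor) : BoundedAt (fiber f y).toFunctor x' ↔
      FiberBoundedAt f (Points.map (fiber f y).ι x') := by
  have hG := isClosedSub_fiber Q f y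
  have hcomp : ∀ (R : SAlgf k) (a : (fiber f y).toFunctor.obj R),
      a ∈ (component _ x').obj R ↔ (a.1 : X.obj R) ∈
        (component X (Points.map (fiber f y).ι x')).obj R := fun R a =>
    forall_congr' fun p => (fiber_point_unique f P Q).eq_iff.symm
  constructor
  · rintro ⟨N, hN⟩
    refine ⟨N, fun R a ha hmin hf hsq => ?_⟩
    rw [map_fiber_point f Q] at hf
    exact hN R ⟨a, hf⟩ ((hcomp R _).2 ha) ((hG.isMinimal_iff _).2 hmin) hsq
  · rintro ⟨N, hN⟩
    refine ⟨N, fun R a ha hmin hsq => ?_⟩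
    refine hN R a.1 ((hcomp R _).1 ha) ((hG.isMinimal_iff _).1 hmin) ?_ hsq
    rw [map_fiber_point f Q]
    exact a.2

theorem algebraicAt_fiber_iff (P : Pres X) (Q : Pres Y) {y : Points Y}
    (x' : Points (fiber f y).toFunctor) : AlgebraicAt (fiber f y).toFunctor x' ↔
      FiberBoundedAt f (Points.map (fiber f y).ι x') := by
  obtain ⟨P'⟩ := P.exists_sub (isClosedSub_fiber Q f y)
  rw [algebraicAt_iff _ P', boundedAt_fiber_iff f P Q]

theorem forall_locallyAlgebraic_fiber_iff (P : Pres X) (Q : Pres Y) :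
    (∀ y, LocallyAlgebraic (fiber f y).toFunctor) ↔ ∀ x, FiberBoundedAt f x := by
  constructor
  · intro h x
    obtain ⟨x', hx'⟩ := exists_fiber_point f Q x
    have := (algebraicAt_fiber_iff f P Q x').1 (h _ x')
    rwa [hx'] at this
  · intro h y x'
    exact (algebraicAt_fiber_iff f P Q x').2 (h _)

end Fiber

/-! ### The residue superalgebra of a point -/

/-- One residue algebra serves all `R`: any element of `{z}`, taken at a high enough level, kills
the prime of `z` and factors through the fixed quotient. -/
theorem Pres.exists_residue_elt {Z : FormalFunctor k} (P : Pres Z) (z : Points Z) :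
    ∃ (K : SAlgf k) (_ : IsDomain K.carrier) (η : Z.obj K), η ∈ (component Z z).obj K ∧
      ∀ (R : SAlgf k) (b : Z.obj R), b ∈ (pointSub Z z).obj R → ∃ ψ : K ⟶ R, Z.map ψ η = b := by
  obtain ⟨l, -, p, hp⟩ := P.exists_mk_above z (Classical.arbitrary _)
  obtain ⟨K, hK, π, hπ, hk⟩ := SAlgf.exists_residue p
  refine ⟨K, hK, Z.map π (P.elt l), fun q => ?_, fun R b hb => ?_⟩
  · rw [Points.mk_map, ← hp]
    congr 1
    exact Spec.ext fun r => by rw [SAlgf.comap_eq_ker, hk]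
  · obtain ⟨m, hm, χ, rfl⟩ := P.surj_above b l
    have h := (map_elt_mem_pointSub_iff P ((P.mk_comap_tr hm p).trans hp) χ).1 hb
    obtain ⟨ψ, rfl⟩ := SAlgf.exists_lift_of_surjective (P.tr hm ≫ π)
      (hπ.comp (P.tr_surj hm)) χ fun r hr => h r ((hk _).1 hr)
    refine ⟨ψ, ?_⟩
    rw [map_comp_apply', map_comp_apply', P.map_tr]

/-- The subalgebra generated by the images of two superalgebras, one of which is a domain. -/
theorem SAlgf.exists_compositum {S K R : SAlgf k} [IsDomain K.carrier] (ι : S ⟶ R) (ψ : K ⟶ R) :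
    ∃ (T : SAlgf k) (j : T ⟶ R) (ι' : S ⟶ T) (ψ' : K ⟶ T), ι' ≫ j = ι ∧ ψ' ≫ j = ψ ∧
      Function.Injective (homAlg j) ∧
      Module.finrank k T.carrier ≤ Module.finrank k S.carrier * Module.finrank k K.carrier := by
  -- A domain in this category is purely even, so its image is central and the two images multiply
  -- to an algebra map from the tensor product.
  have hev : ∀ c, homAlg ψ c ∈ R.part 0 := fun c => by
    rw [mem_zero_iff, ← inv_hom, K.even_of_isDomain]
  let F : S.carrier ⊗[k] K.carrier →ₐ[k] R.carrier :=
    Algebra.TensorProduct.lift (homAlg ι) (homAlg ψ) fun s c =>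
      (R.even_mul_comm (hev c) (homAlg ι s)).symm
  have hF : ∀ s c, F (s ⊗ₜ c) = homAlg ι s * homAlg ψ c := fun s c =>
    Algebra.TensorProduct.lift_tmul _ _ _ _ _
  obtain ⟨T, j, hj, hr⟩ := R.exists_sub F.range (by
    rintro _ ⟨t, rfl⟩
    change R.inv (F t) ∈ F.range
    induction t with
    | zero => rw [map_zero, map_zero]; exact zero_mem _
    | add x y hx hy => rw [map_add, map_add]; exact add_mem hx hy
    | tmul s c =>
      refine ⟨S.inv s ⊗ₜ K.inv c, ?_⟩
      change F _ = _
      rw [hF, hF, map_mul, inv_hom, inv_hom])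
  obtain ⟨ι', hι'⟩ := exists_lift_of_injective j hj ι fun s => (hr _).2 ⟨s ⊗ₜ 1, by
    change F _ = _
    rw [hF, map_one, mul_one]⟩
  obtain ⟨ψ', hψ'⟩ := exists_lift_of_injective j hj ψ fun c => (hr _).2 ⟨1 ⊗ₜ c, by
    change F _ = _
    rw [hF, map_one, one_mul]⟩
  refine ⟨T, j, ι', ψ', hι', hψ', hj, ?_⟩
  have h1 : LinearMap.range (homAlg j).toLinearMap ≤ LinearMap.range F.toLinearMap := by
    rintro _ ⟨t, rfl⟩
    exact (hr _).1 ⟨t, rfl⟩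
  rw [← Module.finrank_tensorProduct, ← LinearMap.finrank_range_of_inj (f := (homAlg j).toLinearMap) hj]
  exact (Submodule.finrank_mono h1).trans (LinearMap.finrank_range_le _)

/-- Morphisms that are locally of finite presentation have bounded fibers. -/
theorem fiberBoundedAt_of_lofp {X Y : FormalFunctor k} (Q : Pres Y) {f : X ⟶ Y} (h : LOFP f)
    (x : Points X) : FiberBoundedAt f x := by
  obtain ⟨W, hW, halg, i, hi, rfl⟩ := h
  obtain ⟨PW⟩ := hW.nonempty_pres
  obtain ⟨N, hN⟩ := boundedAt_of_algebraicAt _ PW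
    (halg (Points.map (i ≫ FunctorToTypes.prod.fst) x))
  obtain ⟨K, _, η, -, hη⟩ := Q.exists_residue_elt
    (Points.map (i ≫ FunctorToTypes.prod.snd) x)
  refine ⟨N * Module.finrank k K.carrier, fun R a ha hmin hf hsq => ?_⟩
  obtain ⟨ψ, hψ⟩ := hη R _ hf
  obtain ⟨S, ι, w, hι, hw, hιw⟩ := exists_minimal PW ((i ≫ FunctorToTypes.prod.fst).app R a)
  -- The image in `W` may be defined over a smaller algebra `S`. It stays square-zero, and its
  -- primes lift to `R`, so it is a thickening of the image point of `x`.
  have hS : Module.finrank k S.carrier ≤ N := by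
    refine hN S w (fun p => ?_) hw (hsq.of_injective ι hι)
    obtain ⟨q, rfl⟩ := Spec.exists_comap_eq ι hι p
    rw [← Points.mk_map, hιw, ← Points.map_mk, ha q]
  obtain ⟨T, j, ι', ψ', rfl, rfl, -, hT⟩ := SAlgf.exists_compositum ι ψ
  -- Over the compositum `T` both coordinates of the image of `a` are defined. The closed immersion
  -- gives a quotient `B` of `T` over which `a` is defined, and minimality makes `B → R` onto.
  obtain ⟨B, π, b, hπ, hB⟩ := hi.exists_elt T (show (FunctorToTypes.prod W Y).obj T from
    (W.map ι' w, Y.map ψ' η))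
  obtain ⟨β, -, hβ⟩ := hB R a j (Prod.ext
    (hιw.symm.trans (map_comp_apply' W ι' j w)) (hψ.symm.trans (map_comp_apply' Y ψ' j η)))
  have h1 := LinearMap.finrank_le_finrank_of_surjective (f := (homAlg β).toLinearMap)
    (hmin B β b hβ)
  have h2 := LinearMap.finrank_le_finrank_of_surjective (f := (homAlg π).toLinearMap) hπ
  exact (h1.trans h2).trans (hT.trans (Nat.mul_le_mul_right _ hS))

end
end SuperFormal

namespace SuperFormal

noncomputable section

variable {k : Type u} [Field k]

/-! ### Generation of finite-dimensional superalgebras -/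

/-- Left multiplication by `U` preserves `U + U (I ∩ U²)`: a product of two elements of `U` is an
element of `U` plus an error in `I ∩ U²`, and further errors vanish since `I² = 0`. As `U` generates
and contains 1, this subspace of `U³` is everything. -/
theorem mul_mul_eq_top_of_adjoin {R : Type u} [Ring R] [Algebra k R] {U I : Submodule k R}
    (h1 : 1 ∈ U) (hU : Algebra.adjoin k (U : Set R) = ⊤) (hI : ∀ i ∈ I, ∀ j ∈ I, i * j = 0)
    (hs : U ⊔ I = ⊤) : U * (U * U) = ⊤ := by
  have hUU : U ≤ U * U := fun u hu => by simpa using Submodule.mul_mem_mul h1 hu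
  have split : ∀ r ∈ U, ∀ u ∈ U, ∃ v ∈ U, ∃ i ∈ I ⊓ U * U, r * u = v + i := fun r hr u hu => by
    obtain ⟨v, hv, i, hi, h⟩ := Submodule.mem_sup.1 (hs ▸ Submodule.mem_top : r * u ∈ U ⊔ I)
    refine ⟨v, hv, i, ⟨hi, ?_⟩, h.symm⟩
    rw [← eq_sub_iff_add_eq'] at h
    rw [h]
    exact sub_mem (Submodule.mul_mem_mul hr hu) (hUU hv)
  let T : Submodule k R := U ⊔ U * (I ⊓ U * U)
  have hF : I ⊓ U * U ≤ T := fun i hi => Submodule.mem_sup_right (by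
    simpa using Submodule.mul_mem_mul h1 hi)
  have hT : ∀ r ∈ U, ∀ t ∈ T, r * t ∈ T := by
    intro r hr t ht
    obtain ⟨u, hu, w, hw, rfl⟩ := Submodule.mem_sup.1 ht
    rw [mul_add]
    refine add_mem ?_ (Submodule.mem_sup_right ?_)
    · obtain ⟨v, hv, i, hi, h⟩ := split r hr u hu
      rw [h]
      exact add_mem (Submodule.mem_sup_left hv) (hF hi)
    · clear ht
      induction hw using Submodule.mul_induction_on' with
      | mem_mul_mem u hu f hf =>
        obtain ⟨v, hv, i, hi, h⟩ := split r hr u hu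
        rw [← mul_assoc, h, add_mul, hI i hi.1 f hf.1, add_zero]
        exact Submodule.mul_mem_mul hv hf
      | add x _ y _ hx hy => rw [mul_add]; exact add_mem hx hy
  let D : Subalgebra k R :=
    { carrier := {r | ∀ t ∈ T, r * t ∈ T}
      mul_mem' := fun {a b} ha hb t ht => by rw [mul_assoc]; exact ha _ (hb t ht)
      add_mem' := fun {a b} ha hb t ht => by rw [add_mul]; exact add_mem (ha t ht) (hb t ht)
      algebraMap_mem' := fun c t ht => by
        rw [← Algebra.smul_def]; exact T.smul_mem c ht }
  have hD : D = ⊤ := by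
    rw [← top_le_iff, ← hU]
    exact Algebra.adjoin_le hT
  rw [← top_le_iff]
  intro r _
  have hr : r ∈ D := hD ▸ Algebra.mem_top
  have hrT : r * 1 ∈ T := hr 1 (Submodule.mem_sup_left h1)
  rw [mul_one] at hrT
  refine (sup_le (fun u hu => ?_) (mul_le_mul_right inf_le_right _) : T ≤ U * (U * U)) hrT
  simpa using Submodule.mul_mem_mul h1 (hUU hu)

theorem finrank_mul_le_mul {R : Type u} [Ring R] [Algebra k R] [Module.Finite k R]
    (M N : Submodule k R) : Module.finrank k ↥(M * N) ≤ Module.finrank k M * Module.finrank k N := by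
  rw [← Module.finrank_tensorProduct, ← Submodule.mulMap_range]
  exact LinearMap.finrank_range_le _

namespace SAlgf

theorem exists_lift_of_jointly_injective [NeZero (2 : k)] {T R S A : SAlgf k} (β : T ⟶ R)
    (γ : T ⟶ S) (hinj : ∀ t, homAlg β t = 0 → homAlg γ t = 0 → t = 0) (χ : A ⟶ R) (ξ : A ⟶ S)
    (h : ∀ a, ∃ t, homAlg β t = homAlg χ a ∧ homAlg γ t = homAlg ξ a) :
    ∃ ω : A ⟶ T, ω ≫ β = χ ∧ ω ≫ γ = ξ := by
  have hi : ∀ {s t : T.carrier}, homAlg β s = homAlg β t → homAlg γ s = homAlg γ t → s = t :=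
    fun {s t} h1 h2 => sub_eq_zero.1 (hinj _ (by rw [map_sub, h1, sub_self])
      (by rw [map_sub, h2, sub_self]))
  choose g hg1 hg2 using h
  let ω : A.carrier →ₐ[k] T.carrier :=
    { toFun := g
      map_one' := hi (by rw [hg1, map_one, map_one]) (by rw [hg2, map_one, map_one])
      map_mul' a b := hi (by rw [hg1, map_mul, map_mul, hg1, hg1])
        (by rw [hg2, map_mul, map_mul, hg2, hg2])
      map_zero' := hi (by rw [hg1, map_zero, map_zero]) (by rw [hg2, map_zero, map_zero])
      map_add' a b := hi (by rw [hg1, map_add, map_add, hg1, hg1])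
        (by rw [hg2, map_add, map_add, hg2, hg2])
      commutes' c := hi (by rw [hg1, AlgHom.commutes, AlgHom.commutes])
        (by rw [hg2, AlgHom.commutes, AlgHom.commutes]) }
  refine ⟨homMk ω fun s => hi ?_ ?_, hom_ext hg1, hom_ext hg2⟩
  · change homAlg β (g _) = homAlg β (T.inv (g s))
    rw [hg1, inv_hom, inv_hom, hg1]
  · change homAlg γ (g _) = homAlg γ (T.inv (g s))
    rw [hg2, inv_hom, inv_hom, hg2]

/-- The direct factor of a superalgebra determined by an even idempotent. -/
theorem exists_factor_of_idempotent [NeZero (2 : k)] (A : SAlgf k) {e : A.carrier}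
    (he : e ∈ A.part 0) (hee : e * e = e) : ∃ (R : SAlgf k) (π : A ⟶ R),
      Function.Surjective (homAlg π) ∧ homAlg π e = 1 ∧
      ∀ r s, homAlg π r = homAlg π s → e * r = e * s := by
  have hc := A.even_mul_comm he
  let I : Ideal A.carrier :=
    { carrier := {r | e * r = 0}
      add_mem' := fun {r s} (hr : _ = _) (hs : _ = _) => by
        change e * (r + s) = 0
        rw [mul_add, hr, hs, add_zero]
      zero_mem' := mul_zero e
      smul_mem' := fun r s (hs : _ = _) => by
        change e * (r * s) = 0
        rw [← mul_assoc, hc, mul_assoc, hs, mul_zero] }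
  obtain ⟨R, π, hπ, hk⟩ := A.exists_quot I fun r (hr : _ = _) => by
    change e * A.inv r = 0
    rw [← A.mem_zero_iff.1 he, ← map_mul, hr, map_zero]
  refine ⟨R, π, hπ, ?_, fun r s h => ?_⟩
  · rw [← sub_eq_zero, ← map_one (homAlg π), ← map_sub, hk]
    change e * (e - 1) = 0
    rw [mul_sub, hee, mul_one, sub_self]
  · rw [← sub_eq_zero, ← map_sub, hk] at h
    rw [← sub_eq_zero, ← mul_sub]
    exact h

/-- A version of Nakayama's lemma for subalgebras of a local superalgebra. -/
theorem eq_top_of_forall_sqZero [NeZero (2 : k)] {R : SAlgf k} (hR : ∀ p q : Spec R, p = q)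
    (p : Spec R) {B T : Subalgebra k R.carrier} (hBT : B ≤ T) (hB : ∀ b ∈ B, R.inv b ∈ B)
    (h : ∀ (Q : SAlgf k) (ρ : R ⟶ Q), Function.Surjective (homAlg ρ) → Q.SqZero →
      (∀ b ∈ B, b ∈ p.1 → homAlg ρ b = 0) → ∀ q, ∃ t ∈ T, homAlg ρ t = q) : T = ⊤ := by
  let m := p.sub
  let N : Submodule k R.carrier := m ⊓ Subalgebra.toSubmodule B
  let t := Subalgebra.toSubmodule T
  have hmul : ∀ r, ∀ x ∈ m, r * x ∈ m := fun r x hx => p.1.mul_mem_left r hx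
  -- The quotient by `m² + R (m ∩ B)` is the largest one to which the hypothesis applies.
  let J := idealOf (m * m ⊔ ⊤ * N) fun r x hx => by
    obtain ⟨y, hy, z, hz, rfl⟩ := Submodule.mem_sup.1 hx
    rw [mul_add]
    exact add_mem (Submodule.mem_sup_left (mul_mem_mul_left hmul r hy))
      (Submodule.mem_sup_right (mul_mem_mul_left (fun _ _ _ => Submodule.mem_top) r hz))
  have hmm : m * m ≤ m := Submodule.mul_le.2 fun r _ s hs => hmul r s hs
  have hJm : m * m ⊔ ⊤ * N ≤ m := sup_le hmm (Submodule.mul_le.2 fun r _ s hs => hmul r s hs.1)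
  obtain ⟨Q, ρ, hρ, hk⟩ := R.exists_quot J fun x hx => by
    obtain ⟨y, hy, z, hz, rfl⟩ := Submodule.mem_sup.1 hx
    rw [map_add]
    exact add_mem (S := Submodule k R.carrier) (s := m * m ⊔ ⊤ * N)
      (Submodule.mem_sup_left (inv_mem_mul (fun r hr => p.inv_mem r hr)
        (fun r hr => p.inv_mem r hr) hy))
      (Submodule.mem_sup_right (inv_mem_mul (M := ⊤) (N := N) (fun _ _ => Submodule.mem_top)
        (fun r hr => ⟨p.inv_mem r hr.1, hB r hr.2⟩) hz))
  have hsq : Q.SqZero := by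
    have hn : ∀ r, IsNilpotent (homAlg ρ r) → r ∈ m := fun r ⟨n, hn⟩ => by
      rw [← map_pow, hk] at hn
      have := p.2.2
      exact this.mem_of_pow_mem n (hJm hn)
    intro x y hx hy
    obtain ⟨r, rfl⟩ := hρ x
    obtain ⟨s, rfl⟩ := hρ y
    rw [← map_mul, hk]
    exact Submodule.mem_sup_left (Submodule.mul_mem_mul (hn r hx) (hn s hy))
  have h0 : ∀ r, ∃ s ∈ t, ∃ j ∈ m * m ⊔ ⊤ * N, r = s + j := fun r => by
    obtain ⟨s, hs, hs'⟩ := h Q ρ hρ hsq (fun b hb hbp => (hk b).2 (Submodule.mem_sup_right (by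
      simpa using Submodule.mul_mem_mul (Submodule.mem_top (x := (1 : R.carrier)))
        (show b ∈ N from ⟨hbp, hb⟩)))) (homAlg ρ r)
    refine ⟨s, hs, r - s, (hk _).1 ?_, by abel⟩
    rw [map_sub, hs', sub_self]
  -- Writing `r = s + j` with `s` in `T`, the term `s n` stays in `T` because `B ≤ T`, and `j n`
  -- lies in `m²`. So the contribution of `B` is absorbed and `R = T + m²`.
  have hNt : ⊤ * N ≤ t ⊔ m * m := Submodule.mul_le.2 fun r _ n hn => by
    obtain ⟨s, hs, j, hj, rfl⟩ := h0 r
    rw [add_mul]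
    exact add_mem (Submodule.mem_sup_left (T.mul_mem hs (hBT hn.2)))
      (Submodule.mem_sup_right (Submodule.mul_mem_mul (hJm hj) hn.1))
  have h1 : ∀ r, r ∈ t ⊔ m * m := fun r => by
    obtain ⟨s, hs, j, hj, rfl⟩ := h0 r
    exact add_mem (Submodule.mem_sup_left hs) (sup_le le_sup_right hNt hj)
  -- The exponent is shifted: the claim for `n` is `R = T + m^(n+2)`, starting from `R = T + m²`.
  have hpow : ∀ n : ℕ, ∀ r, r ∈ t ⊔ m ^ (n + 1) * m := by
    intro n
    induction n with
    | zero => simpa using h1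
    | succ n ih =>
      have hle : m ^ (n + 1) * m ≤ m := Submodule.mul_le.2 fun r _ s hs => hmul r s hs
      have hsplit : ∀ r ∈ m, ∃ s ∈ t ⊓ m, ∃ j ∈ m ^ (n + 1) * m, r = s + j := fun r hr => by
        obtain ⟨s, hs, j, hj, rfl⟩ := Submodule.mem_sup.1 (ih r)
        refine ⟨s, ⟨hs, ?_⟩, j, hj, rfl⟩
        have := sub_mem hr (hle hj)
        rwa [add_sub_cancel_right] at this
      have h2 : m * m ≤ t ⊔ m ^ (n + 2) * m := Submodule.mul_le.2 fun a ha b hb => by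
        obtain ⟨s, hs, j, hj, rfl⟩ := hsplit a ha
        obtain ⟨s', hs', j', hj', rfl⟩ := hsplit b hb
        have e : (s + j) * (s' + j') = s * s' + (s * j' + j * (s' + j')) := by noncomm_ring
        rw [e]
        refine add_mem (Submodule.mem_sup_left (T.mul_mem hs.1 hs'.1))
          (Submodule.mem_sup_right (add_mem ?_ ?_))
        · have : m ^ (n + 2) * m = m * (m ^ (n + 1) * m) := by
            rw [← mul_assoc, ← pow_succ']
          rw [this]
          exact Submodule.mul_mem_mul hs.2 hj'
        · rw [pow_succ m (n + 1)]
          exact Submodule.mul_mem_mul hj hb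
      intro r
      obtain ⟨s, hs, j, hj, rfl⟩ := Submodule.mem_sup.1 (h1 r)
      exact add_mem (Submodule.mem_sup_left hs) (h2 hj)
  obtain ⟨n, hn⟩ := Spec.exists_pow_eq_bot hR p
  rw [← top_le_iff]
  intro r _
  have hr := hpow n r
  rw [pow_succ, hn, Submodule.bot_mul, Submodule.bot_mul, sup_bot_eq] at hr
  exact hr

end SAlgf

end
end SuperFormal

namespace SuperFormal

noncomputable section

variable {k : Type u} [Field k]

/-! ### Generators in the fiber direction -/

theorem SAlgf.SqZero.of_jointly_injective {T R S : SAlgf k} (hR : R.SqZero) (hS : S.SqZero)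
    (β : T ⟶ R) (γ : T ⟶ S) (hinj : ∀ t, homAlg β t = 0 → homAlg γ t = 0 → t = 0) : T.SqZero :=
  fun r s hr hs => hinj _
    (by rw [map_mul]; exact hR _ _ (hr.map (homAlg β)) (hs.map (homAlg β)))
    (by rw [map_mul]; exact hS _ _ (hr.map (homAlg γ)) (hs.map (homAlg γ)))

theorem SAlgf.SqZero.of_isDomain (K : SAlgf k) [IsDomain K.carrier] : K.SqZero :=
  fun r s hr _ => by rw [hr.eq_zero, zero_mul]

/-- The ideal of conditions vanishes in `T` once it vanishes in both `R` and `S`. With the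
square-zero analogue, this makes the image of a pair of thickenings a thickening. -/
theorem IsClosedSub.mem_of_jointly_injective {X : FormalFunctor k} {G : Subfunctor X}
    (hG : IsClosedSub G) {T R S : SAlgf k} (β : T ⟶ R) (γ : T ⟶ S)
    (hinj : ∀ t, homAlg β t = 0 → homAlg γ t = 0 → t = 0) {a : X.obj T}
    (h1 : X.map β a ∈ G.obj R) (h2 : X.map γ a ∈ G.obj S) : a ∈ G.obj T := by
  obtain ⟨I, -, hI⟩ := hG T a
  have h := (hI T (𝟙 T)).2 fun r hr => hinj r ((hI R β).1 h1 r hr) ((hI S γ).1 h2 r hr)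
  rwa [map_id_apply'] at h

theorem exists_maximal_of_bounded {p : ℕ → Prop} {N : ℕ} (h0 : ∃ n, p n) (h : ∀ n, p n → n ≤ N) :
    ∃ n, p n ∧ ∀ m, p m → m ≤ n :=
  ⟨sSup {n | p n}, Nat.sSup_mem h0 ⟨N, h⟩, fun _ hm => le_csSup ⟨N, h⟩ hm⟩

theorem SAlgf.injective_of_finrank_le {R S : SAlgf k} (β : R ⟶ S)
    (hβ : Function.Surjective (homAlg β))
    (h : Module.finrank k R.carrier ≤ Module.finrank k S.carrier) :
    Function.Injective (homAlg β) := by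
  have h1 := LinearMap.finrank_le_finrank_of_surjective (f := (homAlg β).toLinearMap) hβ
  exact (LinearMap.injective_iff_surjective_of_finrank_eq_finrank (le_antisymm h h1)
    (f := (homAlg β).toLinearMap)).2 hβ

variable [NeZero (2 : k)]

/-- The image of a superalgebra in a product of two superalgebras. -/
theorem SAlgf.exists_image_pair {A R S : SAlgf k} (π : A ⟶ R) (φ : A ⟶ S) :
    ∃ (B : SAlgf k) (θ : A ⟶ B) (β : B ⟶ R) (γ : B ⟶ S), Function.Surjective (homAlg θ) ∧
      θ ≫ β = π ∧ θ ≫ γ = φ ∧ ∀ b, homAlg β b = 0 → homAlg γ b = 0 → b = 0 := by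
  obtain ⟨B, θ, hθ, hk⟩ := A.exists_quot (SAlgf.ker π ⊓ SAlgf.ker φ) fun r hr =>
    ⟨SAlgf.inv_mem_ker π r hr.1, SAlgf.inv_mem_ker φ r hr.2⟩
  obtain ⟨β, rfl⟩ := SAlgf.exists_lift_of_surjective θ hθ π fun r hr => ((hk r).1 hr).1
  obtain ⟨γ, rfl⟩ := SAlgf.exists_lift_of_surjective θ hθ φ fun r hr => ((hk r).1 hr).2
  refine ⟨B, θ, β, γ, hθ, rfl, rfl, fun b h1 h2 => ?_⟩
  obtain ⟨r, rfl⟩ := hθ b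
  exact (hk r).2 ⟨h1, h2⟩

section

variable {X Y : FormalFunctor k} (P : Pres X) (f : X ⟶ Y)

/-- A quotient of `A_l` defining a square-zero thickening of `x` in its fiber. -/
structure IsFiberThickening (x : Points X) (l : P.Λ) {R : SAlgf k} (π : P.alg l ⟶ R) : Prop where
  surj : Function.Surjective (homAlg π)
  mem_component : X.map π (P.elt l) ∈ (component X x).obj R
  mem_fiber : X.map π (P.elt l) ∈ (fiber f (Points.map f x)).obj R
  sqZero : R.SqZero

theorem isFiberThickening_residue (Q : Pres Y) {x : Points X} {l : P.Λ} {p : Spec (P.alg l)}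
    (hp : Points.mk X _ (P.elt l) p = x) {K : SAlgf k} [IsDomain K.carrier] {π : P.alg l ⟶ K}
    (hπ : Function.Surjective (homAlg π)) (hk : ∀ r, homAlg π r = 0 ↔ r ∈ p.1) :
    IsFiberThickening P f x l π where
  surj := hπ
  mem_component q := by
    rw [Points.mk_map, ← hp]
    congr 1
    exact Spec.ext fun r => by rw [SAlgf.comap_eq_ker, hk]
  mem_fiber := (mem_pointSub_iff Q _ _).2 ⟨K, inferInstance, _, 𝟙 K, fun q => by
    rw [← Points.map_mk, Points.mk_map, ← hp]
    congr 2
    exact Spec.ext fun r => by rw [SAlgf.comap_eq_ker, hk], map_id_apply' _ _⟩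
  sqZero := .of_isDomain K

/-- By the bound there is a fiber thickening `R₀` of maximal dimension. The image of `A_m` in `R₀ ×
R`, for any other thickening `R`, is again a thickening and surjects onto `R₀`, so it is isomorphic
to `R₀`. Hence every thickening is a quotient of `R₀`, and functionals lifting `R₀` suffice for all.
-/
theorem exists_generators (Q : Pres Y) (x : Points X) (h : FiberBoundedAt f x) :
    ∃ V : Submodule k (P.DualLimit →ₗ[k] k), Module.Finite k V ∧ P.limCounit ∈ V ∧
      (∀ α ∈ V, α ∘ₗ P.limInv ∈ V) ∧
      ∀ (l : P.Λ) (R : SAlgf k) (π : P.alg l ⟶ R), IsFiberThickening P f x l π →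
        ∀ r, ∃ α ∈ V, homAlg π (P.ev l α) = r := by
  obtain ⟨N, hN⟩ := h
  obtain ⟨_, ⟨l₀, R₀, π₀, h₀, rfl⟩, hmax⟩ := exists_maximal_of_bounded (N := N)
    (p := fun n => ∃ (l : P.Λ) (R : SAlgf k) (π : P.alg l ⟶ R),
      IsFiberThickening P f x l π ∧ Module.finrank k R.carrier = n)
    (by
      obtain ⟨l, -, p, hp⟩ := P.exists_mk_above x (Classical.arbitrary _)
      obtain ⟨K, _, π, hπ, hk⟩ := SAlgf.exists_residue p
      exact ⟨_, l, K, π, isFiberThickening_residue P f Q hp hπ hk, rfl⟩)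
    (by
      rintro _ ⟨l, R, π, h, rfl⟩
      exact hN R _ h.mem_component (P.isMinimal_map π h.surj) h.mem_fiber h.sqZero)
  obtain ⟨g, hg⟩ := ((homAlg π₀).toLinearMap ∘ₗ P.ev l₀).exists_rightInverse_of_surjective
    (LinearMap.range_eq_top.2 (h₀.surj.comp (P.ev_surjective l₀)))
  let τ : (P.DualLimit →ₗ[k] k) →ₗ[k] (P.DualLimit →ₗ[k] k) := P.limInv.dualMap
  have hτ : ∀ α, τ (τ α) = α := fun α =>
    LinearMap.ext fun d => congrArg α (P.limInv_limInv d)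
  let V₀ : Submodule k (P.DualLimit →ₗ[k] k) := LinearMap.range g ⊔ k ∙ P.limCounit
  -- The counit is added so that the idempotents of points belong to the generated subalgebras, and
  -- the image under `τ` so that these are parity-stable.
  refine ⟨V₀ ⊔ V₀.map τ, inferInstance, ?_, fun α hα => ?_, fun l R π h r => ?_⟩
  · exact Submodule.mem_sup_left (Submodule.mem_sup_right (Submodule.mem_span_singleton_self _))
  · obtain ⟨β, hβ, _, ⟨γ, hγ, rfl⟩, rfl⟩ := Submodule.mem_sup.1 hα
    change τ (β + τ γ) ∈ _
    rw [map_add, hτ]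
    exact add_mem (Submodule.mem_sup_right ⟨β, hβ, rfl⟩) (Submodule.mem_sup_left hγ)
  · obtain ⟨m, hl₀, hl⟩ := exists_ge_ge l₀ l
    obtain ⟨R₁, θ, β, γ, hθ, hβ, hγ, hinj⟩ :=
      SAlgf.exists_image_pair (P.tr hl₀ ≫ π₀) (P.tr hl ≫ π)
    have e1 : X.map β (X.map θ (P.elt m)) = X.map π₀ (P.elt l₀) := by
      rw [← map_comp_apply', hβ, map_comp_apply', P.map_tr]
    have e2 : X.map γ (X.map θ (P.elt m)) = X.map π (P.elt l) := by
      rw [← map_comp_apply', hγ, map_comp_apply', P.map_tr]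
    have h₁ : IsFiberThickening P f x m θ :=
      { surj := hθ
        mem_component := (isClosedSub_component X x).mem_of_jointly_injective β γ hinj
          (e1 ▸ h₀.mem_component) (e2 ▸ h.mem_component)
        mem_fiber := (isClosedSub_fiber Q f _).mem_of_jointly_injective β γ hinj
          (e1 ▸ h₀.mem_fiber) (e2 ▸ h.mem_fiber)
        sqZero := h₀.sqZero.of_jointly_injective h.sqZero β γ hinj }
    have hβs : Function.Surjective (homAlg β) := fun r => by
      obtain ⟨s, rfl⟩ := h₀.surj r
      obtain ⟨t, rfl⟩ := P.tr_surj hl₀ s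
      exact ⟨homAlg θ t, congrArg (fun φ => homAlg φ t) hβ⟩
    have hβi := SAlgf.injective_of_finrank_le β hβs (hmax _ ⟨m, R₁, θ, h₁, rfl⟩)
    obtain ⟨s, rfl⟩ := h.surj r
    obtain ⟨t, rfl⟩ := P.tr_surj hl s
    refine ⟨g (homAlg β (homAlg θ t)),
      Submodule.mem_sup_left (Submodule.mem_sup_left ⟨_, rfl⟩), ?_⟩
    have key : homAlg θ (P.ev m (g (homAlg β (homAlg θ t)))) = homAlg θ t := hβi (by
      have e3 : homAlg π₀ (P.ev l₀ (g (homAlg β (homAlg θ t)))) = homAlg β (homAlg θ t) :=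
        LinearMap.congr_fun hg _
      rw [← SAlgf.homAlg_comp θ β, hβ, SAlgf.homAlg_comp, P.tr_ev, e3])
    have key2 := congrArg (homAlg γ) key
    rw [← SAlgf.homAlg_comp θ γ, hγ, SAlgf.homAlg_comp, P.tr_ev] at key2
    exact key2.trans (congrArg (fun φ => homAlg φ t) hγ)

end

end
end SuperFormal

namespace SuperFormal

noncomputable section

variable {k : Type u} [Field k]

/-! ### Subalgebras generated in the fiber directions -/

theorem Pres.eq_of_subsingleton {Z : FormalFunctor k} (P : Pres Z) {R : SAlgf k}
    [Subsingleton R.carrier] (a b : Z.obj R) : a = b := by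
  obtain ⟨l, φ, rfl⟩ := P.surj a
  obtain ⟨m, h, ψ, rfl⟩ := P.surj_above b l
  rw [← P.map_tr h, ← map_comp_apply', SAlgf.hom_ext (φ := P.tr h ≫ φ) (ψ := ψ)
    fun r => Subsingleton.elim _ _]

variable {X : FormalFunctor k} (P : Pres X)
  (V : Points X → Submodule k (P.DualLimit →ₗ[k] k))

/-- The subalgebra of `A_l` generated by families of functionals supported at the points. -/
def genSub (l : P.Λ) : Subalgebra k (P.alg l).carrier :=
  Algebra.adjoin k {r | ∃ x, ∃ α ∈ V x, pointIdem X (P.elt l) x * P.ev l α = r}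

variable {V}

theorem mul_ev_mem_genSub (l : P.Λ) {x : Points X} {α : P.DualLimit →ₗ[k] k} (hα : α ∈ V x) :
    pointIdem X (P.elt l) x * P.ev l α ∈ genSub P V l :=
  Algebra.subset_adjoin ⟨x, α, hα, rfl⟩

theorem pointIdem_mem_genSub (hV : ∀ x, P.limCounit ∈ V x) (l : P.Λ) (x : Points X) :
    pointIdem X (P.elt l) x ∈ genSub P V l := by
  have := mul_ev_mem_genSub P l (hV x)
  rwa [P.ev_limCounit, mul_one] at this

/-- Both idempotents and evaluations are compatible with transition maps, so the same generators
work at every level. -/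
theorem map_tr_genSub {l m : P.Λ} (h : l ≤ m) :
    (genSub P V m).map (homAlg (P.tr h)) = genSub P V l := by
  rw [genSub, AlgHom.map_adjoin, genSub]
  have key : ∀ x α, homAlg (P.tr h) (pointIdem X (P.elt m) x * P.ev m α) =
      pointIdem X (P.elt l) x * P.ev l α := fun x α => by
    rw [map_mul, pointIdem_map, P.map_tr, P.tr_ev]
  congr 1
  ext r
  constructor
  · rintro ⟨_, ⟨x, α, hα, rfl⟩, rfl⟩
    exact ⟨x, α, hα, (key x α).symm⟩
  · rintro ⟨x, α, hα, rfl⟩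
    exact ⟨_, ⟨x, α, hα, rfl⟩, key x α⟩

variable [NeZero (2 : k)]

theorem inv_mem_genSub (hV : ∀ x, ∀ α ∈ V x, α ∘ₗ P.limInv ∈ V x) (l : P.Λ)
    (r : (P.alg l).carrier) (hr : r ∈ genSub P V l) : (P.alg l).inv r ∈ genSub P V l := by
  have : genSub P V l ≤ (genSub P V l).comap (P.alg l).inv := Algebra.adjoin_le (by
    rintro _ ⟨x, α, hα, rfl⟩
    change (P.alg l).inv _ ∈ genSub P V l
    rw [map_mul, SAlgf.mem_zero_iff _ |>.1 (pointIdem_even _ _ _), ← P.ev_limInv]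
    exact mul_ev_mem_genSub P l (hV x α hα))
  exact this hr

section

variable {Y : FormalFunctor k} (f : X ⟶ Y)

/-- The subalgebra generated by functionals spanning the square-zero thickenings in the fibers
generates `A_l` over the base. -/
theorem eq_top_of_genSub_le (Q : Pres Y) (hV : ∀ x, P.limCounit ∈ V x)
    (hgen : ∀ (x : Points X) (l : P.Λ) (R : SAlgf k) (π : P.alg l ⟶ R),
      IsFiberThickening P f x l π → ∀ r, ∃ α ∈ V x, homAlg π (P.ev l α) = r)
    {l : P.Λ} {n : Q.Λ} (θ : Q.alg n ⟶ P.alg l) (hθ : f.app _ (P.elt l) = Y.map θ (Q.elt n))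
    {D : Subalgebra k (P.alg l).carrier} (h1 : genSub P V l ≤ D) (h2 : ∀ r, homAlg θ r ∈ D) :
    D = ⊤ := by
  have key : ∀ (x : Points X) (a : (P.alg l).carrier), pointIdem X (P.elt l) x * a ∈ D := by
    intro x a
    have he := h1 (pointIdem_mem_genSub P hV l x)
    obtain ⟨R, π, hπ, hπe, hker⟩ := (P.alg l).exists_factor_of_idempotent
      (pointIdem_even X (P.elt l) x) (pointIdem_mul_self X (P.elt l) x)
    have hcomp : X.map π (P.elt l) ∈ (component X x).obj R := by
      rw [mem_component_iff, ← pointIdem_map, hπe]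
    have hT : D.map (homAlg π) = ⊤ := by
      by_cases hR : Nontrivial R.carrier
      swap
      · rw [not_nontrivial_iff_subsingleton] at hR
        exact Subsingleton.elim _ _
      obtain ⟨p⟩ := Spec.nonempty_of_nontrivial (R := R)
      -- Nakayama is applied in the local factor at `x` with the image of the base algebra as `B`. A
      -- square-zero quotient killing the base elements in `p` is exactly one lying in the fiber, so
      -- `V x` spans it.
      refine SAlgf.eq_top_of_forall_sqZero
        (P.spec_eq_of_mem_component hcomp (P.isMinimal_map π hπ)) p
        (B := (homAlg (θ ≫ π)).range) ?_ ?_ fun S ρ hρ hS hb q => ?_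
      · rintro _ ⟨r, rfl⟩
        exact ⟨homAlg θ r, h2 r, rfl⟩
      · rintro _ ⟨r, rfl⟩
        exact ⟨_, SAlgf.inv_hom _ r⟩
      · have hfib : IsFiberThickening P f x l (π ≫ ρ) :=
          { surj := hρ.comp hπ
            mem_component := by
              rw [map_comp_apply']
              exact (component X x).map ρ hcomp
            mem_fiber := by
              change f.app S (X.map (π ≫ ρ) (P.elt l)) ∈ (pointSub Y _).obj S
              rw [app_map, hθ, ← map_comp_apply',
                map_elt_mem_pointSub_iff Q (p := Spec.comap (θ ≫ π) p)]
              · exact fun r hr => hb _ ⟨r, rfl⟩ hr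
              · rw [← Points.mk_map, map_comp_apply', ← hθ, ← app_map, ← Points.map_mk, hcomp p]
            sqZero := hS }
        obtain ⟨α, hα, h⟩ := hgen x l S _ hfib q
        refine ⟨_, ⟨_, h1 (mul_ev_mem_genSub P l hα), rfl⟩, ?_⟩
        change homAlg ρ (homAlg π _) = q
        rw [map_mul, hπe, one_mul]
        exact h
    obtain ⟨d, hd, hda⟩ : homAlg π a ∈ D.map (homAlg π) := hT ▸ Algebra.mem_top
    rw [hker a d hda.symm]
    exact mul_mem he hd
  -- The idempotents generate the unit ideal, because a prime containing all of them would contain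
  -- the idempotent of its own point. So the local factors control all of `A_l`.
  let E : Set (P.alg l).carrier := Set.range (pointIdem X (P.elt l))
  have hE : Ideal.span E = ⊤ := by
    by_contra hne
    have hinv : Ideal.span E ≤ (Ideal.span E).comap (P.alg l).inv := Ideal.span_le.2 (by
      rintro _ ⟨x, rfl⟩
      change (P.alg l).inv _ ∈ Ideal.span E
      rw [SAlgf.mem_zero_iff _ |>.1 (pointIdem_even _ _ _)]
      exact Ideal.subset_span ⟨x, rfl⟩)
    obtain ⟨p, hp⟩ := Spec.exists_le
      (fun r hr => SAlgf.proj_mem _ (I := Ideal.span E) (fun r hr => hinv hr) hr) hne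
    exact (pointIdem_mem_iff X (P.elt l) _ p).1 (hp (Ideal.subset_span ⟨_, rfl⟩)) rfl
  have h3 : ∀ s ∈ Ideal.span E, ∀ a b, a * s * b ∈ D := fun s hs => by
    induction hs using Submodule.span_induction with
    | mem s hs =>
      obtain ⟨x, rfl⟩ := hs
      intro a b
      rw [← SAlgf.even_mul_comm _ (pointIdem_even X (P.elt l) x), mul_assoc]
      exact key x _
    | zero => intro a b; simp
    | add s t _ _ hs ht => intro a b; rw [mul_add, add_mul]; exact add_mem (hs a b) (ht a b)
    | smul r s _ hs =>
      intro a b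
      rw [smul_eq_mul, ← mul_assoc]
      exact hs (a * r) b
  refine eq_top_iff.2 fun a _ => ?_
  have := h3 1 (hE ▸ Submodule.mem_top) 1 a
  rwa [one_mul, one_mul] at this

end

end
end SuperFormal

namespace SuperFormal

noncomputable section

variable {k : Type u} [Field k]

/-! ### The formal superscheme of the generated subalgebras -/

section

variable {X : FormalFunctor k} (P : Pres X) (V : Points X → Submodule k (P.DualLimit →ₗ[k] k))

/-- The formal superscheme presented by the subalgebras `genSub P V l`. -/
structure Envelope where
  W : FormalFunctor k
  isFormal : IsFormalSuperscheme W
  alg : P.Λ → SAlgf k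
  ι : ∀ l, alg l ⟶ P.alg l
  ι_injective : ∀ l, Function.Injective (homAlg (ι l))
  mem_range_iff : ∀ l r, (∃ c, homAlg (ι l) c = r) ↔ r ∈ genSub P V l
  tr : ∀ {l m : P.Λ}, l ≤ m → (alg m ⟶ alg l)
  tr_surj : ∀ {l m : P.Λ} (h : l ≤ m), Function.Surjective (homAlg (tr h))
  tr_comp_ι : ∀ {l m : P.Λ} (h : l ≤ m), tr h ≫ ι l = ι m ≫ P.tr h
  elt : ∀ l, W.obj (alg l)
  map_tr : ∀ {l m : P.Λ} (h : l ≤ m), W.map (tr h) (elt m) = elt l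
  inj : ∀ (l : P.Λ) {S : SAlgf k} (φ ψ : alg l ⟶ S), W.map φ (elt l) = W.map ψ (elt l) → φ = ψ
  surj : ∀ {S : SAlgf k} (a : W.obj S), ∃ (l : P.Λ) (φ : alg l ⟶ S), W.map φ (elt l) = a

variable {P V}

/-- The generated subalgebras are parity-stable and map onto each other by `map_tr_genSub`, so they
form a system with surjective transition maps, as a formal superscheme requires. -/
theorem nonempty_envelope [NeZero (2 : k)] (hV : ∀ x, ∀ α ∈ V x, α ∘ₗ P.limInv ∈ V x) :
    Nonempty (Envelope P V) := by
  choose C ι hι hr using fun l => SAlgf.exists_sub (P.alg l) (genSub P V l) (inv_mem_genSub P hV l)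
  have ht : ∀ {l m : P.Λ} (h : l ≤ m), ∃ t : C m ⟶ C l, t ≫ ι l = ι m ≫ P.tr h := fun {l m} h =>
    SAlgf.exists_lift_of_injective (ι l) (hι l) _ fun s => (hr l _).2 (by
      rw [← map_tr_genSub P h]
      exact ⟨_, (hr m _).1 ⟨s, rfl⟩, rfl⟩)
  choose t ht using @ht
  have cancel : ∀ (l : P.Λ) (R : SAlgf k) (φ ψ : R ⟶ C l), φ ≫ ι l = ψ ≫ ι l → φ = ψ :=
    fun l R φ ψ h => SAlgf.hom_ext fun r => hι l (congrArg (fun χ => homAlg χ r) h)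
  let A : P.Λ ⥤ (SAlgf k)ᵒᵖ :=
    { obj := fun l => op (C l)
      map := fun h => (t h.le).op
      map_id := fun l => congrArg Quiver.Hom.op (cancel l _ (t (le_refl l)) (𝟙 _) (by
        rw [ht, P.tr_self, Category.comp_id, Category.id_comp]))
      map_comp := fun {l m n} h h' => congrArg Quiver.Hom.op
        (cancel l _ (t (h.le.trans h'.le)) (t h'.le ≫ t h.le) (by
          rw [ht, Category.assoc, ht, ← Category.assoc, ht, Category.assoc, P.tr_comp])) }
  have hs : ∀ {l m : P.Λ} (h : l ≤ m), Function.Surjective (homAlg (t h)) := fun {l m} h c => by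
    have : homAlg (ι l) c ∈ (genSub P V m).map (homAlg (P.tr h)) := by
      rw [map_tr_genSub P h]
      exact (hr l _).1 ⟨c, rfl⟩
    obtain ⟨r, hr', hc⟩ := this
    obtain ⟨d, rfl⟩ := (hr m r).2 hr'
    exact ⟨d, hι l ((congrArg (fun χ => homAlg χ d) (ht h)).trans hc)⟩
  have hA : ∀ (l m : P.Λ) (h : l ⟶ m), Function.Surjective (homAlg (A.map h).unop) :=
    fun l m h => hs h.le
  let PW := Pres.ofColimit A hA
  exact ⟨{ W := _
           isFormal := ⟨P.Λ, _, inferInstance, inferInstance, A, hA, ⟨Iso.refl _⟩⟩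
           alg := C
           ι := ι
           ι_injective := hι
           mem_range_iff := hr
           tr := t
           tr_surj := hs
           tr_comp_ι := ht
           elt := PW.elt
           map_tr := fun h => PW.map_tr h
           inj := PW.inj
           surj := PW.surj }⟩

namespace Envelope

variable (E : Envelope P V)

/-- The presentation of an envelope. -/
def pres : Pres E.W where
  Λ := P.Λ
  alg := E.alg
  tr := E.tr
  tr_surj := E.tr_surj
  elt := E.elt
  map_tr := E.map_tr
  inj := E.inj
  surj := E.surj

theorem exists_mk (w : Points E.W) :
    ∃ (l : P.Λ) (q : Spec (E.alg l)), Points.mk E.W _ (E.elt l) q = w :=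
  let ⟨l, _, q, h⟩ := E.pres.exists_mk_above w (Classical.arbitrary _)
  ⟨l, q, h⟩

theorem surj_above {S : SAlgf k} (a : E.W.obj S) (l₀ : P.Λ) :
    ∃ (l : P.Λ) (_ : l₀ ≤ l) (φ : E.alg l ⟶ S), E.W.map φ (E.elt l) = a :=
  E.pres.surj_above a l₀

theorem mk_injective (l : P.Λ) : Function.Injective (Points.mk E.W _ (E.elt l)) :=
  E.pres.mk_injective l

theorem mk_comap_tr {l m : P.Λ} (h : l ≤ m) (q : Spec (E.alg l)) :
    Points.mk E.W _ (E.elt m) (Spec.comap (E.tr h) q) = Points.mk E.W _ (E.elt l) q :=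
  E.pres.mk_comap_tr h q

/-- The canonical morphism to the envelope. -/
def desc : X ⟶ E.W :=
  P.desc (fun l => E.W.map (E.ι l) (E.elt l)) fun {l m} h => by
    rw [← map_comp_apply', ← E.tr_comp_ι, map_comp_apply', E.map_tr]

theorem desc_elt (l : P.Λ) : E.desc.app _ (P.elt l) = E.W.map (E.ι l) (E.elt l) :=
  P.desc_elt (fun l => E.W.map (E.ι l) (E.elt l)) (fun {l m} h => by
    rw [← map_comp_apply', ← E.tr_comp_ι, map_comp_apply', E.map_tr]) l

theorem exists_ι_eq (l : P.Λ) {r : (P.alg l).carrier} (hr : r ∈ genSub P V l) :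
    ∃ c, homAlg (E.ι l) c = r := (E.mem_range_iff l r).2 hr

end Envelope

end

/-! ### The envelope is locally algebraic and contains `X` over `Y` -/

section

variable [NeZero (2 : k)] {X Y : FormalFunctor k} {P : Pres X}
  {V : Points X → Submodule k (P.DualLimit →ₗ[k] k)} (E : Envelope P V) (f : X ⟶ Y)

namespace Envelope

/-- At a point under `x`, a minimal square-zero thickening is generated by the image `U` of `V x`,
and `U` spans it modulo the square-zero nilradical since `V x` spans the residue algebra of `x`. By
`mul_mul_eq_top_of_adjoin` it equals `U³`, so its dimension is at most the cube of that of `V x`. -/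
theorem locallyAlgebraic (Q : Pres Y) (hfin : ∀ x, Module.Finite k (V x))
    (hV : ∀ x, P.limCounit ∈ V x)
    (hgen : ∀ (x : Points X) (l : P.Λ) (R : SAlgf k) (π : P.alg l ⟶ R),
      IsFiberThickening P f x l π → ∀ r, ∃ α ∈ V x, homAlg π (P.ev l α) = r) :
    LocallyAlgebraic E.W := by
  intro w
  obtain ⟨l, q, hq⟩ := E.exists_mk w
  -- Subalgebras are injective, so each prime of the envelope lifts to a prime of `A_l`; its point
  -- `x` decides which `V x` is relevant.
  obtain ⟨p, hp⟩ := Spec.exists_comap_eq (E.ι l) (E.ι_injective l) q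
  obtain ⟨x, hx⟩ : ∃ x, Points.mk X _ (P.elt l) p = x := ⟨_, rfl⟩
  refine algebraicAt_of_boundedAt w E.pres
    ⟨Module.finrank k (V x) * (Module.finrank k (V x) * Module.finrank k (V x)), ?_⟩
  intro R a ha hmin hsq
  by_cases hR : Nontrivial R.carrier
  swap
  · rw [not_nontrivial_iff_subsingleton] at hR
    rw [Module.finrank_zero_of_subsingleton]
    exact Nat.zero_le _
  obtain ⟨q'⟩ := Spec.nonempty_of_nontrivial (R := R)
  have hone := E.pres.spec_eq_of_mem_component ha hmin
  obtain ⟨m, hm, φ, rfl⟩ := E.surj_above a l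
  have hφ : Function.Surjective (homAlg φ) := hmin _ φ _ rfl
  set p' := Spec.comap (P.tr hm) p with hp'
  have hx' : Points.mk X _ (P.elt m) p' = x := by rw [hp', P.mk_comap_tr, hx]
  have hcomap : Spec.comap φ q' = Spec.comap (E.ι m) p' := by
    rw [hp', ← Spec.comap_comp, ← E.tr_comp_ι, Spec.comap_comp, hp]
    refine E.mk_injective m ?_
    rw [← Points.mk_map, ha q', ← hq, E.mk_comap_tr]
  have hmem : ∀ c : (E.alg m).carrier, homAlg φ c ∈ q'.1 ↔ homAlg (E.ι m) c ∈ p'.1 := fun c =>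
    Set.ext_iff.1 (congrArg (fun q => (q.1 : Set (E.alg m).carrier)) hcomap) c
  obtain ⟨K, _, π, hπ, hπk⟩ := SAlgf.exists_residue p'
  have hth := isFiberThickening_residue P f Q hx' hπ hπk
  have hπe : homAlg π (pointIdem X (P.elt m) x) = 1 := by
    rw [pointIdem_map]
    exact (mem_component_iff _ _ _).1 hth.mem_component
  choose c hc using fun y => E.exists_ι_eq m (pointIdem_mem_genSub P hV m y)
  have hcc : ∀ y, c y * c y = c y := fun y => E.ι_injective m (by
    rw [map_mul, hc, pointIdem_mul_self])
  have hφc : ∀ y, homAlg φ (c y) * homAlg φ (c y) = homAlg φ (c y) := fun y => by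
    rw [← map_mul, hcc]
  have hcx : homAlg φ (c x) = 1 := Spec.isIdempotentElem_eq_one (hφc x) fun q'' => by
    rw [hone q'' q', hmem, hc, pointIdem_mem_iff, not_not, hx']
  -- Generators attached to other points vanish in `R`, because their idempotents do.
  have hcy : ∀ y, y ≠ x → homAlg φ (c y) = 0 := fun y hy =>
    Spec.isIdempotentElem_eq_zero (hφc y) fun q'' => by
      rw [hone q'' q', hmem, hc, pointIdem_mem_iff, hx']
      exact hy.symm
  obtain ⟨g, hg⟩ := (homAlg (E.ι m)).toLinearMap.exists_leftInverse_of_injective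
    (LinearMap.ker_eq_bot.2 (E.ι_injective m))
  have hg' : ∀ d, g (homAlg (E.ι m) d) = d := fun d => LinearMap.congr_fun hg d
  -- The linear retraction `g` only serves to make the assignment `α ↦ φ(e_x α)` a linear map on all
  -- functionals.
  let L : (P.DualLimit →ₗ[k] k) →ₗ[k] R.carrier := (homAlg φ).toLinearMap ∘ₗ g ∘ₗ
    LinearMap.mulLeft k (pointIdem X (P.elt m) x) ∘ₗ P.ev m
  have hL : ∀ α d, homAlg (E.ι m) d = pointIdem X (P.elt m) x * P.ev m α → L α = homAlg φ d :=
    fun α d h => by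
      change homAlg φ (g (pointIdem X (P.elt m) x * P.ev m α)) = _
      rw [← h, hg']
  have hbound : Module.finrank k ((V x).map L) ≤ Module.finrank k (V x) :=
    have := hfin x
    Submodule.finrank_map_le L (V x)
  have htop : (V x).map L * ((V x).map L * (V x).map L) = ⊤ := by
    refine mul_mul_eq_top_of_adjoin (I := q'.1.restrictScalars k) ?_ ?_ ?_ ?_
    · refine ⟨_, hV x, ?_⟩
      rw [hL _ (c x) (by rw [hc, P.ev_limCounit, mul_one]), hcx]
    · have hle : genSub P V m ≤ ((Algebra.adjoin k ((V x).map L : Set R.carrier)).comap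
          (homAlg φ)).map (homAlg (E.ι m)) := Algebra.adjoin_le (by
        rintro _ ⟨y, α, hα, rfl⟩
        obtain ⟨d, hd⟩ := E.exists_ι_eq m (mul_ev_mem_genSub P m hα)
        refine ⟨d, ?_, hd⟩
        change homAlg φ d ∈ Algebra.adjoin k _
        by_cases hy : y = x
        · subst hy
          rw [← hL α d hd]
          exact Algebra.subset_adjoin ⟨α, hα, rfl⟩
        · have : d = c y * d := E.ι_injective m (by
            rw [map_mul, hd, hc, ← mul_assoc, pointIdem_mul_self])
          rw [this, map_mul, hcy y hy, zero_mul]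
          exact zero_mem _)
      refine eq_top_iff.2 fun r _ => ?_
      obtain ⟨d, rfl⟩ := hφ r
      obtain ⟨d', hd', h⟩ := hle ((E.mem_range_iff m _).1 ⟨d, rfl⟩)
      rw [← E.ι_injective m h]
      exact hd'
    · intro i hi j hj
      exact hsq i j ((Spec.mem_iff_isNilpotent hone q' i).1 hi)
        ((Spec.mem_iff_isNilpotent hone q' j).1 hj)
    · refine eq_top_iff.2 fun r _ => ?_
      obtain ⟨d, rfl⟩ := hφ r
      obtain ⟨α, hα, h⟩ := hgen x m K π hth (homAlg π (homAlg (E.ι m) d))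
      obtain ⟨d', hd'⟩ := E.exists_ι_eq m (mul_ev_mem_genSub P m hα)
      refine Submodule.mem_sup.2 ⟨_, ⟨α, hα, hL α d' hd'⟩, homAlg φ (d - d'), ?_, ?_⟩
      · change homAlg φ (d - d') ∈ q'.1
        rw [hmem, ← hπk, map_sub, map_sub, hd', map_mul, hπe, one_mul, h, sub_self]
      · rw [map_sub, add_sub_cancel]
  calc Module.finrank k R.carrier
      = Module.finrank k ↥((V x).map L * ((V x).map L * (V x).map L)) := by
        rw [htop, finrank_top]
    _ ≤ _ := (finrank_mul_le_mul _ _).trans (Nat.mul_le_mul hbound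
        ((finrank_mul_le_mul _ _).trans (Nat.mul_le_mul hbound hbound)))

/-- The required quotient of `A` is one of maximal dimension among those over which `(w, y)` lifts
to `X`. A further lift over `S` can be glued with it over the image of `A` in the product, and
maximality shows that gluing adds nothing. -/
theorem isClosedImmersion (Q : Pres Y) (hV : ∀ x, P.limCounit ∈ V x)
    (hgen : ∀ (x : Points X) (l : P.Λ) (R : SAlgf k) (π : P.alg l ⟶ R),
      IsFiberThickening P f x l π → ∀ r, ∃ α ∈ V x, homAlg π (P.ev l α) = r) :
    IsClosedImmersion (FunctorToTypes.prod.lift E.desc f) := by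
  refine isClosedImmersion_of_exists ?_
  rintro A ⟨w, y⟩
  let Good : (B : SAlgf k) → (A ⟶ B) → X.obj B → Prop := fun B π b =>
    Function.Surjective (homAlg π) ∧ E.desc.app B b = E.W.map π w ∧ f.app B b = Y.map π y
  obtain ⟨_, ⟨B, π, b, ⟨hπ, hbw, hby⟩, rfl⟩, hmax⟩ := exists_maximal_of_bounded
    (N := Module.finrank k A.carrier)
    (p := fun n => ∃ B π b, Good B π b ∧ Module.finrank k B.carrier = n)
    (by
      -- The zero algebra is always a candidate, since any two elements over it agree.
      obtain ⟨B, π, hπ, hk⟩ := A.exists_quot ⊤ fun r _ => Submodule.mem_top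
      have : Subsingleton B.carrier := subsingleton_of_zero_eq_one (by
        rw [← map_one (homAlg π)]; exact ((hk 1).2 Submodule.mem_top).symm)
      obtain ⟨l⟩ := P.nonempty
      let ζ : P.alg l ⟶ B := SAlgf.homMk
        { toFun := fun _ => 0
          map_one' := Subsingleton.elim _ _
          map_mul' := fun _ _ => Subsingleton.elim _ _
          map_zero' := rfl
          map_add' := fun _ _ => Subsingleton.elim _ _
          commutes' := fun _ => Subsingleton.elim _ _ } fun r => Subsingleton.elim _ _
      exact ⟨_, B, π, X.map ζ (P.elt l), ⟨hπ, E.pres.eq_of_subsingleton _ _,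
        Q.eq_of_subsingleton _ _⟩, rfl⟩)
    (by
      rintro _ ⟨B, π, b, ⟨hπ, -⟩, rfl⟩
      exact LinearMap.finrank_le_finrank_of_surjective (f := (homAlg π).toLinearMap) hπ)
  refine ⟨B, π, b, hπ, Prod.ext hbw hby, fun S x φ hx => ?_⟩
  have hxw : E.desc.app S x = E.W.map φ w := congrArg Prod.fst hx
  have hxy : f.app S x = Y.map φ y := congrArg Prod.snd hx
  clear hx
  obtain ⟨B₁, θ₁, β₁, γ₁, hθ₁, rfl, rfl, hinj⟩ := SAlgf.exists_image_pair π φ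
  obtain ⟨l₀, γ₀, rfl⟩ := E.surj w
  obtain ⟨l₁, h₁, χ₁, rfl⟩ := P.surj_above b l₀
  obtain ⟨l, h, χ', rfl⟩ := P.surj_above x l₁
  obtain ⟨χ, hχ⟩ : ∃ χ, χ = P.tr h ≫ χ₁ := ⟨_, rfl⟩
  obtain ⟨γ, hγ⟩ : ∃ γ, γ = E.tr (h₁.trans h) ≫ γ₀ := ⟨_, rfl⟩
  have hb : X.map χ₁ (P.elt l₁) = X.map χ (P.elt l) := by rw [hχ, map_comp_apply', P.map_tr]
  have hw : E.W.map γ₀ (E.elt l₀) = E.W.map γ (E.elt l) := by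
    rw [hγ, map_comp_apply', E.map_tr]
  rw [hw] at hbw hxw
  rw [hb] at hbw hby
  obtain ⟨n₀, θ₀, hθ₀⟩ := Q.surj (f.app _ (P.elt l))
  obtain ⟨n, hn, δ, rfl⟩ := Q.surj_above y n₀
  obtain ⟨θ, hθ⟩ : ∃ θ : Q.alg n ⟶ P.alg l, f.app _ (P.elt l) = Y.map θ (Q.elt n) :=
    ⟨Q.tr hn ≫ θ₀, by rw [map_comp_apply', Q.map_tr, hθ₀]⟩
  have eW : ∀ {T : SAlgf k} (ξ : P.alg l ⟶ T) (ζ : A ⟶ T),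
      E.desc.app T (X.map ξ (P.elt l)) = E.W.map ζ (E.W.map γ (E.elt l)) ↔
        E.ι l ≫ ξ = γ ≫ ζ := fun {T} ξ ζ => by
    rw [app_map, E.desc_elt, ← map_comp_apply', ← map_comp_apply']
    exact ⟨E.inj l _ _, fun h => by rw [h]⟩
  have eY : ∀ {T : SAlgf k} (ξ : P.alg l ⟶ T) (ζ : A ⟶ T),
      f.app T (X.map ξ (P.elt l)) = Y.map ζ (Y.map δ (Q.elt n)) ↔ θ ≫ ξ = δ ≫ ζ :=
    fun {T} ξ ζ => by
      rw [app_map, hθ, ← map_comp_apply', ← map_comp_apply']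
      exact ⟨Q.inj n _ _, fun h => by rw [h]⟩
  rw [eW] at hbw hxw
  rw [eY] at hby hxy
  -- The elements of `A_l` whose pair of images lies in the image `B₁` of `A` form a subalgebra. It
  -- contains the functions from `W` and from `Y`, as these come from `A`, hence it is everything,
  -- and both lifts factor through `B₁`.
  have htop := eq_top_of_genSub_le P f Q hV hgen θ hθ
    (D := ((homAlg β₁).prod (homAlg γ₁)).range.comap ((homAlg χ).prod (homAlg χ')))
    (fun r hr => by
      obtain ⟨c, rfl⟩ := E.exists_ι_eq l hr
      exact ⟨homAlg θ₁ (homAlg γ c), Prod.ext (congrArg (fun ψ => homAlg ψ c) hbw.symm)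
        (congrArg (fun ψ => homAlg ψ c) hxw.symm)⟩)
    (fun r => ⟨homAlg θ₁ (homAlg δ r), Prod.ext (congrArg (fun ψ => homAlg ψ r) hby.symm)
        (congrArg (fun ψ => homAlg ψ r) hxy.symm)⟩)
  obtain ⟨ω, hωβ, hωγ⟩ := SAlgf.exists_lift_of_jointly_injective β₁ γ₁ hinj χ χ' fun a => by
    obtain ⟨t, ht⟩ := (htop ▸ Algebra.mem_top : a ∈
      ((homAlg β₁).prod (homAlg γ₁)).range.comap ((homAlg χ).prod (homAlg χ')))
    exact ⟨t, congrArg Prod.fst ht, congrArg Prod.snd ht⟩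
  have hext : ∀ {T : SAlgf k} (ξ ζ : T ⟶ B₁), ξ ≫ β₁ = ζ ≫ β₁ → ξ ≫ γ₁ = ζ ≫ γ₁ → ξ = ζ :=
    fun {T} ξ ζ h1 h2 => SAlgf.hom_ext fun r => sub_eq_zero.1 (hinj _
      (by rw [map_sub, sub_eq_zero]; exact congrArg (fun ψ => homAlg ψ r) h1)
      (by rw [map_sub, sub_eq_zero]; exact congrArg (fun ψ => homAlg ψ r) h2))
  have hgood : Good B₁ θ₁ (X.map ω (P.elt l)) := by
    refine ⟨hθ₁, ?_, ?_⟩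
    · rw [hw, eW]
      exact hext _ _ (by rw [Category.assoc, hωβ, hbw, Category.assoc])
        (by rw [Category.assoc, hωγ, hxw, Category.assoc])
    · rw [eY]
      exact hext _ _ (by rw [Category.assoc, hωβ, hby, Category.assoc])
        (by rw [Category.assoc, hωγ, hxy, Category.assoc])
  -- Now `B₁` is a candidate surjecting onto `B`, so by maximality `B₁ → B` is an isomorphism, and
  -- its inverse followed by `B₁ → S` is the factorization.
  have hβs : Function.Surjective (homAlg β₁) := Function.Surjective.of_comp (g := homAlg θ₁) hπ
  obtain ⟨ψ, h1, -⟩ := SAlgf.iso_of_bijective β₁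
    ⟨SAlgf.injective_of_finrank_le β₁ hβs (hmax _ ⟨_, _, _, hgood, rfl⟩), hβs⟩
  refine ⟨ψ ≫ γ₁, ?_, ?_⟩
  · rw [Category.assoc, ← Category.assoc β₁, h1, Category.id_comp]
  · rw [hb, ← hωβ, ← map_comp_apply', Category.assoc, ← Category.assoc β₁, h1, Category.id_comp,
      hωγ]

end Envelope

end

end
end SuperFormal

namespace SuperFormal

noncomputable section

variable {k : Type u} [Field k]

/-! ### Finite presentation and fibers -/

theorem map_component_point {Z : FormalFunctor k} {z : Points Z}
    (z' : Points (component Z z).toFunctor) :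
    Points.map (component Z z).ι z' = z := by
  obtain ⟨R, ⟨a, ha⟩, p, rfl⟩ := z'.exists_mk
  exact ha p

variable [NeZero (2 : k)]

theorem lofp_of_forall_fiberBoundedAt {X Y : FormalFunctor k} (f : X ⟶ Y) (P : Pres X)
    (Q : Pres Y) (h : ∀ x, FiberBoundedAt f x) : LOFP f := by
  choose V hfin hone hinv hgen using fun x => exists_generators P f Q x (h x)
  obtain ⟨E⟩ := nonempty_envelope hinv
  exact ⟨E.W, E.isFormal, E.locallyAlgebraic f Q hfin hone hgen,
    FunctorToTypes.prod.lift E.desc f, E.isClosedImmersion f Q hone hgen, rfl⟩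

theorem lofp_iff {X Y : FormalFunctor k} (f : X ⟶ Y) (P : Pres X) (Q : Pres Y) :
    LOFP f ↔ ∀ x, FiberBoundedAt f x :=
  ⟨fiberBoundedAt_of_lofp Q, lofp_of_forall_fiberBoundedAt f P Q⟩

/-! ### Finite presentation at a point -/

section Component

variable {Z : FormalFunctor k} {z : Points Z}

theorem exists_component_point (P : Pres Z) (z : Points Z) :
    Nonempty (Points (component Z z).toFunctor) := by
  obtain ⟨K, _, η, hη, -⟩ := P.exists_residue_elt z
  exact ⟨Points.mk _ K ⟨η, hη⟩ K.botSpec⟩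

theorem mem_component_component (P : Pres Z) (z' : Points (component Z z).toFunctor) {R : SAlgf k}
    (a : (component Z z).toFunctor.obj R) : a ∈ (component _ z').obj R := fun _ =>
  (isClosedSub_component Z z).points_injective P
    ((map_component_point _).trans (map_component_point _).symm)

/-- By `mem_pointSub_iff`, membership only involves elements over domains in the component, and
these are the same for `Z` and for its component. -/
theorem mem_pointSub_component_iff (P : Pres Z) (z' : Points (component Z z).toFunctor)
    {R : SAlgf k} (a : (component Z z).toFunctor.obj R) :
    a ∈ (pointSub _ z').obj R ↔ (a : Z.obj R) ∈ (pointSub Z z).obj R := by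
  obtain ⟨P'⟩ := P.exists_sub (isClosedSub_component Z z)
  rw [mem_pointSub_iff P', mem_pointSub_iff P]
  constructor
  · rintro ⟨K, hK, η, ψ, -, rfl⟩
    exact ⟨K, hK, η, ψ, η.2, rfl⟩
  · rintro ⟨K, hK, η, ψ, hη, h⟩
    exact ⟨K, hK, ⟨η, hη⟩, ψ, mem_component_component P z' _, Subtype.ext h⟩

end Component

/-- Components are closed, so minimality is unchanged, and all elements of a component lie over its
single point; the bound at `x` is therefore local. -/
theorem fiberBoundedAt_componentMap_iff {X Y : FormalFunctor k} (f : X ⟶ Y) (P : Pres X)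
    (Q : Pres Y) (x : Points X) (x' : Points (component X x).toFunctor) :
    FiberBoundedAt (componentMap f x) x' ↔ FiberBoundedAt f x := by
  have hG := isClosedSub_component X x
  constructor
  · rintro ⟨N, h⟩
    exact ⟨N, fun R a ha hm hp hs => h R ⟨a, ha⟩ (mem_component_component P x' _)
      ((hG.isMinimal_iff _).2 hm) ((mem_pointSub_component_iff Q _ _).2 hp) hs⟩
  · rintro ⟨N, h⟩
    exact ⟨N, fun R a _ hm hp hs => h R a a.2 ((hG.isMinimal_iff _).1 hm)
      ((mem_pointSub_component_iff Q _ _).1 hp) hs⟩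

theorem ofpAt_iff {X Y : FormalFunctor k} (f : X ⟶ Y) (P : Pres X) (Q : Pres Y) (x : Points X) :
    OFPAt f x ↔ FiberBoundedAt f x := by
  obtain ⟨P'⟩ := P.exists_sub (isClosedSub_component X x)
  obtain ⟨Q'⟩ := Q.exists_sub (isClosedSub_component Y (Points.map f x))
  obtain ⟨x'⟩ := exists_component_point P x
  rw [OFPAt, lofp_iff _ P' Q']
  simp only [fiberBoundedAt_componentMap_iff f P Q]
  exact ⟨fun h => h x', fun h _ => h⟩

end
end SuperFormal

theorem propositionP5p7 {k : Type u} [Field k] (hk : ringChar k ≠ 2)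
    {X Y : SuperFormal.FormalFunctor k}
    (hX : SuperFormal.IsFormalSuperscheme X) (hY : SuperFormal.IsFormalSuperscheme Y)
    (f : X ⟶ Y) :
    (∀ x : SuperFormal.Points X,
      ∃ x' : SuperFormal.Points (SuperFormal.fiber f (SuperFormal.Points.map f x)).toFunctor,
        SuperFormal.Points.map
          (SuperFormal.fiber f (SuperFormal.Points.map f x)).ι x' = x ∧
        (∀ x'' : SuperFormal.Points (SuperFormal.fiber f (SuperFormal.Points.map f x)).toFunctor,
          SuperFormal.Points.map
            (SuperFormal.fiber f (SuperFormal.Points.map f x)).ι x'' = x → x'' = x') ∧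
        (SuperFormal.OFPAt f x ↔
          SuperFormal.AlgebraicAt
            (SuperFormal.fiber f (SuperFormal.Points.map f x)).toFunctor x')) ∧
    (SuperFormal.LOFP f ↔
      ∀ y : SuperFormal.Points Y,
        SuperFormal.LocallyAlgebraic (SuperFormal.fiber f y).toFunctor) := by
  have h2 : NeZero (2 : k) := ⟨Ring.two_ne_zero hk⟩
  obtain ⟨P⟩ := hX.nonempty_pres
  obtain ⟨Q⟩ := hY.nonempty_pres
  constructor
  · intro x
    obtain ⟨x', hx'⟩ := SuperFormal.exists_fiber_point f Q x
    refine ⟨x', hx', fun x'' h => SuperFormal.fiber_point_unique f P Q (h.trans hx'.symm), ?_⟩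
    rw [SuperFormal.ofpAt_iff f P Q, SuperFormal.algebraicAt_fiber_iff f P Q, hx']
  · rw [SuperFormal.lofp_iff f P Q, SuperFormal.forall_locallyAlgebraic_fiber_iff f P Q]
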